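/- Let $\Omega\subset\mathbb R^3$ be a bounded domain and let $\Omega_h$ be a finite decomposition of $\Omega$ into disjoint open polyhedra $P\subset\Omega$ whose closures cover $\overline\Omega$. Assume shape regularity: for some $\rho>0$ every element $P$ (every face $F$) is star-shaped with respect to a ball (a disc) of radius at least $\rho h_P$ ($\rho h_F$), where $h$ denotes the diameter, and all edge lengths and face diameters of $P$ are at least $\rho h_P$. $\mathbb P_k$ denotes polynomials of degree at most $k$. For $D$ a face or an element, let $\Upsilon_D^\nabla v\in\mathbb P_1(D)$ be given by $\int_D\nabla(\Upsilon_D^\nabla v-v)\cdot\nabla p=0$ for all $p\in\mathbb P_1(D)$ and $\int_{\partial D}(\Upsilon_D^\nabla v-v)=0$; let $\Pi_D^\Delta v\in\mathbb P_2(D)$ be given by $\int_D\nabla^2(\Pi_D^\Delta v-v):\nabla^2p=0$ for all $p\in\mathbb P_2(D)$ and $\int_{\partial D}(\Pi_D^\Delta v-v)q=0$ for all $q\in\mathbb P_1(D)$; let $\Upsilon_P^0$, $\Pi_P^0$ be the $L^2(P)$-projections onto $\mathbb P_1(P)$, $\mathbb P_2(P)$. *$C^0$ spaces.* $V_h(F)$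 consists of the $v\in H^1(F)\cap C^0(\overline F)$ with $\Delta v\in\mathbb P_1(F)$ (in face coordinates), $v|_e\in\mathbb P_1(e)$ for every edge $e$ of $F$, and $\int_F\Upsilon_F^\nabla v\,q=\int_F v\,q$ for all $q\in\mathbb P_1(F)$. $V_h(P)$ consists of the $v\in H^1(P)$ with $\Delta v\in\mathbb P_1(P)$, $v|_{\partial P}\in C^0(\partial P)$, $v|_F\in V_h(F)$ for every face $F$ of $P$, and $\int_P\Upsilon_P^\nabla v\,q=\int_P v\,q$ for all $q\in\mathbb P_1(P)$. Put $V_h=\{v\in H^1_0(\Omega): v|_P\in V_h(P)\ \forall P\in\Omega_h\}$. *$C^1$ spaces.* $\Psi_h^\nabla(F)$ consists of the $\psi\in H^1(F)$ with $\Delta\psi\in\mathbb P_0(F)$, $\psi|_{\partial F}\in C^0(\partial F)$, $\psi|_e\in\mathbb P_1(e)$ for every edge $e$, and $\int_F\Upsilon_F^\nabla\psi=\int_F\psi$. $\Psi_h^\Delta(F)$ consists of the $\psi\in H^2(F)$ with $\Delta^2\psi\in\mathbb P_1(F)$, $\psi|_{\partial F}\in C^0(\partial F)$, $\psi|_e\in\mathbb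 P_3(e)$, $\nabla\psi|_{\partial F}\in C^0(\partial F)^2$, $\partial_n\psi|_e\in\mathbb P_1(e)$ for every edge $e$, and $\int_F\Pi_F^\Delta\psi\,q=\int_F\psi\,q$ for all $q\in\mathbb P_1(F)$. $\Psi_h(P)$ consists of the $\psi\in H^2(P)$ with $\Delta^2\psi\in\mathbb P_2(P)$, $\psi$ and $\nabla\psi$ continuous on the union of the edges of $P$, $\psi|_F\in\Psi_h^\Delta(F)$ and $\partial_n\psi|_F\in\Psi_h^\nabla(F)$ for every face $F$, and $\int_P\Pi_P^\Delta\psi\,q=\int_P\psi\,q$ for all $q\in\mathbb P_2(P)$. Put $\Psi_h=\{\psi\in H^2(\Omega)\cap H^1_0(\Omega):\psi|_P\in\Psi_h(P)\ \forall P\in\Omega_h\}$. *Forms.* For each $P$ let $s_P^\Delta$, $s_P^\nabla$ be bilinear forms on $\Psi_h(P)$, $V_h(P)$ such that, with positive constants $\alpha_*,\alpha^*,\beta_*,\beta^*$ independent of $P$, $$\alpha_*\!\int_P|\nabla^2\psi|^2\le s_P^\Delta(\psi,\psi)\le\alpha^*\!\int_P|\nabla^2\psi|^2\quad\text{if }\psi\in\Psi_h(P),\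 \Pi_P^\Delta\psi=0,$$ $$\beta_*\!\int_P|\nabla v|^2\le s_P^\nabla(v,v)\le\beta^*\!\int_P|\nabla v|^2\quad\text{if }v\in V_h(P),\ \Upsilon_P^\nabla v=0.$$ Let $$a_h^\Delta(u,\psi)=\sum_P\Big[\int_P\nabla^2\Pi_P^\Delta u:\nabla^2\Pi_P^\Delta\psi+s_P^\Delta(u-\Pi_P^\Delta u,\psi-\Pi_P^\Delta\psi)\Big],$$ $$a_h^\nabla(\sigma,v)=\sum_P\Big[\int_P\nabla\Upsilon_P^\nabla\sigma\cdot\nabla\Upsilon_P^\nabla v+s_P^\nabla(\sigma-\Upsilon_P^\nabla\sigma,v-\Upsilon_P^\nabla v)\Big],$$ $$a_h^0(\sigma,\psi)=\sum_P\int_P\Upsilon_P^0\sigma\;\Pi_P^0\psi,\qquad F_h(v)=-\sum_P\int_P(\Upsilon_P^0f)\,v .$$ **Theorem.** For every $f\in L^2(\Omega)$ there is a unique $(\sigma_h,u_h)\in V_h\times\Psi_h$ with $$a_h^\Delta(u_h,\psi_h)+a_h^\nabla(\sigma_h,v_h)+a_h^0(\sigma_h,\psi_h)=F_h(v_h)\qquad\forall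 v_h\in V_h,\ \forall\psi_h\in\Psi_h.$$ Moreover, $(\sigma_h,u_h)\in V_h\times\Psi_h$ solves this equation if and only if (1) $a_h^\nabla(\sigma_h,v_h)=F_h(v_h)$ for all $v_h\in V_h$ and (2) $a_h^\Delta(u_h,\psi_h)=-a_h^0(\sigma_h,\psi_h)$ for all $\psi_h\in\Psi_h$; problem (1) has a unique solution $\sigma_h\in V_h$, and for each $\sigma_h\in V_h$ problem (2) has a unique solution $u_h\in\Psi_h$. -/

import Mathlib

open MeasureTheory Set
open scoped ContDiff

noncomputable section

namespace VEM

/-! ## Sobolev spaces through weak derivatives -/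

/-- Euclidean space of dimension `d`. -/
abbrev E (d : ℕ) := EuclideanSpace ℝ (Fin d)

/-- `L²(U)`, as a space of classes modulo equality almost everywhere on `U`. -/
abbrev L2 {d : ℕ} (U : Set (E d)) := Lp ℝ 2 (volume.restrict U)

/-- The class in `L²(U)` of a function that is square integrable on `U`. It is also used to restrict
an element of `L²(Ω)` to a subset `U` of `Ω`. -/
def toL2 {d : ℕ} (U : Set (E d)) (u : E d → ℝ) : L2 U :=
  open Classical in
  if h : MemLp u 2 (volume.restrict U) then h.toLp u else 0

/-- Classical partial derivative. -/
def pderiv {d : ℕ} (i : Fin d) (φ : E d → ℝ) (x : E d) : ℝ :=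
  fderiv ℝ φ x (EuclideanSpace.single i 1)

/-- Smooth functions with compact support contained in `U`. -/
def IsTest {d : ℕ} (U : Set (E d)) (φ : E d → ℝ) : Prop :=
  ContDiff ℝ ∞ φ ∧ HasCompactSupport φ ∧ tsupport φ ⊆ U

/-- `w ∈ L²(U)` is the weak `i`-th partial derivative of `u` in `U`. -/
def IsWeakPartial {d : ℕ} (U : Set (E d)) (i : Fin d) (u w : E d → ℝ) : Prop :=
  MemLp w 2 (volume.restrict U) ∧
    ∀ φ, IsTest U φ → ∫ x in U, u x * pderiv i φ x = - ∫ x in U, w x * φ x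

/-- The weak `i`-th partial derivative of `u` in `U` (unique up to null sets when it exists in
`L²(U)`, which is part of the hypothesis wherever this is used). -/
def weakDeriv {d : ℕ} (U : Set (E d)) (i : Fin d) (u : E d → ℝ) : E d → ℝ :=
  open Classical in
  if h : ∃ w, IsWeakPartial U i u w then h.choose else 0

/-- `u ∈ H¹(U)`. -/
def MemH1 {d : ℕ} (U : Set (E d)) (u : E d → ℝ) : Prop :=
  MemLp u 2 (volume.restrict U) ∧ ∀ i, ∃ w, IsWeakPartial U i u w

/-- `u ∈ H²(U)`. -/
def MemH2 {d : ℕ} (U : Set (E d)) (u : E d → ℝ) : Prop :=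
  MemH1 U u ∧ ∀ i, MemH1 U (weakDeriv U i u)

/-- `u ∈ H¹₀(U)`, the closure in `H¹(U)` of the smooth functions with compact support in `U`. -/
def MemH10 {d : ℕ} (U : Set (E d)) (u : E d → ℝ) : Prop :=
  MemH1 U u ∧ ∀ ε : ℝ, 0 < ε → ∃ φ, IsTest U φ ∧
    (∫ x in U, (u x - φ x) ^ 2) + ∑ i, ∫ x in U, (weakDeriv U i u x - pderiv i φ x) ^ 2 < ε

/-- `Δ u = p` in `U`, in the sense of distributions. -/
def HasLaplacian {d : ℕ} (U : Set (E d)) (u p : E d → ℝ) : Prop :=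
  ∀ φ, IsTest U φ →
    ∫ x in U, u x * Laplacian.laplacian φ x = ∫ x in U, p x * φ x

/-- `Δ² u = p` in `U`, in the sense of distributions. -/
def HasBilaplacian {d : ℕ} (U : Set (E d)) (u p : E d → ℝ) : Prop :=
  ∀ φ, IsTest U φ →
    ∫ x in U, u x * Laplacian.laplacian (Laplacian.laplacian φ) x = ∫ x in U, p x * φ x

/-- `∫_U ∇u · ∇v`. -/
def gradForm {d : ℕ} (U : Set (E d)) (u v : E d → ℝ) : ℝ :=
  ∫ x in U, ∑ i, weakDeriv U i u x * weakDeriv U i v x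

/-- `∫_U ∇²u : ∇²v`. -/
def hessForm {d : ℕ} (U : Set (E d)) (u v : E d → ℝ) : ℝ :=
  ∫ x in U, ∑ i, ∑ j,
    weakDeriv U j (weakDeriv U i u) x * weakDeriv U j (weakDeriv U i v) x

/-- Polynomial functions in `d` variables of total degree at most `k`. -/
def Poly (d k : ℕ) : Set (E d → ℝ) :=
  {q | ∃ p : MvPolynomial (Fin d) ℝ, p.totalDegree ≤ k ∧
    ∀ x : E d, q x = MvPolynomial.eval (fun i => x i) p}

/-! ## Traces -/

/-- A set together with the surface measures and the outward unit normals of its flat boundary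
pieces. This is plain data, filled in below for polygons and polyhedra. -/
structure Faceted (d : ℕ) where
  carrier : Set (E d)
  n : ℕ
  meas : Fin n → Measure (E d)
  normal : Fin n → E d

/-- `∫_{∂D} g`. -/
def Faceted.bdryInt {d : ℕ} (D : Faceted d) (g : E d → ℝ) : ℝ :=
  ∑ k, ∫ x, g x ∂(D.meas k)

/-- `g ∈ L²(∂D)` is the trace on `∂D` of `u ∈ H¹(D)`, characterised by Green's formula
`∫_D (u ∂ᵢφ + ∂ᵢu φ) = ∫_{∂D} g φ nᵢ` for all test functions `φ` on the whole space. -/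
def HasTrace {d : ℕ} (D : Faceted d) (u g : E d → ℝ) : Prop :=
  MemH1 D.carrier u ∧ (∀ k, MemLp g 2 (D.meas k)) ∧
    ∀ (i : Fin d) (φ : E d → ℝ), IsTest univ φ →
      ∫ x in D.carrier, (u x * pderiv i φ x + weakDeriv D.carrier i u x * φ x) =
        ∑ k, D.normal k i * ∫ x, g x * φ x ∂(D.meas k)

/-! ## Polynomial projections -/

/-- `q ∈ ℙ₁` is the `H¹`-projection of `v`, normalised by the mean value on `∂D`. -/
def IsGradProj {d : ℕ} (D : Faceted d) (v q : E d → ℝ) : Prop :=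
  q ∈ Poly d 1 ∧
    (∀ p ∈ Poly d 1, gradForm D.carrier (fun x => q x - v x) p = 0) ∧
    ∃ g, HasTrace D v g ∧ D.bdryInt (fun x => q x - g x) = 0

/-- The `H¹`-projection onto `ℙ₁`. -/
def gradProj {d : ℕ} (D : Faceted d) (v : E d → ℝ) : E d → ℝ :=
  open Classical in
  if h : ∃ q, IsGradProj D v q then h.choose else 0

/-- `q ∈ ℙ₂` is the `H²`-projection of `v`, normalised by the moments on `∂D` against `ℙ₁`. -/
def IsHessProj {d : ℕ} (D : Faceted d) (v q : E d → ℝ) : Prop :=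
  q ∈ Poly d 2 ∧
    (∀ p ∈ Poly d 2, hessForm D.carrier (fun x => q x - v x) p = 0) ∧
    ∃ g, HasTrace D v g ∧ ∀ p ∈ Poly d 1, D.bdryInt (fun x => (q x - g x) * p x) = 0

/-- The `H²`-projection onto `ℙ₂`. -/
def hessProj {d : ℕ} (D : Faceted d) (v : E d → ℝ) : E d → ℝ :=
  open Classical in
  if h : ∃ q, IsHessProj D v q then h.choose else 0

/-- `q ∈ ℙₖ` is the `L²(U)`-projection of `v`. -/
def IsL2Proj {d : ℕ} (U : Set (E d)) (k : ℕ) (v q : E d → ℝ) : Prop :=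
  q ∈ Poly d k ∧ ∀ p ∈ Poly d k, ∫ x in U, q x * p x = ∫ x in U, v x * p x

/-- The `L²(U)`-projection onto `ℙₖ`. -/
def l2Proj {d : ℕ} (U : Set (E d)) (k : ℕ) (v : E d → ℝ) : E d → ℝ :=
  open Classical in
  if h : ∃ q, IsL2Proj U k v q then h.choose else 0

/-! ## Polygons and polyhedra -/

/-- `S` is star-shaped with respect to every point of a ball of radius at least `r`. -/
def StarShapedBall {d : ℕ} (S : Set (E d)) (r : ℝ) : Prop :=
  ∃ (c : E d) (r' : ℝ), r ≤ r' ∧ ∀ y ∈ Metric.ball c r', StarConvex ℝ y S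

/-- A bounded open polygon in the plane, lying locally on one side of each of its edges. Collinear
consecutive edges are allowed. -/
structure Polygon where
  carrier : Set (E 2)
  isOpen : IsOpen carrier
  nonempty : carrier.Nonempty
  bounded : Bornology.IsBounded carrier
  /-- the number of edges -/
  n : ℕ
  fst : Fin n → E 2
  snd : Fin n → E 2
  ne : ∀ e, fst e ≠ snd e
  frontier_eq : frontier carrier = ⋃ e, segment ℝ (fst e) (snd e)
  /-- distinct edges can only meet in common endpoints -/
  edges_disjoint : ∀ e e', e ≠ e' →
    Disjoint (openSegment ℝ (fst e) (snd e)) (segment ℝ (fst e') (snd e'))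
  normal : Fin n → E 2
  norm_normal : ∀ e, ‖normal e‖ = 1
  normal_orth : ∀ e, inner ℝ (normal e) (snd e - fst e) = 0
  /-- the normals point outwards -/
  outward : ∀ e, ∀ x ∈ openSegment ℝ (fst e) (snd e), ∃ δ > 0, ∀ t ∈ Ioo (0 : ℝ) δ,
    x - t • normal e ∈ carrier ∧ x + t • normal e ∉ closure carrier

/-- The edge `e` as a set. -/
def Polygon.edge (F : Polygon) (e : Fin F.n) : Set (E 2) :=
  segment ℝ (F.fst e) (F.snd e)

/-- A polygon with the length measures and outward normals of its edges. -/
def Polygon.faceted (F : Polygon) : Faceted 2 where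
  carrier := F.carrier
  n := F.n
  meas e := (ENNReal.ofReal (dist (F.fst e) (F.snd e)) • volume.restrict (Icc (0 : ℝ) 1)).map
    (fun t => AffineMap.lineMap (F.fst e) (F.snd e) t)
  normal := F.normal

/-- A bounded open polyhedron in space, lying locally on one side of each of its faces. A face is
the image of an open polygon under an isometric parametrisation of its plane, which provides the
local face coordinates. -/
structure Polyhedron where
  carrier : Set (E 3)
  isOpen : IsOpen carrier
  nonempty : carrier.Nonempty
  bounded : Bornology.IsBounded carrier
  /-- the number of faces -/
  n : ℕ
  face : Fin n → Polygon
  chart : Fin n → (E 2 →ᵃⁱ[ℝ] E 3)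
  frontier_eq : frontier carrier = ⋃ f, chart f '' closure (face f).carrier
  /-- the interior of a face does not meet the other faces -/
  faces_disjoint : ∀ f f', f ≠ f' →
    Disjoint (chart f '' (face f).carrier) (chart f' '' closure (face f').carrier)
  /-- edges of two faces are equal or meet at most in common endpoints -/
  edges_match : ∀ f f' (e : Fin (face f).n) (e' : Fin (face f').n),
    chart f '' (face f).edge e = chart f' '' (face f').edge e' ∨
    Disjoint (chart f '' openSegment ℝ ((face f).fst e) ((face f).snd e))
      (chart f' '' (face f').edge e')
  normal : Fin n → E 3
  norm_normal : ∀ f, ‖normal f‖ = 1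
  normal_orth : ∀ f y z, inner ℝ (normal f) (chart f y - chart f z) = 0
  /-- the normals point outwards -/
  outward : ∀ f, ∀ x ∈ chart f '' (face f).carrier, ∃ δ > 0, ∀ t ∈ Ioo (0 : ℝ) δ,
    x - t • normal f ∈ carrier ∧ x + t • normal f ∉ closure carrier

/-- A polyhedron with the area measures and outward normals of its faces. -/
def Polyhedron.faceted (P : Polyhedron) : Faceted 3 where
  carrier := P.carrier
  n := P.n
  meas f := (volume.restrict (P.face f).carrier).map (P.chart f)
  normal := P.normal

/-- The skeleton of `P`, the union of its edges. -/
def Polyhedron.skeleton (P : Polyhedron) : Set (E 3) :=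
  ⋃ f, ⋃ e, P.chart f '' (P.face f).edge e

/-! ## The `C⁰` virtual element spaces -/

/-- The `C⁰` virtual element space on a face. -/
def IsC0Face (F : Polygon) (v : E 2 → ℝ) : Prop :=
  MemH1 F.carrier v ∧ ContinuousOn v (closure F.carrier) ∧
  (∃ p ∈ Poly 2 1, HasLaplacian F.carrier v p) ∧
  HasTrace F.faceted v v ∧ (∀ e, ∃ p ∈ Poly 2 1, EqOn v p (F.edge e)) ∧
  ∀ q ∈ Poly 2 1,
    ∫ x in F.carrier, gradProj F.faceted v x * q x = ∫ x in F.carrier, v x * q x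

/-- The `C⁰` virtual element space on a polyhedron; `g` is the continuous trace of `v`. -/
def IsC0Poly (P : Polyhedron) (v : E 3 → ℝ) : Prop :=
  MemH1 P.carrier v ∧
  (∃ p ∈ Poly 3 1, HasLaplacian P.carrier v p) ∧
  (∃ g : E 3 → ℝ, HasTrace P.faceted v g ∧ ContinuousOn g (frontier P.carrier) ∧
    ∀ f, IsC0Face (P.face f) (g ∘ P.chart f)) ∧
  ∀ q ∈ Poly 3 1,
    ∫ x in P.carrier, gradProj P.faceted v x * q x = ∫ x in P.carrier, v x * q x

/-- `V_h(P)`. -/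
def Vloc (P : Polyhedron) : Set (L2 P.carrier) := {v | IsC0Poly P v}

/-! ## The `C¹` virtual element spaces -/

/-- The face space `Ψ_h^∇(f)`, for normal derivatives. -/
def IsC1FaceGrad (F : Polygon) (ψ : E 2 → ℝ) : Prop :=
  MemH1 F.carrier ψ ∧
  (∃ p ∈ Poly 2 0, HasLaplacian F.carrier ψ p) ∧
  (∃ g : E 2 → ℝ, HasTrace F.faceted ψ g ∧ ContinuousOn g (frontier F.carrier) ∧
    ∀ e, ∃ p ∈ Poly 2 1, EqOn g p (F.edge e)) ∧
  ∫ x in F.carrier, gradProj F.faceted ψ x = ∫ x in F.carrier, ψ x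

/-- The face space `Ψ_h^Δ(f)`, for the function itself; `g` is the trace of `ψ` and `G` the trace of
its gradient. -/
def IsC1FaceHess (F : Polygon) (ψ : E 2 → ℝ) : Prop :=
  MemH2 F.carrier ψ ∧
  (∃ p ∈ Poly 2 1, HasBilaplacian F.carrier ψ p) ∧
  (∃ g : E 2 → ℝ, HasTrace F.faceted ψ g ∧ ContinuousOn g (frontier F.carrier) ∧
    ∀ e, ∃ p ∈ Poly 2 3, EqOn g p (F.edge e)) ∧
  (∃ G : Fin 2 → E 2 → ℝ,
    (∀ i, HasTrace F.faceted (weakDeriv F.carrier i ψ) (G i) ∧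
      ContinuousOn (G i) (frontier F.carrier)) ∧
    ∀ e, ∃ p ∈ Poly 2 1, EqOn (fun x => ∑ i, G i x * F.normal e i) p (F.edge e)) ∧
  ∀ q ∈ Poly 2 1,
    ∫ x in F.carrier, hessProj F.faceted ψ x * q x = ∫ x in F.carrier, ψ x * q x

/-- The `C¹` virtual element space on a polyhedron; `g` and `G` are the traces of `ψ` and of `∇ψ`
on the boundary surface, `s` and `S` those on the skeleton, seen from each face. -/
def IsC1Poly (P : Polyhedron) (ψ : E 3 → ℝ) : Prop :=
  MemH2 P.carrier ψ ∧
  (∃ p ∈ Poly 3 2, HasBilaplacian P.carrier ψ p) ∧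
  (∃ (g : E 3 → ℝ) (G : Fin 3 → E 3 → ℝ),
    HasTrace P.faceted ψ g ∧
    (∀ i, HasTrace P.faceted (weakDeriv P.carrier i ψ) (G i)) ∧
    (∃ s : E 3 → ℝ, ContinuousOn s P.skeleton ∧
      ∀ f, HasTrace (P.face f).faceted (g ∘ P.chart f) (s ∘ P.chart f)) ∧
    (∃ S : Fin 3 → E 3 → ℝ, ∀ i, ContinuousOn (S i) P.skeleton ∧
      ∀ f, HasTrace (P.face f).faceted (G i ∘ P.chart f) (S i ∘ P.chart f)) ∧
    ∀ f, IsC1FaceHess (P.face f) (g ∘ P.chart f) ∧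
      IsC1FaceGrad (P.face f) (fun y => ∑ i, G i (P.chart f y) * P.normal f i)) ∧
  ∀ q ∈ Poly 3 2,
    ∫ x in P.carrier, hessProj P.faceted ψ x * q x = ∫ x in P.carrier, ψ x * q x

/-- `Ψ_h(P)`. -/
def Psiloc (P : Polyhedron) : Set (L2 P.carrier) := {ψ | IsC1Poly P ψ}

/-! ## Meshes and global spaces -/

/-- A decomposition of `Ω` into finitely many polyhedra. -/
structure Mesh (Ω : Set (E 3)) where
  /-- the number of elements -/
  n : ℕ
  elt : Fin n → Polyhedron
  subset : ∀ K, (elt K).carrier ⊆ Ω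
  disjoint : ∀ K K', K ≠ K' → Disjoint (elt K).carrier (elt K').carrier
  cover : closure Ω = ⋃ K, closure (elt K).carrier

/-- Shape regularity with constant `ρ`: elements and faces are star-shaped with respect to a ball or
disc of radius comparable with their diameter, and the edge lengths and face diameters are
comparable with the diameter of the element. -/
structure Mesh.ShapeRegular {Ω : Set (E 3)} (M : Mesh Ω) (ρ : ℝ) : Prop where
  elt_star : ∀ K, StarShapedBall (M.elt K).carrier (ρ * Metric.diam (M.elt K).carrier)
  face_star : ∀ K f, StarShapedBall ((M.elt K).face f).carrier
    (ρ * Metric.diam ((M.elt K).face f).carrier)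
  face_diam : ∀ K f, ρ * Metric.diam (M.elt K).carrier ≤
    Metric.diam ((M.elt K).face f).carrier
  edge_length : ∀ K f e, ρ * Metric.diam (M.elt K).carrier ≤
    dist (((M.elt K).face f).fst e) (((M.elt K).face f).snd e)

/-- `V_h`, the functions of `H¹₀(Ω)` that belong to `V_h(P)` on each element. -/
def Mesh.V {Ω : Set (E 3)} (M : Mesh Ω) : Set (L2 Ω) :=
  {v | MemH10 Ω v ∧ ∀ K, toL2 (M.elt K).carrier v ∈ Vloc (M.elt K)}

/-- `Ψ_h`, the functions of `H²(Ω) ∩ H¹₀(Ω)` that belong to `Ψ_h(P)` on each element. -/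
def Mesh.Psi {Ω : Set (E 3)} (M : Mesh Ω) : Set (L2 Ω) :=
  {ψ | MemH2 Ω ψ ∧ MemH10 Ω ψ ∧ ∀ K, toL2 (M.elt K).carrier ψ ∈ Psiloc (M.elt K)}

/-! ## Discrete forms -/

/-- `s` is bilinear on the set `S`, which is a linear subspace wherever this is used; the values of
`s` outside `S` are irrelevant. -/
structure IsBilinOn {M : Type*} [AddCommGroup M] [Module ℝ M] (S : Set M) (s : M → M → ℝ) :
    Prop where
  add_left : ∀ u ∈ S, ∀ v ∈ S, ∀ w ∈ S, s (u + v) w = s u w + s v w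
  smul_left : ∀ c : ℝ, ∀ u ∈ S, ∀ w ∈ S, s (c • u) w = c * s u w
  add_right : ∀ w ∈ S, ∀ u ∈ S, ∀ v ∈ S, s w (u + v) = s w u + s w v
  smul_right : ∀ c : ℝ, ∀ w ∈ S, ∀ u ∈ S, s w (c • u) = c * s w u

/-- A stabilisation `s_P^∇` on `V_h(P)` with stability constants `β₀` and `β₁`; the bounds are only required on the kernel
of the projection. -/
structure IsGradStab (P : Polyhedron) (β₀ β₁ : ℝ) (s : L2 P.carrier → L2 P.carrier → ℝ) :
    Prop where
  bilin : IsBilinOn (Vloc P) s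
  lower : ∀ v ∈ Vloc P, gradProj P.faceted v = 0 → β₀ * gradForm P.carrier v v ≤ s v v
  upper : ∀ v ∈ Vloc P, gradProj P.faceted v = 0 → s v v ≤ β₁ * gradForm P.carrier v v

/-- A stabilisation `s_P^Δ` on `Ψ_h(P)` with stability constants `α₀` and `α₁`; the bounds are only required on the
kernel of the projection. -/
structure IsHessStab (P : Polyhedron) (α₀ α₁ : ℝ) (s : L2 P.carrier → L2 P.carrier → ℝ) :
    Prop where
  bilin : IsBilinOn (Psiloc P) s
  lower : ∀ ψ ∈ Psiloc P, hessProj P.faceted ψ = 0 → α₀ * hessForm P.carrier ψ ψ ≤ s ψ ψ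
  upper : ∀ ψ ∈ Psiloc P, hessProj P.faceted ψ = 0 → s ψ ψ ≤ α₁ * hessForm P.carrier ψ ψ

/-- The local form `a_{P,h}^∇`. -/
def locGrad (P : Polyhedron) (s : L2 P.carrier → L2 P.carrier → ℝ) (σ v : L2 P.carrier) : ℝ :=
  gradForm P.carrier (gradProj P.faceted σ) (gradProj P.faceted v) +
    s (σ - toL2 P.carrier (gradProj P.faceted σ)) (v - toL2 P.carrier (gradProj P.faceted v))

/-- The local form `a_{P,h}^Δ`. -/
def locHess (P : Polyhedron) (s : L2 P.carrier → L2 P.carrier → ℝ) (u ψ : L2 P.carrier) : ℝ :=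
  hessForm P.carrier (hessProj P.faceted u) (hessProj P.faceted ψ) +
    s (u - toL2 P.carrier (hessProj P.faceted u)) (ψ - toL2 P.carrier (hessProj P.faceted ψ))

/-- The local form `a_{P,h}^0`. -/
def locMass (P : Polyhedron) (σ ψ : L2 P.carrier) : ℝ :=
  ∫ x in P.carrier, l2Proj P.carrier 1 σ x * l2Proj P.carrier 2 ψ x

/-- The local load `F_{P,h}`. -/
def locLoad (P : Polyhedron) (f v : L2 P.carrier) : ℝ :=
  - ∫ x in P.carrier, l2Proj P.carrier 1 f x * v x

/-- `a_h^∇`. -/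
def Mesh.aGrad {Ω : Set (E 3)} (M : Mesh Ω)
    (s : ∀ K, L2 (M.elt K).carrier → L2 (M.elt K).carrier → ℝ) (σ v : L2 Ω) : ℝ :=
  ∑ K, locGrad (M.elt K) (s K) (toL2 _ σ) (toL2 _ v)

/-- `a_h^Δ`. -/
def Mesh.aHess {Ω : Set (E 3)} (M : Mesh Ω)
    (s : ∀ K, L2 (M.elt K).carrier → L2 (M.elt K).carrier → ℝ) (u ψ : L2 Ω) : ℝ :=
  ∑ K, locHess (M.elt K) (s K) (toL2 _ u) (toL2 _ ψ)

/-- `a_h^0`. -/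
def Mesh.aMass {Ω : Set (E 3)} (M : Mesh Ω) (σ ψ : L2 Ω) : ℝ :=
  ∑ K, locMass (M.elt K) (toL2 _ σ) (toL2 _ ψ)

/-- `F_h`. -/
def Mesh.load {Ω : Set (E 3)} (M : Mesh Ω) (f v : L2 Ω) : ℝ :=
  ∑ K, locLoad (M.elt K) (toL2 _ f) (toL2 _ v)

end VEM

end

noncomputable section
namespace VEM

/-! ## Smooth functions and test functions -/

variable {d : ℕ} {U : Set (E d)}

/-! The test functions separate the unknowns. With `ψ = 0` the coupled equation is an equation for
`σ_h` alone, with `v = 0` it is an equation for `u_h` in which `σ_h` is a datum, and the sum of the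
two gives the coupled equation back (`decoupled_iff`). Each of the two is a linear system on a
finite-dimensional space with a bilinear form that vanishes on the diagonal only at zero, so it is
uniquely solvable for every right-hand side (`existsUnique_of_definite`). What has to be shown for
`V_h` and `Ψ_h` is that they are linear and finite-dimensional, and that the forms are bilinear and
definite.

Definiteness. On an element the form at `(v, v)` is the energy of `Πv` plus the stabilisation of `v
- Πv`. Since `Π` reproduces polynomials, `v - Πv` lies in its kernel, where the stabilisation
dominates the energy. If the form vanishes, both energies vanish, so the weak gradient (or Hessian)
of `v` is zero on each element, hence almost everywhere in `Ω` because element boundaries are null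
sets. For `V_h`, Poincaré's inequality concludes. For `Ψ_h`, first `∂ᵢ∂ᵢu = 0` and `u ∈ H¹₀` give
`∂ᵢu = 0`.

Finite dimension. A local function is determined by its polynomial Laplacian or bilaplacian together
with polynomial data on faces and edges: uniqueness for the Dirichlet problem, respectively for the
clamped plate, is applied on each face and then in the element. `finite_of_linear_relation` turns
this into a dimension bound.

Uniqueness. A function with vanishing trace extends by zero together with its weak derivatives.
Contracting the extension towards the points of the star ball while mollifying gives a genuine test
function in the domain, whose derivatives are contractions of the original derivatives up to a
factor `1 + τ`. Inserting it into the equation and letting `τ → 0` shows that the energy is zero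
(`ae_eq_zero_of_hasLaplacian_zero`, `ae_eq_zero_of_hasBilaplacian_zero`).

Linearity. The spaces are defined through `Π`, so they are linear only once `Π` is known to exist,
to be unique and to be linear. This needs unique traces, boundary moments that are definite on `ℙ₁`,
and the fact that a polynomial is its own trace. The last is Green's formula on a polyhedron
(`FlatDomain.integral_pderiv`): the domain is cut into cones over its faces, a radial identity is
integrated along rays, and the identities for two different apexes are subtracted. -/

theorem contDiff_pderiv {f : E d → ℝ} (hf : ContDiff ℝ ∞ f) (i : Fin d) :
    ContDiff ℝ ∞ (pderiv i f) :=
  (hf.fderiv_right (m := ∞) (by simp)).clm_apply contDiff_const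

theorem pderiv_add {f g : E d → ℝ} (hf : ContDiff ℝ ∞ f) (hg : ContDiff ℝ ∞ g) (i : Fin d) :
    pderiv i (f + g) = pderiv i f + pderiv i g := by
  funext x
  simp [pderiv, fderiv_add (hf.differentiable (by simp) x) (hg.differentiable (by simp) x)]

theorem pderiv_smul {f : E d → ℝ} (hf : ContDiff ℝ ∞ f) (c : ℝ) (i : Fin d) :
    pderiv i (c • f) = c • pderiv i f := by
  funext x
  simp [pderiv, fderiv_const_smul (hf.differentiable (by simp) x)]

theorem pderiv_mul {f g : E d → ℝ} (hf : ContDiff ℝ ∞ f) (hg : ContDiff ℝ ∞ g) (i : Fin d) :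
    pderiv i (f * g) = pderiv i f * g + f * pderiv i g := by
  funext x
  simp [pderiv, fderiv_mul (hf.differentiable (by simp) x) (hg.differentiable (by simp) x)]
  ring

theorem pderiv_const (c : ℝ) (i : Fin d) : pderiv i (fun _ => c) = 0 := by
  funext x; simp [pderiv]

theorem pderiv_coord (i j : Fin d) :
    pderiv i (fun x : E d => x j) = fun _ => if j = i then 1 else 0 := by
  funext x
  have : (fun x : E d => x j) = ⇑(EuclideanSpace.proj j : E d →L[ℝ] ℝ) := by
    ext y; simp
  rw [pderiv, this, ContinuousLinearMap.fderiv]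
  simp

theorem pderiv_comm {f : E d → ℝ} (hf : ContDiff ℝ ∞ f) (i j : Fin d) :
    pderiv i (pderiv j f) = pderiv j (pderiv i f) := by
  funext x
  have h1 : ∀ k l : Fin d, pderiv k (pderiv l f) x =
      fderiv ℝ (fderiv ℝ f) x (EuclideanSpace.single k 1) (EuclideanSpace.single l 1) := by
    intro k l
    have hd : DifferentiableAt ℝ (fderiv ℝ f) x :=
      (hf.fderiv_right (m := ∞) (by simp)).differentiable (by simp) x
    change fderiv ℝ (fun y => fderiv ℝ f y (EuclideanSpace.single l 1)) x _ = _
    rw [fderiv_clm_apply hd (differentiableAt_const _)]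
    simp
  rw [h1, h1]
  have : IsSymmSndFDerivAt ℝ f x :=
    (hf.contDiffAt (x := x)).isSymmSndFDerivAt (by
      rw [minSmoothness_of_isRCLikeNormedField]; exact WithTop.coe_le_coe.2 le_top)
  exact this _ _

theorem laplacian_eq_sum {f : E d → ℝ} (hf : ContDiff ℝ ∞ f) :
    Laplacian.laplacian f = fun x => ∑ i, pderiv i (pderiv i f) x := by
  rw [InnerProductSpace.laplacian_eq_iteratedFDeriv_orthonormalBasis f
    (EuclideanSpace.basisFun (Fin d) ℝ)]
  funext x
  refine Finset.sum_congr rfl fun i _ => ?_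
  have hd : DifferentiableAt ℝ (fderiv ℝ f) x :=
    (hf.fderiv_right (m := ∞) (by simp)).differentiable (by simp) x
  rw [iteratedFDeriv_two_apply]
  change _ = fderiv ℝ (fun y => fderiv ℝ f y (EuclideanSpace.single i 1)) x _
  rw [fderiv_clm_apply hd (differentiableAt_const _)]
  simp

theorem contDiff_laplacian {f : E d → ℝ} (hf : ContDiff ℝ ∞ f) :
    ContDiff ℝ ∞ (Laplacian.laplacian f) := by
  rw [laplacian_eq_sum hf]
  exact ContDiff.sum fun i _ => contDiff_pderiv (contDiff_pderiv hf i) i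

/-! ### Test functions: closure properties and integration by parts. -/

namespace IsTest

variable {φ ψ : E d → ℝ}

theorem mono {V : Set (E d)} (h : IsTest U φ) (hUV : U ⊆ V) : IsTest V φ :=
  ⟨h.1, h.2.1, h.2.2.trans hUV⟩

theorem univ (h : IsTest U φ) : IsTest univ φ := h.mono (subset_univ _)

theorem eq_zero (h : IsTest U φ) {x : E d} (hx : x ∉ U) : φ x = 0 :=
  image_eq_zero_of_notMem_tsupport fun h' => hx (h.2.2 h')

theorem zero : IsTest U (0 : E d → ℝ) :=
  ⟨contDiff_const, HasCompactSupport.zero, by simp [tsupport]⟩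

theorem pderiv (h : IsTest U φ) (i : Fin d) : IsTest U (pderiv i φ) := by
  refine ⟨contDiff_pderiv h.1 i, ?_, ?_⟩
  · exact (h.2.1.fderiv ℝ).comp_left (g := fun L => L (EuclideanSpace.single i 1)) (by simp)
  · refine Subset.trans (closure_mono ?_) ((tsupport_fderiv_subset ℝ (f := φ)).trans h.2.2)
    intro x hx
    contrapose! hx
    have hx : fderiv ℝ φ x = 0 := by simpa using hx
    simp [VEM.pderiv, hx]

theorem mul_left (h : IsTest U φ) {f : E d → ℝ} (hf : ContDiff ℝ ∞ f) : IsTest U (f * φ) :=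
  ⟨hf.mul h.1, h.2.1.mul_left, (tsupport_mul_subset_right).trans h.2.2⟩

theorem add (h : IsTest U φ) (h' : IsTest U ψ) : IsTest U (φ + ψ) :=
  ⟨h.1.add h'.1, h.2.1.add h'.2.1,
    (tsupport_add φ ψ).trans (union_subset h.2.2 h'.2.2)⟩

theorem smul (h : IsTest U φ) (c : ℝ) : IsTest U (c • φ) := by
  have := h.mul_left (contDiff_const (c := c))
  exact this

theorem sum {ι : Type*} (s : Finset ι) {φ : ι → E d → ℝ} (h : ∀ i, IsTest U (φ i)) :
    IsTest U (fun x => ∑ i ∈ s, φ i x) := by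
  classical
  induction s using Finset.induction_on with
  | empty => simp only [Finset.sum_empty]; exact zero
  | insert a s ha ih => simp only [Finset.sum_insert ha]; exact (h a).add ih

theorem laplacian (h : IsTest U φ) : IsTest U (Laplacian.laplacian φ) := by
  rw [laplacian_eq_sum h.1]
  exact sum _ fun i => (h.pderiv i).pderiv i

theorem memLp (h : IsTest U φ) {p : ENNReal} (μ : Measure (E d)) [IsFiniteMeasureOnCompacts μ] :
    MemLp φ p μ := h.1.continuous.memLp_of_hasCompactSupport h.2.1

theorem integrable (h : IsTest U φ) (μ : Measure (E d)) [IsFiniteMeasureOnCompacts μ] :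
    Integrable φ μ := memLp_one_iff_integrable.1 (h.memLp μ)

/-- The integrand vanishes off `U`, so neither measurability nor integrability matters. This is what
lets weak derivatives be restricted to smaller sets. -/
theorem setIntegral_mul (h : IsTest U φ) (f : E d → ℝ) :
    ∫ x in U, f x * φ x = ∫ x, f x * φ x :=
  setIntegral_eq_integral_of_forall_compl_eq_zero fun x hx => by rw [h.eq_zero hx, mul_zero]

theorem integral_pderiv (h : IsTest U φ) (i : Fin d) : ∫ x, VEM.pderiv i φ x = 0 := by
  -- Integration by parts against the constant `1`.
  have := integral_mul_fderiv_eq_neg_fderiv_mul_of_integrable (μ := (volume : Measure (E d)))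
    (f := fun _ => (1 : ℝ)) (g := φ) (v := EuclideanSpace.single i 1) (by simp)
    (by simp only [one_mul]; exact (h.pderiv i).integrable volume) (by simpa using h.integrable volume)
    (fun _ _ => differentiableAt_const _) (fun x _ => h.1.differentiable (by simp) x)
  simpa [VEM.pderiv] using this

/-- The product `f φ` is again a test function, so the integral of its derivative vanishes. -/
theorem integral_mul_pderiv (h : IsTest U φ) {f : E d → ℝ} (hf : ContDiff ℝ ∞ f) (i : Fin d) :
    ∫ x, f x * VEM.pderiv i φ x = - ∫ x, VEM.pderiv i f x * φ x := by
  have h1 := (h.mul_left hf).integral_pderiv i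
  rw [pderiv_mul hf h.1] at h1
  have h2 : Integrable (fun x => VEM.pderiv i f x * φ x) :=
    (h.mul_left (contDiff_pderiv hf i)).integrable volume
  have h3 : Integrable (fun x => f x * VEM.pderiv i φ x) :=
    ((h.pderiv i).mul_left hf).integrable volume
  have := integral_add h2 h3
  simp only [Pi.add_apply, Pi.mul_apply] at h1
  linarith

end IsTest

theorem memLp_of_continuous {X : Type*} [TopologicalSpace X] [MeasurableSpace X]
    [OpensMeasurableSpace X] {f : X → ℝ}
    (hf : Continuous f) {K : Set X} (hK : IsCompact K) {μ : Measure X}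
    [IsFiniteMeasure μ] (hμ : ∀ᵐ x ∂μ, x ∈ K) {p : ENNReal} : MemLp f p μ := by
  obtain ⟨C, hC⟩ := hK.exists_bound_of_continuousOn hf.continuousOn
  exact MemLp.of_bound hf.aestronglyMeasurable C (hμ.mono fun x hx => hC x hx)

theorem isFiniteMeasure_restrict (hU : Bornology.IsBounded U) :
    IsFiniteMeasure (volume.restrict U) :=
  ⟨by simpa using hU.measure_lt_top⟩

theorem memLp_of_continuous_bounded {f : E d → ℝ} (hf : Continuous f) (hUo : IsOpen U)
    (hU : Bornology.IsBounded U) {p : ENNReal} : MemLp f p (volume.restrict U) :=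
  haveI := isFiniteMeasure_restrict hU
  memLp_of_continuous hf hU.isCompact_closure
    ((ae_restrict_mem hUo.measurableSet).mono fun _ hx => subset_closure hx)

/-! ## Polynomial functions -/

/-- Evaluation of multivariate polynomials on Euclidean space. -/
def evalFun (d : ℕ) : MvPolynomial (Fin d) ℝ →ₗ[ℝ] (E d → ℝ) where
  toFun p x := MvPolynomial.eval (fun i => x i) p
  map_add' p q := by ext x; simp
  map_smul' c p := by ext x; simp [MvPolynomial.smul_eval]

/-- Polynomial functions of degree at most `k`, as a linear subspace. -/
def polySub (d k : ℕ) : Submodule ℝ (E d → ℝ) :=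
  (MvPolynomial.restrictTotalDegree (Fin d) ℝ k).map (evalFun d)

theorem mem_polySub {k : ℕ} {q : E d → ℝ} : q ∈ polySub d k ↔ q ∈ Poly d k := by
  simp only [polySub, Submodule.mem_map, MvPolynomial.mem_restrictTotalDegree, Poly, mem_ofPred_eq]
  refine exists_congr fun p => and_congr_right fun _ => ?_
  rw [funext_iff]
  exact forall_congr' fun x => eq_comm

instance (d k : ℕ) : Module.Finite ℝ (polySub d k) := by
  unfold polySub; infer_instance

namespace Poly

variable {k l : ℕ} {p q : E d → ℝ}

theorem add (hp : p ∈ Poly d k) (hq : q ∈ Poly d k) : p + q ∈ Poly d k :=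
  mem_polySub.1 (add_mem (mem_polySub.2 hp) (mem_polySub.2 hq))

theorem sub (hp : p ∈ Poly d k) (hq : q ∈ Poly d k) : p - q ∈ Poly d k :=
  mem_polySub.1 (sub_mem (mem_polySub.2 hp) (mem_polySub.2 hq))

theorem smul (c : ℝ) (hp : p ∈ Poly d k) : c • p ∈ Poly d k :=
  mem_polySub.1 (Submodule.smul_mem _ c (mem_polySub.2 hp))

theorem zero : (0 : E d → ℝ) ∈ Poly d k := mem_polySub.1 (zero_mem _)

theorem mono (hkl : k ≤ l) (hp : p ∈ Poly d k) : p ∈ Poly d l :=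
  let ⟨P, h, h'⟩ := hp; ⟨P, h.trans hkl, h'⟩

theorem const (c : ℝ) : (fun _ => c) ∈ Poly d k :=
  ⟨MvPolynomial.C c, by simp, by simp⟩

theorem coord (i : Fin d) : (fun x : E d => x i) ∈ Poly d 1 :=
  ⟨MvPolynomial.X i, by simp, by simp⟩

theorem mul (hp : p ∈ Poly d k) (hq : q ∈ Poly d l) : p * q ∈ Poly d (k + l) := by
  obtain ⟨P, h1, h2⟩ := hp
  obtain ⟨Q, h3, h4⟩ := hq
  exact ⟨P * Q, (MvPolynomial.totalDegree_mul _ _).trans (add_le_add h1 h3),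
    fun x => by simp [h2, h4]⟩

theorem sum {ι : Type*} (s : Finset ι) {f : ι → E d → ℝ} (h : ∀ i ∈ s, f i ∈ Poly d k) :
    (fun x => ∑ i ∈ s, f i x) ∈ Poly d k := by
  have := Submodule.sum_mem (polySub d k) (t := s) (f := f) fun i hi => mem_polySub.2 (h i hi)
  rw [mem_polySub] at this
  convert this using 1
  funext x; simp

theorem pow (hp : p ∈ Poly d 1) (n : ℕ) : p ^ n ∈ Poly d n := by
  induction n with
  | zero => exact const 1
  | succ n ih => rw [pow_succ]; exact mul ih hp

theorem prod_pow {ι : Type*} (s : Finset ι) {f : ι → E d → ℝ} (h : ∀ i, f i ∈ Poly d 1)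
    (m : ι → ℕ) : (fun x => ∏ i ∈ s, f i x ^ m i) ∈ Poly d (∑ i ∈ s, m i) := by
  classical
  induction s using Finset.induction_on with
  | empty => simpa using const 1
  | insert a s ha ih =>
    simp only [Finset.prod_insert ha, Finset.sum_insert ha]
    exact mul (pow (h a) (m a)) ih

/-- A monomial evaluated at functions of degree one is a product of as many such functions as its
degree, so the degree does not grow. Needed to restrict polynomials to faces in face coordinates. -/
theorem comp {n : ℕ} (hp : p ∈ Poly d k) {A : E n → E d}
    (hA : ∀ i, (fun y => A y i) ∈ Poly n 1) : p ∘ A ∈ Poly n k := by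
  obtain ⟨P, h1, h2⟩ := hp
  have : p ∘ A = fun y => ∑ s ∈ P.support, MvPolynomial.coeff s P * ∏ i, A y i ^ s i := by
    funext y; simp [h2, MvPolynomial.eval_eq']
  rw [this]
  refine sum _ fun s hs => smul (MvPolynomial.coeff s P) (mono ?_ (prod_pow Finset.univ hA s))
  have := MvPolynomial.le_totalDegree hs
  rw [Finsupp.sum_fintype _ _ (by simp)] at this
  exact this.trans h1

theorem linearMap (f : E d →ₗ[ℝ] ℝ) : ⇑f ∈ Poly d 1 := by
  have : ⇑f = fun x => ∑ i, f (EuclideanSpace.single i 1) * x i := by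
    funext x
    conv_lhs => rw [← (EuclideanSpace.basisFun (Fin d) ℝ).sum_repr x]
    simp [mul_comm]
  rw [this]
  exact sum _ fun i _ => smul _ (coord i)

theorem comp_affine {n : ℕ} (hp : p ∈ Poly d k) (A : E n →ᵃ[ℝ] E d) : p ∘ A ∈ Poly n k := by
  refine comp hp fun i => ?_
  have : (fun y => A y i) = (fun y => (((EuclideanSpace.proj i : E d →L[ℝ] ℝ) : E d →ₗ[ℝ] ℝ) ∘ₗ
      A.linear) y) + fun _ => A 0 i := by
    funext y
    have := congrFun (AffineMap.decomp A) y
    simp [this]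
  rw [this]
  exact add (linearMap _) (const _)

theorem analyticOnNhd (hp : p ∈ Poly d k) : AnalyticOnNhd ℝ p univ := by
  obtain ⟨P, -, h⟩ := hp
  have := AnalyticOnNhd.aeval_mvPolynomial (𝕜 := ℝ) (E := E d) (s := Set.univ) (A := ℝ) (B := ℝ)
    (f := fun x i => x i)
    (fun i => ((EuclideanSpace.proj i : E d →L[ℝ] ℝ).analyticOnNhd _)) P
  have hpe : p = fun x => MvPolynomial.aeval (fun i => x i) P := by
    funext x; rw [h]; simp [MvPolynomial.aeval_eq_eval]
  rw [hpe]
  exact this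

theorem contDiff (hp : p ∈ Poly d k) : ContDiff ℝ ∞ p :=
  (contDiffOn_univ.1 ((analyticOnNhd hp).contDiffOn uniqueDiffOn_univ)).of_le le_top

theorem continuous (hp : p ∈ Poly d k) : Continuous p := (contDiff hp).continuous

theorem eq_of_eqOn (hp : p ∈ Poly d k) (hq : q ∈ Poly d l) (hU : IsOpen U) (hne : U.Nonempty)
    (h : EqOn p q U) : p = q := by
  obtain ⟨x, hx⟩ := hne
  exact (analyticOnNhd hp).eq_of_eventuallyEq (analyticOnNhd hq) (z₀ := x)
    (Filter.eventually_of_mem (hU.mem_nhds hx) h)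

/-- Projections are functions on all of space while integrals see only `U`; the identity theorem for
analytic functions bridges the two. -/
theorem eq_of_ae_eq (hp : p ∈ Poly d k) (hq : q ∈ Poly d l) (hU : IsOpen U) (hne : U.Nonempty)
    (h : p =ᵐ[volume.restrict U] q) : p = q :=
  eq_of_eqOn hp hq hU hne
    (Measure.eqOn_open_of_ae_eq h hU (continuous hp).continuousOn (continuous hq).continuousOn)

/-- The truncated `k - 1` is also right for `k = 0`, since the derivative of a constant is zero. -/
theorem pderiv (hp : p ∈ Poly d k) (i : Fin d) : pderiv i p ∈ Poly d (k - 1) := by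
  obtain ⟨P, h1, h2⟩ := hp
  have key : ∀ Q : MvPolynomial (Fin d) ℝ,
      VEM.pderiv i (evalFun d Q) = evalFun d (MvPolynomial.pderiv i Q) := by
    have hs : ∀ Q, ContDiff ℝ ∞ (evalFun d Q) := fun Q => Poly.contDiff ⟨Q, le_rfl, fun _ => rfl⟩
    intro Q
    induction Q using MvPolynomial.induction_on with
    | C a =>
      have : evalFun d (MvPolynomial.C a) = fun _ => a := by funext x; simp [evalFun]
      rw [this, pderiv_const]; simp
    | add P Q hP hQ => rw [map_add, pderiv_add (hs _) (hs _), hP, hQ, map_add, map_add]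
    | mul_X Q j hQ =>
      have hm : ∀ A B, evalFun d (A * B) = evalFun d A * evalFun d B := by
        intro A B; funext x; simp [evalFun]
      have hX : evalFun d (MvPolynomial.X j) = fun x => x j := by funext x; simp [evalFun]
      rw [hm, pderiv_mul (hs _) (hs _), hQ, hX, pderiv_coord, Derivation.leibniz, map_add,
        smul_eq_mul, smul_eq_mul, hm, hm, hX]
      funext x
      by_cases hij : j = i
      · subst hij; simp [evalFun]; ring
      · simp [evalFun, hij]; ring
  have hP : p = evalFun d P := funext h2
  rw [hP, key]
  refine ⟨MvPolynomial.pderiv i P, ?_, fun _ => rfl⟩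
  rw [← MvPolynomial.support_sum_monomial_coeff P, map_sum]
  refine MvPolynomial.totalDegree_finsetSum_le fun s hs => ?_
  rw [MvPolynomial.pderiv_monomial]
  by_cases hsi : s i = 0
  · simp [hsi]
  refine (MvPolynomial.totalDegree_monomial_le _ _).trans ?_
  have h3 := (MvPolynomial.le_totalDegree hs).trans h1
  -- The truncated subtraction loses nothing because `s i ≠ 0`.
  have h4 : (s - Finsupp.single i 1) + Finsupp.single i 1 = s := by
    ext j
    by_cases hij : i = j
    · subst hij; simp; omega
    · simp [hij]
  have h5 := congrArg (fun t : Fin d →₀ ℕ => t.sum fun _ e => e) h4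
  beta_reduce at h5
  rw [Finsupp.sum_add_index' (by simp) (by simp), Finsupp.sum_single_index rfl] at h5
  have h6 : ((s - Finsupp.single i 1).sum fun _ => id) = (s - Finsupp.single i 1).sum fun _ e => e :=
    rfl
  omega

theorem eq_const (hp : p ∈ Poly d 0) : ∃ c, p = fun _ => c := by
  obtain ⟨P, h1, h2⟩ := hp
  have := MvPolynomial.totalDegree_eq_zero_iff_eq_C.1 (Nat.le_zero.1 h1)
  refine ⟨MvPolynomial.coeff 0 P, ?_⟩
  funext x; rw [h2, this]; simp

end Poly

theorem polySub_memLp {k : ℕ} {q : E d → ℝ} (hq : q ∈ Poly d k) (hUo : IsOpen U)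
    (hU : Bornology.IsBounded U) : MemLp q 2 (volume.restrict U) :=
  memLp_of_continuous_bounded (Poly.continuous hq) hUo hU

/-! ## Weak derivatives -/

variable {d : ℕ} {U V : Set (E d)} {i : Fin d} {u v w w' : E d → ℝ}

theorem integrable_mul {X : Type*} [MeasurableSpace X] {μ : Measure X} {f g : X → ℝ}
    (hf : MemLp f 2 μ) (hg : MemLp g 2 μ) : Integrable (fun x => f x * g x) μ :=
  hf.integrable_mul hg

theorem memLp_lincomb {X : Type*} [MeasurableSpace X] {μ : Measure X} {f g : X → ℝ} {p : ENNReal}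
    (c : ℝ) (hf : MemLp f p μ) (hg : MemLp g p μ) : MemLp (c • f + g) p μ :=
  (hf.const_smul c).add hg

theorem integral_lincomb_mul {X : Type*} [MeasurableSpace X] {μ : Measure X} {f g h : X → ℝ}
    (c : ℝ) (hf : MemLp f 2 μ) (hg : MemLp g 2 μ) (hh : MemLp h 2 μ) :
    ∫ x, (c • f + g) x * h x ∂μ = c * (∫ x, f x * h x ∂μ) + ∫ x, g x * h x ∂μ := by
  rw [← integral_const_mul, ← integral_add ((integrable_mul hf hh).const_mul c)
    (integrable_mul hg hh)]
  refine integral_congr_ae (Filter.Eventually.of_forall fun x => ?_)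
  simp; ring

theorem integral_mul_congr {X : Type*} [MeasurableSpace X] {μ : Measure X} {f g h : X → ℝ}
    (hfg : f =ᵐ[μ] g) : ∫ x, f x * h x ∂μ = ∫ x, g x * h x ∂μ :=
  integral_congr_ae (hfg.mono fun x hx => by simp only [hx])

/-- An equality of predicates in `w`, so that the choice inside `weakDeriv` is literally the same
for both functions. This is why `weakDeriv_congr` is an equality rather than an almost everywhere
statement. -/
theorem isWeakPartial_congr (h : u =ᵐ[volume.restrict U] v) :
    IsWeakPartial U i u = IsWeakPartial U i v := by
  funext w
  simp only [IsWeakPartial, integral_mul_congr h]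

theorem weakDeriv_congr (h : u =ᵐ[volume.restrict U] v) : weakDeriv U i u = weakDeriv U i v := by
  unfold weakDeriv
  rw [isWeakPartial_congr h]

theorem MemH1.congr (hu : MemH1 U u) (h : u =ᵐ[volume.restrict U] v) : MemH1 U v :=
  ⟨hu.1.ae_eq h, fun i => by rw [← isWeakPartial_congr h]; exact hu.2 i⟩

theorem MemH2.congr (hu : MemH2 U u) (h : u =ᵐ[volume.restrict U] v) : MemH2 U v :=
  ⟨hu.1.congr h, fun i => by rw [← weakDeriv_congr h]; exact hu.2 i⟩

theorem weakDeriv_spec (h : ∃ w, IsWeakPartial U i u w) :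
    IsWeakPartial U i u (weakDeriv U i u) := by
  rw [weakDeriv, dif_pos h]; exact h.choose_spec

theorem MemH1.weak (h : MemH1 U u) (i : Fin d) : IsWeakPartial U i u (weakDeriv U i u) :=
  weakDeriv_spec (h.2 i)

theorem MemH1.memLp_weakDeriv (h : MemH1 U u) (i : Fin d) :
    MemLp (weakDeriv U i u) 2 (volume.restrict U) := (h.weak i).1

/-- The fundamental lemma of the calculus of variations for `u - v`, which is locally integrable
because `L²` embeds in `L¹` on compact sets. -/
theorem ae_eq_of_forall_isTest (hU : IsOpen U) (hu : MemLp u 2 (volume.restrict U))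
    (hv : MemLp v 2 (volume.restrict U))
    (h : ∀ φ, IsTest U φ → ∫ x in U, u x * φ x = ∫ x in U, v x * φ x) :
    u =ᵐ[volume.restrict U] v := by
  have hloc : LocallyIntegrableOn (u - v) U volume := by
    refine (locallyIntegrableOn_iff hU.isLocallyClosed).2 fun K hKU hK => ?_
    have hm : MemLp (u - v) 2 (volume.restrict K) :=
      (hu.sub hv).mono_measure (Measure.restrict_mono hKU le_rfl)
    have : IsFiniteMeasure (volume.restrict K) := ⟨by simpa using hK.measure_lt_top⟩
    exact hm.integrable (by norm_num)
  have := hU.ae_eq_zero_of_integral_contDiff_smul_eq_zero hloc fun φ h1 h2 h3 => by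
    have hφ : IsTest U φ := ⟨h1, h2, h3⟩
    have e := hφ.setIntegral_mul (u - v)
    have e2 := integral_lincomb_mul (h := φ) (-1) hv hu (hφ.memLp _)
    simp only [smul_eq_mul]
    calc ∫ x, φ x * (u - v) x = ∫ x, (u - v) x * φ x := by simp only [mul_comm]
      _ = ∫ x in U, ((-1 : ℝ) • v + u) x * φ x := by
        rw [← e]; congr 1; funext x; simp only [Pi.sub_apply, Pi.add_apply, Pi.smul_apply,
          smul_eq_mul]; ring
      _ = 0 := by rw [e2, h φ hφ]; ring
  rw [Filter.EventuallyEq, ae_restrict_iff' hU.measurableSet]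
  filter_upwards [this] with x hx hxU
  exact sub_eq_zero.1 (hx hxU)

theorem IsWeakPartial.unique (hU : IsOpen U) (h : IsWeakPartial U i u w)
    (h' : IsWeakPartial U i u w') : w =ᵐ[volume.restrict U] w' :=
  ae_eq_of_forall_isTest hU h.1 h'.1 fun φ hφ => by linarith [h.2 φ hφ, h'.2 φ hφ]

theorem IsWeakPartial.weakDeriv_ae_eq (hU : IsOpen U) (h : IsWeakPartial U i u w) :
    weakDeriv U i u =ᵐ[volume.restrict U] w :=
  (weakDeriv_spec ⟨w, h⟩).unique hU h

theorem IsWeakPartial.lincomb (c : ℝ) (hu : MemLp u 2 (volume.restrict U))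
    (hv : MemLp v 2 (volume.restrict U)) (h : IsWeakPartial U i u w)
    (h' : IsWeakPartial U i v w') : IsWeakPartial U i (c • u + v) (c • w + w') :=
  ⟨memLp_lincomb c h.1 h'.1, fun φ hφ => by
    rw [integral_lincomb_mul c hu hv ((hφ.pderiv i).memLp _),
      integral_lincomb_mul c h.1 h'.1 (hφ.memLp _), h.2 φ hφ, h'.2 φ hφ]; ring⟩

theorem IsTest.setIntegral_mul_of_subset {φ : E d → ℝ} (hφ : IsTest V φ) (h : V ⊆ U)
    (f : E d → ℝ) : ∫ x in U, f x * φ x = ∫ x in V, f x * φ x := by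
  rw [(hφ.mono h).setIntegral_mul, hφ.setIntegral_mul]

theorem IsWeakPartial.mono (h : IsWeakPartial U i u w) (hVU : V ⊆ U) : IsWeakPartial V i u w :=
  ⟨h.1.mono_measure (Measure.restrict_mono hVU le_rfl), fun φ hφ => by
    rw [← hφ.setIntegral_mul_of_subset hVU, ← (hφ.pderiv i).setIntegral_mul_of_subset hVU]
    exact h.2 φ (hφ.mono hVU)⟩

theorem MemH1.lincomb (c : ℝ) (hu : MemH1 U u) (hv : MemH1 U v) : MemH1 U (c • u + v) :=
  ⟨memLp_lincomb c hu.1 hv.1, fun i => ⟨_, (hu.weak i).lincomb c hu.1 hv.1 (hv.weak i)⟩⟩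

theorem weakDeriv_lincomb (hU : IsOpen U) (c : ℝ) (hu : MemH1 U u) (hv : MemH1 U v) (i : Fin d) :
    weakDeriv U i (c • u + v) =ᵐ[volume.restrict U] c • weakDeriv U i u + weakDeriv U i v :=
  ((hu.weak i).lincomb c hu.1 hv.1 (hv.weak i)).weakDeriv_ae_eq hU

theorem MemH2.lincomb (hU : IsOpen U) (c : ℝ) (hu : MemH2 U u) (hv : MemH2 U v) :
    MemH2 U (c • u + v) :=
  ⟨hu.1.lincomb c hv.1, fun i =>
    ((hu.2 i).lincomb c (hv.2 i)).congr (weakDeriv_lincomb hU c hu.1 hv.1 i).symm⟩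

theorem weakDeriv_weakDeriv_lincomb (hU : IsOpen U) (c : ℝ) (hu : MemH2 U u) (hv : MemH2 U v)
    (i j : Fin d) :
    weakDeriv U j (weakDeriv U i (c • u + v)) =ᵐ[volume.restrict U]
      c • weakDeriv U j (weakDeriv U i u) + weakDeriv U j (weakDeriv U i v) := by
  rw [weakDeriv_congr (weakDeriv_lincomb hU c hu.1 hv.1 i)]
  exact weakDeriv_lincomb hU c (hu.2 i) (hv.2 i) j

theorem MemH1.weakDeriv_mono (hu : MemH1 U u) (hV : IsOpen V) (h : V ⊆ U) (i : Fin d) :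
    weakDeriv V i u =ᵐ[volume.restrict V] weakDeriv U i u :=
  ((hu.weak i).mono h).weakDeriv_ae_eq hV

theorem isWeakPartial_of_contDiff (hUo : IsOpen U) (hU : Bornology.IsBounded U)
    (hf : ContDiff ℝ ∞ u) (i : Fin d) : IsWeakPartial U i u (pderiv i u) := by
  refine ⟨memLp_of_continuous_bounded (contDiff_pderiv hf i).continuous hUo hU, fun φ hφ => ?_⟩
  rw [(hφ.pderiv i).setIntegral_mul, hφ.setIntegral_mul, hφ.integral_mul_pderiv hf]

theorem memH1_of_contDiff (hUo : IsOpen U) (hU : Bornology.IsBounded U)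
    (hf : ContDiff ℝ ∞ u) : MemH1 U u :=
  ⟨memLp_of_continuous_bounded hf.continuous hUo hU,
    fun i => ⟨_, isWeakPartial_of_contDiff hUo hU hf i⟩⟩

theorem weakDeriv_of_contDiff (hUo : IsOpen U) (hU : Bornology.IsBounded U)
    (hf : ContDiff ℝ ∞ u) (i : Fin d) :
    weakDeriv U i u =ᵐ[volume.restrict U] pderiv i u :=
  (isWeakPartial_of_contDiff hUo hU hf i).weakDeriv_ae_eq hUo

theorem memH2_of_contDiff (hUo : IsOpen U) (hU : Bornology.IsBounded U)
    (hf : ContDiff ℝ ∞ u) : MemH2 U u :=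
  ⟨memH1_of_contDiff hUo hU hf, fun i =>
    (memH1_of_contDiff hUo hU (contDiff_pderiv hf i)).congr
      (weakDeriv_of_contDiff hUo hU hf i).symm⟩

theorem weakDeriv_weakDeriv_of_contDiff (hUo : IsOpen U) (hU : Bornology.IsBounded U)
    (hf : ContDiff ℝ ∞ u) (i j : Fin d) :
    weakDeriv U j (weakDeriv U i u) =ᵐ[volume.restrict U] pderiv j (pderiv i u) := by
  rw [weakDeriv_congr (weakDeriv_of_contDiff hUo hU hf i)]
  exact weakDeriv_of_contDiff hUo hU (contDiff_pderiv hf i) j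

/-- Tested against `φ`, both sides become the integral of `u` against a mixed second derivative of
`φ`, and classical mixed derivatives commute. -/
theorem MemH2.weakDeriv_comm (hU : IsOpen U) (hu : MemH2 U u) (i j : Fin d) :
    weakDeriv U j (weakDeriv U i u) =ᵐ[volume.restrict U] weakDeriv U i (weakDeriv U j u) := by
  refine ae_eq_of_forall_isTest hU ((hu.2 i).memLp_weakDeriv j) ((hu.2 j).memLp_weakDeriv i)
    fun φ hφ => ?_
  have h1 := ((hu.2 i).weak j).2 φ hφ
  have h2 := ((hu.2 j).weak i).2 φ hφ
  have h3 := (hu.1.weak i).2 _ (hφ.pderiv j)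
  have h4 := (hu.1.weak j).2 _ (hφ.pderiv i)
  rw [pderiv_comm hφ.1] at h3
  linarith

/-! ## The Laplacian and the bilaplacian -/

theorem HasLaplacian.congr {p : E d → ℝ} (h : HasLaplacian U u p)
    (huv : u =ᵐ[volume.restrict U] v) : HasLaplacian U v p := fun φ hφ => by
  rw [← h φ hφ, integral_mul_congr huv]

theorem HasBilaplacian.congr {p : E d → ℝ} (h : HasBilaplacian U u p)
    (huv : u =ᵐ[volume.restrict U] v) : HasBilaplacian U v p := fun φ hφ => by
  rw [← h φ hφ, integral_mul_congr huv]

theorem HasLaplacian.lincomb {p q : E d → ℝ} (c : ℝ) (hu : MemLp u 2 (volume.restrict U))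
    (hv : MemLp v 2 (volume.restrict U)) (hp : MemLp p 2 (volume.restrict U))
    (hq : MemLp q 2 (volume.restrict U)) (h : HasLaplacian U u p) (h' : HasLaplacian U v q) :
    HasLaplacian U (c • u + v) (c • p + q) := fun φ hφ => by
  rw [integral_lincomb_mul c hu hv (hφ.laplacian.memLp _),
    integral_lincomb_mul c hp hq (hφ.memLp _), h φ hφ, h' φ hφ]

theorem HasBilaplacian.lincomb {p q : E d → ℝ} (c : ℝ) (hu : MemLp u 2 (volume.restrict U))
    (hv : MemLp v 2 (volume.restrict U)) (hp : MemLp p 2 (volume.restrict U))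
    (hq : MemLp q 2 (volume.restrict U)) (h : HasBilaplacian U u p) (h' : HasBilaplacian U v q) :
    HasBilaplacian U (c • u + v) (c • p + q) := fun φ hφ => by
  rw [integral_lincomb_mul c hu hv (hφ.laplacian.laplacian.memLp _),
    integral_lincomb_mul c hp hq (hφ.memLp _), h φ hφ, h' φ hφ]

theorem hasLaplacian_of_contDiff (hu : ContDiff ℝ ∞ u) :
    HasLaplacian U u (Laplacian.laplacian u) := fun φ hφ => by
  rw [hφ.laplacian.setIntegral_mul, hφ.setIntegral_mul, laplacian_eq_sum hu,
    laplacian_eq_sum hφ.1]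
  simp only [Finset.mul_sum, Finset.sum_mul]
  have h1 : ∀ i, Integrable fun x => u x * pderiv i (pderiv i φ) x := fun i =>
    (((hφ.pderiv i).pderiv i).mul_left hu).integrable volume
  have h2 : ∀ i, Integrable fun x => pderiv i (pderiv i u) x * φ x := fun i =>
    (hφ.mul_left (contDiff_pderiv (contDiff_pderiv hu i) i)).integrable volume
  rw [integral_finsetSum _ fun i _ => h1 i, integral_finsetSum _ fun i _ => h2 i]
  refine Finset.sum_congr rfl fun i _ => ?_
  rw [(hφ.pderiv i).integral_mul_pderiv hu, hφ.integral_mul_pderiv (contDiff_pderiv hu i), neg_neg]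

theorem hasBilaplacian_of_contDiff (hu : ContDiff ℝ ∞ u) :
    HasBilaplacian U u (Laplacian.laplacian (Laplacian.laplacian u)) := fun φ hφ => by
  rw [hasLaplacian_of_contDiff hu _ hφ.laplacian,
    hasLaplacian_of_contDiff (contDiff_laplacian hu) _ hφ]

theorem laplacian_mem_poly {k : ℕ} {q : E d → ℝ} (hq : q ∈ Poly d k) :
    Laplacian.laplacian q ∈ Poly d (k - 2) := by
  rw [laplacian_eq_sum (Poly.contDiff hq)]
  exact Poly.sum _ fun i _ => Poly.pderiv (Poly.pderiv hq i) i

theorem pderiv_eq_zero {q : E d → ℝ} (hq : q ∈ Poly d 0) (i : Fin d) : pderiv i q = 0 := by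
  obtain ⟨c, rfl⟩ := Poly.eq_const hq
  exact pderiv_const c i

/-! ## Traces -/

theorem HasTrace.congr {D : Faceted d} {g : E d → ℝ} (h : HasTrace D u g)
    (huv : u =ᵐ[volume.restrict D.carrier] v) : HasTrace D v g := by
  refine ⟨h.1.congr huv, h.2.1, fun i φ hφ => ?_⟩
  rw [← h.2.2 i φ hφ, ← weakDeriv_congr huv]
  exact integral_congr_ae (huv.mono fun x hx => by simp only [hx])

theorem HasTrace.lincomb {D : Faceted d} {g g' : E d → ℝ} (hD : IsOpen D.carrier)
    [∀ k, IsFiniteMeasure (D.meas k)] (c : ℝ)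
    (h : HasTrace D u g) (h' : HasTrace D v g') : HasTrace D (c • u + v) (c • g + g') := by
  refine ⟨h.1.lincomb c h'.1, fun k => memLp_lincomb c (h.2.1 k) (h'.2.1 k), fun i φ hφ => ?_⟩
  have e : ∀ {u}, MemH1 D.carrier u →
      ∫ x in D.carrier, (u x * pderiv i φ x + weakDeriv D.carrier i u x * φ x) =
      (∫ x in D.carrier, u x * pderiv i φ x) + ∫ x in D.carrier, weakDeriv D.carrier i u x * φ x :=
    fun hu => integral_add (integrable_mul hu.1 ((hφ.pderiv i).memLp _))
      (integrable_mul (hu.memLp_weakDeriv i) (hφ.memLp _))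
  have h1 := h.2.2 i φ hφ
  have h2 := h'.2.2 i φ hφ
  rw [e h.1] at h1
  rw [e h'.1] at h2
  rw [e (h.1.lincomb c h'.1), integral_lincomb_mul c h.1.1 h'.1.1 ((hφ.pderiv i).memLp _),
    integral_mul_congr (weakDeriv_lincomb hD c h.1 h'.1 i),
    integral_lincomb_mul c (h.1.memLp_weakDeriv i) (h'.1.memLp_weakDeriv i) (hφ.memLp _)]
  have h3 : ∑ k, D.normal k i * ∫ x, (c • g + g') x * φ x ∂(D.meas k) =
      c * (∑ k, D.normal k i * ∫ x, g x * φ x ∂(D.meas k)) +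
        ∑ k, D.normal k i * ∫ x, g' x * φ x ∂(D.meas k) := by
    rw [Finset.mul_sum, ← Finset.sum_add_distrib]
    refine Finset.sum_congr rfl fun k _ => ?_
    rw [integral_lincomb_mul c (h.2.1 k) (h'.2.1 k) (hφ.memLp _)]
    ring
  rw [h3, ← h1, ← h2]
  ring

/-! ## Integration over cones -/

variable {d : ℕ}

/-- The normal and the images of the standard basis under `L` form an orthonormal basis, whose
coordinate map preserves volume. This is Fubini's theorem across a hyperplane. -/
theorem exists_hyperplane_equiv (L : E d →ₗᵢ[ℝ] E (d + 1)) {n : E (d + 1)} (hn : ‖n‖ = 1)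
    (hL : ∀ y, inner ℝ n (L y) = 0) :
    ∃ Θ : ℝ × E d ≃ᵐ E (d + 1), MeasurePreserving Θ volume volume ∧
      ∀ s y, Θ (s, y) = s • n + L y := by
  let v : Fin (d + 1) → E (d + 1) :=
    Fin.cons n fun i => L (EuclideanSpace.single i 1)
  have hv : Orthonormal ℝ v := by
    rw [orthonormal_iff_ite]
    intro i j
    refine Fin.cases ?_ (fun i => ?_) i <;> refine Fin.cases ?_ (fun j => ?_) j
    · simp [v, hn]
    · simp [v, hL, (Fin.succ_ne_zero j).symm]
    · simp [v, real_inner_comm n, hL]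
    · have := orthonormal_iff_ite.1 (EuclideanSpace.basisFun (Fin d) ℝ).orthonormal i j
      simpa [v, L.inner_map_map] using this
  let b := (basisOfOrthonormalOfCardEqFinrank hv (by simp)).toOrthonormalBasis (by
    rw [coe_basisOfOrthonormalOfCardEqFinrank]; exact hv)
  have hb : ∀ i, b i = v i := fun i => by simp [b]
  let Θ : ℝ × E d ≃ᵐ E (d + 1) :=
    (((MeasurableEquiv.refl ℝ).prodCongr (MeasurableEquiv.toLp 2 (Fin d → ℝ)).symm).trans
      (MeasurableEquiv.piFinSuccAbove (fun _ => ℝ) 0).symm).trans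
      ((MeasurableEquiv.toLp 2 (Fin (d + 1) → ℝ)).trans b.repr.symm.toMeasurableEquiv)
  refine ⟨Θ, ?_, ?_⟩
  · have h1 : MeasurePreserving ((MeasurableEquiv.refl ℝ).prodCongr
        (MeasurableEquiv.toLp 2 (Fin d → ℝ)).symm) (volume : Measure (ℝ × E d)) volume :=
      (MeasurePreserving.id _).prod (EuclideanSpace.volume_preserving_symm_measurableEquiv_toLp _)
    have h2 := (volume_preserving_piFinSuccAbove (fun _ : Fin (d + 1) => ℝ) 0).symm
    exact (b.measurePreserving_repr_symm.comp (PiLp.volume_preserving_toLp _)).comp (h2.comp h1)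
  · intro s y
    have : Θ (s, y) = b.repr.symm (WithLp.toLp 2 (Fin.cons s y.ofLp)) := by
      change b.repr.symm (WithLp.toLp 2 (Fin.insertNth 0 s y.ofLp)) = _
      rw [Fin.insertNth_zero']
    rw [this, ← OrthonormalBasis.sum_repr_symm, Fin.sum_univ_succ]
    have hy : L y = ∑ i, y i • L (EuclideanSpace.single i 1) := by
      conv_lhs => rw [← (EuclideanSpace.basisFun (Fin d) ℝ).sum_repr y]
      simp
    simp [hb, v, hy]

/-- The open cone with apex `c` over the image of `S` under `χ`. -/
def cone (χ : E d → E (d + 1)) (c : E (d + 1)) (S : Set (E d)) : Set (E (d + 1)) :=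
  {x | ∃ t ∈ Ioo (0 : ℝ) 1, ∃ y ∈ S, x = c + t • (χ y - c)}

section Cone

variable {χ : E d →ᵃⁱ[ℝ] E (d + 1)} {n c : E (d + 1)} {h : ℝ} {S : Set (E d)}

/-- Coordinates in which the slice of the cone at height `s` above the apex is the base scaled by `s
/ h`. The point `y₀` is the parameter of the foot of the perpendicular from `c` to the plane of the
base. -/
theorem exists_cone_equiv (hn : ‖n‖ = 1) (hχ : ∀ y z, inner ℝ n (χ y - χ z) = 0)
    (hh : ∀ y, inner ℝ n (χ y - c) = h) (hpos : 0 < h) :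
    ∃ (Θ : ℝ × E d ≃ᵐ E (d + 1)) (y₀ : E d), MeasurePreserving Θ volume volume ∧
      (∀ s y, 0 < s → c + Θ (s, y) = c + (s / h) • (χ ((h / s) • y + y₀) - c)) ∧
      ∀ S s y, c + Θ (s, y) ∈ cone χ c S ↔ s ∈ Ioo 0 h ∧ (h / s) • y + y₀ ∈ S := by
  have hL : ∀ y z, χ (y + z) = χ.linearIsometry y + χ z := fun y z => χ.map_vadd z y
  have hLn : ∀ y, inner ℝ n (χ.linearIsometry y) = 0 := by
    intro y
    have := hχ (y + 0) 0
    rwa [hL, add_sub_cancel_right] at this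
  obtain ⟨Θ, hΘ, hΘe⟩ := exists_hyperplane_equiv χ.linearIsometry hn hLn
  obtain ⟨⟨s₀, y₀⟩, h₀⟩ := Θ.surjective (c + h • n - χ 0)
  rw [hΘe] at h₀
  have hs₀ : s₀ = 0 := by
    have h1 := congrArg (inner ℝ n) h₀
    have h2 := hh 0
    rw [inner_sub_right] at h2
    simp only [inner_add_right, inner_sub_right, inner_smul_right, hLn,
      real_inner_self_eq_norm_sq, hn] at h1
    linarith
  subst hs₀
  have hy₀ : χ y₀ = c + h • n := by
    have := hL y₀ 0
    rw [add_zero] at this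
    rw [this]
    simp only [zero_smul, zero_add] at h₀
    rw [h₀]; abel
  have key : ∀ y, χ (y + y₀) - c = h • n + χ.linearIsometry y := fun y => by
    rw [hL, hy₀]; abel
  refine ⟨Θ, y₀, hΘ, fun s y hs => ?_, fun S s y => ⟨?_, ?_⟩⟩
  · rw [key, hΘe, map_smul, smul_add, smul_smul, smul_smul, div_mul_cancel₀ _ hpos.ne',
      div_mul_div_cancel₀ hpos.ne', div_self hs.ne', one_smul]
  · rintro ⟨t, ht, z, hz, he⟩
    have h1 : Θ (s, y) = Θ (t * h, t • (z - y₀)) := by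
      rw [hΘe (t * h), map_smul, mul_smul, ← smul_add, ← key, sub_add_cancel]
      exact add_left_cancel he
    have h2 := Θ.injective h1
    simp only [Prod.mk.injEq] at h2
    obtain ⟨rfl, rfl⟩ := h2
    refine ⟨⟨mul_pos ht.1 hpos, mul_lt_of_lt_one_left hpos ht.2⟩, ?_⟩
    have : h / (t * h) * t = 1 := by have := ht.1.ne'; field_simp
    rwa [smul_smul, this, one_smul, sub_add_cancel]
  · rintro ⟨hs, hy⟩
    refine ⟨s / h, ⟨div_pos hs.1 hpos, (div_lt_one hpos).2 hs.2⟩, _, hy, ?_⟩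
    rw [key, hΘe, map_smul, smul_add, smul_smul, smul_smul, div_mul_cancel₀ _ hpos.ne',
      div_mul_div_cancel₀ hpos.ne', div_self hs.1.ne', one_smul]

theorem measurableSet_cone (hn : ‖n‖ = 1) (hχ : ∀ y z, inner ℝ n (χ y - χ z) = 0)
    (hh : ∀ y, inner ℝ n (χ y - c) = h) (hpos : 0 < h) (hS : MeasurableSet S) :
    MeasurableSet (cone χ c S) := by
  obtain ⟨Θ, y₀, -, -, hmem⟩ := exists_cone_equiv hn hχ hh hpos
  have h1 : MeasurableSet {p : ℝ × E d | p.1 ∈ Ioo 0 h ∧ (h / p.1) • p.2 + y₀ ∈ S} := by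
    refine (measurable_fst measurableSet_Ioo).inter ?_
    have : Measurable fun p : ℝ × E d => (h / p.1) • p.2 + y₀ := by fun_prop
    exact this hS
  have h2 : cone χ c S = (fun x => Θ.symm (-c + x)) ⁻¹'
      {p : ℝ × E d | p.1 ∈ Ioo 0 h ∧ (h / p.1) • p.2 + y₀ ∈ S} := by
    ext x
    have := hmem S (Θ.symm (-c + x)).1 (Θ.symm (-c + x)).2
    simp only [Prod.mk.eta, MeasurableEquiv.apply_symm_apply, add_neg_cancel_left] at this
    exact this
  rw [h2]
  exact (Θ.symm.measurable.comp (measurable_const_add (-c))) h1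

theorem volume_cone_eq_zero (hn : ‖n‖ = 1) (hχ : ∀ y z, inner ℝ n (χ y - χ z) = 0)
    (hh : ∀ y, inner ℝ n (χ y - c) = h) (hpos : 0 < h) (hS : MeasurableSet S)
    (hS0 : volume S = 0) : volume (cone χ c S) = 0 := by
  obtain ⟨Θ, y₀, hΘ, -, hmem⟩ := exists_cone_equiv hn hχ hh hpos
  have hm := measurableSet_cone hn hχ hh hpos hS
  rw [← measure_preimage_add volume c (cone χ c S), ← hΘ.measure_preimage_equiv]
  rw [show (volume : Measure (ℝ × E d)) = (volume : Measure ℝ).prod volume from rfl,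
    Measure.measure_prod_null (Θ.measurable ((measurable_const_add c) hm))]
  refine Filter.Eventually.of_forall fun s => ?_
  by_cases hs : s ∈ Ioo 0 h
  · have : Prod.mk s ⁻¹' (Θ ⁻¹' ((fun x => c + x) ⁻¹' cone χ c S)) =
        (fun y => (h / s) • y) ⁻¹' ((fun y => y + y₀) ⁻¹' S) := by
      ext y
      simp only [mem_preimage, hmem, hs, true_and]
    simp only [this, Pi.zero_apply]
    rw [Measure.addHaar_preimage_smul _ (div_pos hpos hs.1).ne', measure_preimage_add_right, hS0,
      mul_zero]
  · have : Prod.mk s ⁻¹' (Θ ⁻¹' ((fun x => c + x) ⁻¹' cone χ c S)) = ∅ := by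
      ext y
      simp only [mem_preimage, hmem, hs, false_and, mem_empty_iff_false]
    simp [this]

/-- Fubini over the height: scaling the slice by `s / h` contributes `(s / h) ^ d`, where `d` is the
dimension of the base, and substituting `t = s / h` produces the factor `h`. -/
theorem setIntegral_cone (hn : ‖n‖ = 1) (hχ : ∀ y z, inner ℝ n (χ y - χ z) = 0)
    (hh : ∀ y, inner ℝ n (χ y - c) = h) (hpos : 0 < h) (hS : MeasurableSet S)
    {f : E (d + 1) → ℝ} (hf : IntegrableOn f (cone χ c S)) :
    ∫ x in cone χ c S, f x =
      h * ∫ t in (0 : ℝ)..1, t ^ d * ∫ y in S, f (c + t • (χ y - c)) := by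
  obtain ⟨Θ, y₀, hΘ, hΘe, hmem⟩ := exists_cone_equiv hn hχ hh hpos
  have hm := measurableSet_cone hn hχ hh hpos hS
  rw [← integral_indicator hm, ← integral_add_left_eq_self _ c,
    ← hΘ.integral_comp' (g := fun x => (cone χ c S).indicator f (c + x))]
  have hi : Integrable fun p => (cone χ c S).indicator f (c + Θ p) :=
    hΘ.integrable_comp_of_integrable (g := fun x => (cone χ c S).indicator f (c + x))
      (((integrable_indicator_iff hm).2 hf).comp_add_left c)
  rw [show (volume : Measure (ℝ × E d)) = (volume : Measure ℝ).prod volume from rfl] at hi ⊢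
  rw [integral_prod _ hi]
  have hslice : ∀ s, ∫ y, (cone χ c S).indicator f (c + Θ (s, y)) =
      (Ioo 0 h).indicator
        (fun s => (s / h) ^ d * ∫ y in S, f (c + (s / h) • (χ y - c))) s := by
    intro s
    by_cases hs : s ∈ Ioo 0 h
    · rw [indicator_of_mem hs, ← integral_indicator hS]
      have e1 : ∀ y, (cone χ c S).indicator f (c + Θ (s, y)) =
          S.indicator (fun y => f (c + (s / h) • (χ y - c))) ((h / s) • y + y₀) := by
        intro y
        by_cases hy : (h / s) • y + y₀ ∈ S
        · rw [indicator_of_mem hy, indicator_of_mem ((hmem S s y).2 ⟨hs, hy⟩), hΘe s y hs.1]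
        · rw [indicator_of_notMem hy, indicator_of_notMem fun hc => hy ((hmem S s y).1 hc).2]
      simp only [e1]
      rw [Measure.integral_comp_smul volume
        (fun y => S.indicator (fun y => f (c + (s / h) • (χ y - c))) (y + y₀)) (h / s),
        integral_add_right_eq_self]
      have : |((h / s) ^ Module.finrank ℝ (E d))⁻¹| = (s / h) ^ d := by
        have h0 : 0 ≤ s / h := (div_pos hs.1 hpos).le
        rw [finrank_euclideanSpace_fin, ← inv_pow, inv_div, abs_of_nonneg (pow_nonneg h0 d)]
      rw [this, smul_eq_mul]
    · rw [indicator_of_notMem hs]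
      refine integral_eq_zero_of_ae (Filter.Eventually.of_forall fun y => ?_)
      exact indicator_of_notMem (fun hc => hs ((hmem S s y).1 hc).1) _
  simp only [hslice]
  rw [integral_indicator measurableSet_Ioo, ← integral_Ioc_eq_integral_Ioo,
    ← intervalIntegral.integral_of_le hpos.le,
    intervalIntegral.integral_comp_div
      (fun t => t ^ d * ∫ y in S, f (c + t • (χ y - c))) hpos.ne',
    zero_div, div_self hpos.ne', smul_eq_mul]

end Cone

/-! ## The divergence theorem on star-shaped domains with flat boundary pieces -/

/-- A bounded open set whose boundary consists of finitely many flat pieces. -/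
structure FlatDomain {d : ℕ} (D : Faceted (d + 1)) where
  chart : Fin D.n → (E d →ᵃⁱ[ℝ] E (d + 1))
  base : Fin D.n → Set (E d)
  base_open : ∀ k, IsOpen (base k)
  base_bounded : ∀ k, Bornology.IsBounded (base k)
  base_frontier : ∀ k, volume (frontier (base k)) = 0
  meas_eq : ∀ k, D.meas k = (volume.restrict (base k)).map (chart k)
  isOpen : IsOpen D.carrier
  nonempty : D.carrier.Nonempty
  bounded : Bornology.IsBounded D.carrier
  frontier_eq : frontier D.carrier = ⋃ k, chart k '' closure (base k)
  disjoint : ∀ k l, k ≠ l → Disjoint (chart k '' base k) (chart l '' closure (base l))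
  norm_normal : ∀ k, ‖D.normal k‖ = 1
  normal_orth : ∀ k y z, inner ℝ (D.normal k) (chart k y - chart k z) = 0
  outward : ∀ k, ∀ x ∈ chart k '' base k, ∃ δ > 0, ∀ t ∈ Ioo (0 : ℝ) δ,
    x - t • D.normal k ∈ D.carrier ∧ x + t • D.normal k ∉ closure D.carrier

/-- The point `z` is only in the closure, so it is replaced by a nearby `w ∈ S`. The resulting error
is absorbed by moving the star centre, which is possible because the centres form an open ball. -/
theorem star_mem {d : ℕ} {S : Set (E d)} {c y z : E d} {r : ℝ}
    (hs : ∀ y ∈ Metric.ball c r, StarConvex ℝ y S) (hz : z ∈ closure S)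
    (hy : y ∈ Metric.ball c r) {t : ℝ} (ht : t ∈ Ico (0 : ℝ) 1) : y + t • (z - y) ∈ S := by
  have h1t : (1 - t) ≠ 0 := (sub_pos.2 ht.2).ne'
  -- `F w` is the centre from which the target point sits at parameter `t` on the segment to `w`; it
  -- tends to `y` as `w` tends to `z`.
  let F : E d → E d := fun w => (1 - t)⁻¹ • (y + t • (z - y) - t • w)
  have hF : Continuous F := by fun_prop
  have hFz : F z = y := by
    simp only [F]
    rw [show y + t • (z - y) - t • z = (1 - t) • y by module, smul_smul, inv_mul_cancel₀ h1t,
      one_smul]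
  have h2 : F ⁻¹' Metric.ball c r ∈ nhds z :=
    hF.continuousAt.preimage_mem_nhds (Metric.isOpen_ball.mem_nhds (by rwa [hFz]))
  obtain ⟨w, hw, hwS⟩ := mem_closure_iff_nhds.1 hz _ h2
  have h3 := hs _ hw hwS (a := 1 - t) (b := t) (sub_pos.2 ht.2).le ht.1 (by ring)
  convert h3 using 1
  simp only [F]
  rw [smul_smul, mul_inv_cancel₀ h1t, one_smul]
  abel

namespace FlatDomain

variable {d : ℕ} {D : Faceted (d + 1)} (X : FlatDomain D)

include X

theorem chart_mem_frontier {k : Fin D.n} {y : E d} (hy : y ∈ closure (X.base k)) :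
    X.chart k y ∈ frontier D.carrier := by
  rw [X.frontier_eq]
  exact mem_iUnion.2 ⟨k, y, hy, rfl⟩

theorem isFiniteMeasure_meas (k : Fin D.n) : IsFiniteMeasure (D.meas k) := by
  have := isFiniteMeasure_restrict (X.base_bounded k)
  rw [X.meas_eq]
  infer_instance

theorem ae_meas_mem (k : Fin D.n) : ∀ᵐ x ∂(D.meas k), x ∈ X.chart k '' X.base k := by
  rw [X.meas_eq]
  have hm : MeasurableEmbedding (X.chart k) :=
    (X.chart k).isometry.isClosedEmbedding.measurableEmbedding
  rw [hm.ae_map_iff]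
  exact (ae_restrict_mem (X.base_open k).measurableSet).mono fun y hy => mem_image_of_mem _ hy

theorem integral_meas (k : Fin D.n) (g : E (d + 1) → ℝ) :
    ∫ x, g x ∂(D.meas k) = ∫ y in X.base k, g (X.chart k y) := by
  rw [X.meas_eq]
  exact (X.chart k).isometry.isClosedEmbedding.measurableEmbedding.integral_map g

theorem ae_meas_iff (k : Fin D.n) {p : E (d + 1) → Prop} :
    (∀ᵐ x ∂(D.meas k), p x) ↔ ∀ᵐ y ∂(volume.restrict (X.base k)), p (X.chart k y) := by
  rw [X.meas_eq]
  exact (X.chart k).isometry.isClosedEmbedding.measurableEmbedding.ae_map_iff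

theorem memLp_meas_iff (k : Fin D.n) {g : E (d + 1) → ℝ} {p : ENNReal} :
    MemLp g p (D.meas k) ↔ MemLp (g ∘ X.chart k) p (volume.restrict (X.base k)) := by
  rw [X.meas_eq]
  exact (X.chart k).isometry.isClosedEmbedding.measurableEmbedding.memLp_map_measure_iff

theorem memLp_meas_of_continuous (k : Fin D.n) {g : E (d + 1) → ℝ} (hg : Continuous g)
    {p : ENNReal} : MemLp g p (D.meas k) :=
  (X.memLp_meas_iff k).2 (memLp_of_continuous_bounded (hg.comp (X.chart k).continuous)
    (X.base_open k) (X.base_bounded k))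

/-! ### Cone decomposition of a star-shaped domain and the divergence theorem. -/

section Star

variable {c : E (d + 1)} {r : ℝ} (hr : 0 < r)
  (hs : ∀ y ∈ Metric.ball c r, StarConvex ℝ y D.carrier)

include hr hs in
-- If the height were not positive, some star centre `c'` would lie strictly on the outer side of
-- the plane of the face. Segments from nearby face points to `c'` stay in the domain, so one would
-- find domain points straight outside the face, against the outward condition.
theorem height_pos (k : Fin D.n) {y : E d} (hy : y ∈ X.base k) :
    0 < inner ℝ (D.normal k) (X.chart k y - c) := by
  set n := D.normal k with hn
  have hnn : inner ℝ n n = 1 := by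
    rw [real_inner_self_eq_norm_sq, X.norm_normal]; norm_num
  by_contra! hle
  obtain ⟨c', hc', hlt⟩ : ∃ c' ∈ Metric.ball c r, inner ℝ n (X.chart k y - c') < 0 := by
    refine ⟨c + (r / 2) • n, ?_, ?_⟩
    · rw [Metric.mem_ball, dist_self_add_left, norm_smul, X.norm_normal, Real.norm_eq_abs,
        abs_of_pos (half_pos hr)]
      linarith
    · rw [← sub_sub, inner_sub_right, inner_smul_right, hnn]
      linarith
  set m := inner ℝ n (X.chart k y - c') with hm
  have hcompl : inner ℝ n (c' - X.chart k y) = -m := by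
    rw [← inner_neg_right, neg_sub]
  obtain ⟨Θ, -, hΘe⟩ := exists_hyperplane_equiv (X.chart k).linearIsometry (X.norm_normal k)
    (fun w => by
      have h1 := X.normal_orth k (w + y) y
      have h2 : X.chart k (w + y) = (X.chart k).linearIsometry w + X.chart k y :=
        (X.chart k).map_vadd y w
      rwa [h2, add_sub_cancel_right] at h1)
  obtain ⟨⟨s, z⟩, hsz⟩ := Θ.surjective (c' - X.chart k y)
  rw [hΘe] at hsz
  have hsm : s = -m := by
    have h1 := congrArg (inner ℝ n) hsz
    have h2 := X.normal_orth k (z + y) y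
    have h3 : X.chart k (z + y) = (X.chart k).linearIsometry z + X.chart k y :=
      (X.chart k).map_vadd y z
    rw [h3, add_sub_cancel_right] at h2
    rwa [inner_add_right, inner_smul_right, ← hn, hnn, h2, mul_one, add_zero, hcompl] at h1
  obtain ⟨δ, hδ, hout⟩ := X.outward k _ (mem_image_of_mem _ hy)
  -- Write `c' - χ y = s n + L z`. Starting at the face point with parameter `y - (τ / (1 - τ)) z`
  -- and going the fraction `τ` of the way to `c'` cancels the tangential part and leads to `χ y + τ
  -- s n`.
  have hcont : ContinuousAt (fun τ : ℝ => y - (τ / (1 - τ)) • z) 0 := by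
    have h0 : ContinuousAt (fun τ : ℝ => τ / (1 - τ)) 0 :=
      continuousAt_id.div (by fun_prop) (by norm_num)
    fun_prop
  have hev : ∀ᶠ τ in nhdsWithin (0 : ℝ) (Ioi 0), y - (τ / (1 - τ)) • z ∈ X.base k := by
    refine nhdsWithin_le_nhds (hcont.preimage_mem_nhds ((X.base_open k).mem_nhds ?_))
    simpa using hy
  have hev2 : ∀ᶠ τ in nhdsWithin (0 : ℝ) (Ioi 0), τ < min 1 (δ / (-m)) :=
    nhdsWithin_le_nhds (Iio_mem_nhds (lt_min one_pos (div_pos hδ (by linarith))))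
  obtain ⟨τ, ⟨hτ1, hτ2⟩, hτ0⟩ := ((hev.and hev2).and self_mem_nhdsWithin).exists
  have hτ0 : 0 < τ := hτ0
  have hτ1' : τ < 1 := hτ2.trans_le (min_le_left _ _)
  have hne : (1 - τ) ≠ 0 := by linarith
  have hT : τ * (-m) ∈ Ioo 0 δ :=
    ⟨mul_pos hτ0 (by linarith), (lt_div_iff₀ (by linarith)).1 (hτ2.trans_le (min_le_right _ _))⟩
  refine (hout _ hT).2 (subset_closure ?_)
  have hz := star_mem hs (frontier_subset_closure (X.chart_mem_frontier (subset_closure hτ1))) hc'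
    (t := 1 - τ) ⟨by linarith, by linarith⟩
  convert hz using 1
  have h4 : X.chart k (y - (τ / (1 - τ)) • z) =
      X.chart k y - (τ / (1 - τ)) • (X.chart k).linearIsometry z := by
    have := (X.chart k).map_vadd y (-((τ / (1 - τ)) • z))
    rw [vadd_eq_add, vadd_eq_add, neg_add_eq_sub, map_neg, map_smul, neg_add_eq_sub] at this
    exact this
  have h5 : (1 - τ) * (τ / (1 - τ)) = τ := by field_simp
  rw [h4, show c' = X.chart k y + s • n + (X.chart k).linearIsometry z by
    rw [add_assoc, hsz]; abel]
  rw [← hn, ← hsm]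
  have : (1 - τ) • (τ / (1 - τ)) • (X.chart k).linearIsometry z =
    τ • (X.chart k).linearIsometry z := by rw [smul_smul, h5]
  simp only [smul_sub, smul_add, this]
  module

/-- The distance of the apex `c` from the hyperplane of a boundary piece. -/
def height (c : E (d + 1)) (k : Fin D.n) : ℝ := inner ℝ (D.normal k) (X.chart k 0 - c)

theorem inner_chart_sub (c : E (d + 1)) (k : Fin D.n) (y : E d) :
    inner ℝ (D.normal k) (X.chart k y - c) = X.height c k := by
  have := X.normal_orth k y 0
  rw [height, ← sub_eq_zero, ← inner_sub_right]
  rwa [sub_sub_sub_cancel_right]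

include hr hs in
theorem cone_subset (k : Fin D.n) : cone (X.chart k) c (closure (X.base k)) ⊆ D.carrier := by
  rintro x ⟨t, ht, y, hy, rfl⟩
  exact star_mem hs (frontier_subset_closure (X.chart_mem_frontier hy)) (Metric.mem_ball_self hr)
    ⟨ht.1.le, ht.2⟩

include hr hs in
-- Of two distinct frontier points on one ray, the nearer would lie in the open domain by
-- `star_mem`. Hence the cones over different faces are disjoint.
theorem eq_of_ray {y y' : E (d + 1)} (hy : y ∈ frontier D.carrier) (hy' : y' ∈ frontier D.carrier)
    {t t' : ℝ} (ht : 0 < t) (ht' : 0 < t') (h : c + t • (y - c) = c + t' • (y' - c)) :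
    y = y' := by
  have key : ∀ {y y' : E (d + 1)} {t t' : ℝ}, y ∈ frontier D.carrier → y' ∈ frontier D.carrier →
      0 < t → t < t' → c + t • (y - c) ≠ c + t' • (y' - c) := by
    intro y y' t t' hy hy' ht htt h
    have h1 : y' = c + (t / t') • (y - c) := by
      have h2 := add_left_cancel h
      rw [div_eq_inv_mul, mul_smul, h2, smul_smul, inv_mul_cancel₀ (ht.trans htt).ne', one_smul]
      abel
    have h3 := star_mem hs (frontier_subset_closure hy) (Metric.mem_ball_self hr)
      (t := t / t') ⟨(div_pos ht (ht.trans htt)).le, (div_lt_one (ht.trans htt)).2 htt⟩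
    rw [← h1] at h3
    rw [X.isOpen.frontier_eq] at hy'
    exact hy'.2 h3
  rcases lt_trichotomy t t' with h1 | h1 | h1
  · exact absurd h (key hy hy' ht h1)
  · subst h1
    have := smul_right_injective _ ht.ne' (add_left_cancel h)
    exact sub_left_injective this
  · exact absurd h.symm (key hy' hy ht' h1)

include hr hs in
theorem cone_disjoint {k l : Fin D.n} (hkl : k ≠ l) :
    Disjoint (cone (X.chart k) c (X.base k)) (cone (X.chart l) c (X.base l)) := by
  rw [Set.disjoint_left]
  rintro x ⟨t, ht, y, hy, rfl⟩ ⟨t', ht', y', hy', h⟩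
  have h1 := X.eq_of_ray hr hs (X.chart_mem_frontier (subset_closure hy))
    (X.chart_mem_frontier (subset_closure hy')) ht.1 ht'.1 h
  exact Set.disjoint_left.1 (X.disjoint k l hkl) (mem_image_of_mem _ hy)
    (h1 ▸ mem_image_of_mem _ (subset_closure hy'))

/-- The ray from `c` through `x` leaves the bounded domain, hence crosses the frontier beyond `x`,
and `x` lies in the cone over the face that is hit. -/
theorem carrier_subset_cones :
    D.carrier ⊆ {c} ∪ ⋃ k, cone (X.chart k) c (closure (X.base k)) := by
  intro x hx
  by_cases hxc : x = c
  · exact Or.inl hxc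
  right
  have hne : x - c ≠ 0 := sub_ne_zero.2 hxc
  obtain ⟨R, hR⟩ := X.bounded.subset_closedBall c
  obtain ⟨T, hT1, hT⟩ : ∃ T : ℝ, 1 < T ∧ R < T * ‖x - c‖ := by
    refine ⟨max 2 ((|R| + 1) / ‖x - c‖), lt_max_of_lt_left (by norm_num), ?_⟩
    have h1 : (|R| + 1) / ‖x - c‖ * ‖x - c‖ = |R| + 1 := div_mul_cancel₀ _ (norm_ne_zero_iff.2 hne)
    have h2 := mul_le_mul_of_nonneg_right (le_max_right 2 ((|R| + 1) / ‖x - c‖)) (norm_nonneg (x - c))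
    have := le_abs_self R
    linarith
  have hz : c + T • (x - c) ∉ D.carrier := by
    intro h
    have := hR h
    rw [Metric.mem_closedBall, dist_self_add_left, norm_smul, Real.norm_eq_abs,
      abs_of_pos (by linarith)] at this
    linarith
  have hconn : IsPreconnected ((fun t : ℝ => c + t • (x - c)) '' Icc 1 T) :=
    isPreconnected_Icc.image _ (by fun_prop)
  -- Otherwise the domain and the complement of its closure would disconnect the segment.
  have hfr : (((fun t : ℝ => c + t • (x - c)) '' Icc 1 T) ∩ frontier D.carrier).Nonempty := by
    by_contra hemp
    have hno : ∀ z ∈ (fun t : ℝ => c + t • (x - c)) '' Icc 1 T, z ∉ D.carrier →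
        z ∈ (closure D.carrier)ᶜ := fun z hz hzD hzc =>
      hemp ⟨z, hz, by rw [X.isOpen.frontier_eq]; exact ⟨hzc, hzD⟩⟩
    have hzT : c + T • (x - c) ∈ (fun t : ℝ => c + t • (x - c)) '' Icc 1 T :=
      ⟨T, ⟨hT1.le, le_rfl⟩, rfl⟩
    obtain ⟨z, -, hz1, hz2⟩ := hconn D.carrier (closure D.carrier)ᶜ X.isOpen
      isClosed_closure.isOpen_compl
      (fun z hz => (em (z ∈ D.carrier)).imp_right (hno z hz))
      ⟨x, ⟨1, ⟨le_rfl, hT1.le⟩, by simp⟩, hx⟩ ⟨_, hzT, hno _ hzT hz⟩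
    exact hz2 (subset_closure hz1)
  obtain ⟨_, ⟨t, ht, rfl⟩, hfr⟩ := hfr
  have ht1 : 1 < t := by
    refine lt_of_le_of_ne ht.1 ?_
    rintro rfl
    rw [X.isOpen.frontier_eq] at hfr
    exact hfr.2 (by simpa using hx)
  rw [X.frontier_eq] at hfr
  obtain ⟨k, y, hy, hyx⟩ := mem_iUnion.1 hfr
  refine mem_iUnion.2 ⟨k, t⁻¹, ⟨by positivity, inv_lt_one_of_one_lt₀ ht1⟩, y, hy, ?_⟩
  rw [hyx]
  simp only
  rw [add_sub_cancel_left, smul_smul, inv_mul_cancel₀ (by positivity), one_smul]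
  abel

include hr hs in
theorem height_pos' (k : Fin D.n) (hne : (X.base k).Nonempty) : 0 < X.height c k := by
  obtain ⟨y, hy⟩ := hne
  rw [← X.inner_chart_sub c k y]
  exact X.height_pos hr hs k hy

include hr hs in
-- What the open cones miss is the apex and the cones over the boundaries of the faces, which have
-- zero volume because those boundaries are null in the face planes.
theorem carrier_ae_eq_cones :
    (D.carrier : Set (E (d + 1))) =ᵐ[volume] ⋃ k, cone (X.chart k) c (X.base k) := by
  refine Filter.EventuallyLE.antisymm ?_ (LE.le.eventuallyLE ?_)
  · have hnull : volume ({c} ∪ ⋃ k, cone (X.chart k) c (closure (X.base k) \ X.base k)) = 0 := by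
      refine measure_union_null (measure_singleton c) (measure_iUnion_null fun k => ?_)
      -- A piece with empty base is split off because the positivity of the height is proved at a
      -- point of the base.
      rcases (X.base k).eq_empty_or_nonempty with hk | hk
      · simp [hk, cone]
      refine volume_cone_eq_zero (X.norm_normal k) (X.normal_orth k) (X.inner_chart_sub c k)
        (X.height_pos' hr hs k hk) (isClosed_closure.measurableSet.diff
          (X.base_open k).measurableSet) ?_
      rw [← (X.base_open k).frontier_eq]
      exact X.base_frontier k
    have hae := measure_eq_zero_iff_ae_notMem.1 hnull
    filter_upwards [hae] with x hx hxD
    rcases X.carrier_subset_cones (c := c) hxD with h | h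
    · exact absurd (Or.inl h) hx
    obtain ⟨k, t, ht, y, hy, rfl⟩ := mem_iUnion.1 h
    refine mem_iUnion.2 ⟨k, t, ht, y, ?_, rfl⟩
    by_contra hyS
    exact hx (Or.inr (mem_iUnion.2 ⟨k, t, ht, y, ⟨hy, hyS⟩, rfl⟩))
  · refine iUnion_subset fun k => Subset.trans ?_ (X.cone_subset hr hs k)
    rintro x ⟨t, ht, y, hy, rfl⟩
    exact ⟨t, ht, y, subset_closure hy, rfl⟩

include hr hs in
theorem setIntegral_eq_sum_cones {f : E (d + 1) → ℝ} (hf : Continuous f) :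
    ∫ x in D.carrier, f x = ∑ k, X.height c k *
      ∫ t in (0 : ℝ)..1, t ^ d * ∫ y in X.base k, f (c + t • (X.chart k y - c)) := by
  have hi : IntegrableOn f D.carrier :=
    memLp_one_iff_integrable.1 (memLp_of_continuous_bounded hf X.isOpen X.bounded)
  have hsub : ∀ k, cone (X.chart k) c (X.base k) ⊆ D.carrier := fun k => by
    refine Subset.trans ?_ (X.cone_subset hr hs k)
    rintro x ⟨t, ht, y, hy, rfl⟩
    exact ⟨t, ht, y, subset_closure hy, rfl⟩
  have hmeas : ∀ k, MeasurableSet (cone (X.chart k) c (X.base k)) := fun k => by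
    rcases (X.base k).eq_empty_or_nonempty with hk | hk
    · simp [hk, cone]
    exact measurableSet_cone (X.norm_normal k) (X.normal_orth k) (X.inner_chart_sub c k)
      (X.height_pos' hr hs k hk) (X.base_open k).measurableSet
  rw [setIntegral_congr_set (X.carrier_ae_eq_cones hr hs),
    integral_iUnion_fintype hmeas (fun k l hkl => X.cone_disjoint hr hs hkl)
      fun k => hi.mono_set (hsub k)]
  refine Finset.sum_congr rfl fun k _ => ?_
  rcases (X.base k).eq_empty_or_nonempty with hk | hk
  · simp [hk, cone]
  exact setIntegral_cone (X.norm_normal k) (X.normal_orth k) (X.inner_chart_sub c k)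
    (X.height_pos' hr hs k hk) (X.base_open k).measurableSet (hi.mono_set (hsub k))

include hr hs in
-- The divergence theorem for the field `g(x) (x - c)`. Along a ray the integrand times `t ^ d` is
-- the derivative of `t ^ (d + 1) * g`, so only the value on the face survives, and the normal
-- component of `x - c` on a flat face is its constant height.
theorem integral_radial_div {g : E (d + 1) → ℝ} (hg : ContDiff ℝ ∞ g) :
    ∫ x in D.carrier, ((d + 1) * g x + fderiv ℝ g x (x - c)) =
      ∑ k, X.height c k * ∫ x, g x ∂(D.meas k) := by
  have hg1 : Continuous (fderiv ℝ g) := hg.continuous_fderiv (by simp)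
  have hcont : Continuous fun x => (d + 1) * g x + fderiv ℝ g x (x - c) := by
    have := hg.continuous
    fun_prop
  rw [X.setIntegral_eq_sum_cones hr hs hcont]
  refine Finset.sum_congr rfl fun k _ => ?_
  congr 1
  rw [X.integral_meas]
  simp only [← integral_const_mul]
  rw [intervalIntegral.integral_of_le zero_le_one]
  have hF : Continuous fun p : ℝ × E d => p.1 ^ d * ((d + 1) * g (c + p.1 • (X.chart k p.2 - c)) +
      fderiv ℝ g (c + p.1 • (X.chart k p.2 - c)) (c + p.1 • (X.chart k p.2 - c) - c)) := by
    have h1 : Continuous fun p : ℝ × E d => c + p.1 • (X.chart k p.2 - c) := by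
      have := (X.chart k).continuous
      fun_prop
    exact (continuous_fst.pow d).mul (hcont.comp h1)
  rw [integral_integral_swap]
  · refine integral_congr_ae (Filter.Eventually.of_forall fun y => ?_)
    simp only
    rw [← intervalIntegral.integral_of_le zero_le_one]
    set w := X.chart k y - c with hw
    have hder : ∀ t : ℝ, HasDerivAt (fun t : ℝ => t ^ (d + 1) * g (c + t • w))
        (t ^ d * ((d + 1) * g (c + t • w) + fderiv ℝ g (c + t • w) (c + t • w - c))) t := by
      intro t
      have h1 : HasDerivAt (fun t : ℝ => c + t • w) w t := by
        simpa using ((hasDerivAt_id t).smul_const w).const_add c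
      have h2 : HasDerivAt (fun t : ℝ => g (c + t • w)) (fderiv ℝ g (c + t • w) w) t :=
        (hg.differentiable (by simp) (c + t • w)).hasFDerivAt.comp_hasDerivAt t h1
      have h3 := (hasDerivAt_pow (d + 1) t).mul h2
      refine h3.congr_deriv ?_
      rw [add_sub_cancel_left, map_smul, smul_eq_mul]
      simp
      ring
    rw [intervalIntegral.integral_eq_sub_of_hasDerivAt (fun t _ => hder t)]
    · simp [hw]
    · exact (hF.comp (f := fun t : ℝ => (t, y)) (by fun_prop)).intervalIntegrable _ _
  · rw [Measure.prod_restrict]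
    have hb : Bornology.IsBounded (Ioc (0 : ℝ) 1 ×ˢ X.base k) :=
      (Metric.isBounded_Ioc 0 1).prod (X.base_bounded k)
    have : IsFiniteMeasure (((volume : Measure ℝ).prod (volume : Measure (E d))).restrict
        (Ioc (0 : ℝ) 1 ×ˢ X.base k)) := by
      refine ⟨?_⟩
      rw [Measure.restrict_apply_univ, Measure.prod_prod]
      exact ENNReal.mul_lt_top (by simp) (X.base_bounded k).measure_lt_top
    refine memLp_one_iff_integrable.1 (memLp_of_continuous hF hb.isCompact_closure ?_)
    exact (ae_restrict_mem (measurableSet_Ioc.prod (X.base_open k).measurableSet)).mono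
      fun _ hx => subset_closure hx

include hr hs in
-- Subtract the radial identities for the apexes `c` and `c - (r / 2) eᵢ`. The fields differ by the
-- constant direction `(r / 2) eᵢ` times `g`, and the heights by `(r / 2) nᵢ`. Star-shapedness with
-- respect to a whole ball makes both apexes admissible.
theorem integral_pderiv {g : E (d + 1) → ℝ} (hg : ContDiff ℝ ∞ g) (i : Fin (d + 1)) :
    ∫ x in D.carrier, pderiv i g x = ∑ k, D.normal k i * ∫ x, g x ∂(D.meas k) := by
  have hg1 : Continuous (fderiv ℝ g) := hg.continuous_fderiv (by simp)
  set c' := c - (r / 2) • EuclideanSpace.single i (1 : ℝ) with hc'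
  have hs' : ∀ y ∈ Metric.ball c' (r / 2), StarConvex ℝ y D.carrier := by
    intro y hy
    refine hs y ?_
    rw [Metric.mem_ball] at hy ⊢
    have h1 : dist c' c = r / 2 := by
      rw [hc', dist_self_sub_left, norm_smul]
      simp [abs_of_pos hr]
    linarith [dist_triangle y c' c]
  have h1 := X.integral_radial_div hr hs hg
  have h2 := X.integral_radial_div (half_pos hr) hs' hg
  have hint : ∀ c, Integrable (fun x => (d + 1) * g x + fderiv ℝ g x (x - c))
      (volume.restrict D.carrier) := fun c => by
    refine memLp_one_iff_integrable.1 (memLp_of_continuous_bounded ?_ X.isOpen X.bounded)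
    have := hg.continuous
    fun_prop
  have h3 := integral_sub (hint c') (hint c)
  rw [h1, h2, ← Finset.sum_sub_distrib] at h3
  have h4 : ∀ x, ((d + 1) * g x + fderiv ℝ g x (x - c')) - ((d + 1) * g x + fderiv ℝ g x (x - c)) =
      r / 2 * pderiv i g x := by
    intro x
    have : x - c' = (x - c) + (r / 2) • EuclideanSpace.single i (1 : ℝ) := by rw [hc']; abel
    rw [this, map_add, map_smul, pderiv, smul_eq_mul]
    ring
  have h5 : ∀ k, X.height c' k - X.height c k = r / 2 * D.normal k i := by
    intro k
    rw [height, height, ← inner_sub_right, sub_sub_sub_cancel_left, hc', sub_sub_cancel,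
      inner_smul_right]
    simp [EuclideanSpace.inner_single_right]
  simp only [h4, ← sub_mul, h5, integral_const_mul, mul_assoc, ← Finset.mul_sum] at h3
  exact mul_left_cancel₀ (half_pos hr).ne' h3

include hr hs in
theorem hasTrace_of_contDiff {u : E (d + 1) → ℝ} (hu : ContDiff ℝ ∞ u) : HasTrace D u u := by
  refine ⟨memH1_of_contDiff X.isOpen X.bounded hu,
    fun k => X.memLp_meas_of_continuous k hu.continuous, fun i φ hφ => ?_⟩
  rw [← X.integral_pderiv hr hs (hu.mul hφ.1) i]
  refine integral_congr_ae ?_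
  filter_upwards [weakDeriv_of_contDiff X.isOpen X.bounded hu i] with x hx
  rw [hx, show (fun x => u x * φ x) = u * φ from rfl, pderiv_mul hu hφ.1]
  simp
  ring

end Star

end FlatDomain

/-! ## Weak continuity of contractions -/

variable {d : ℕ}

section WeakLimit

open Filter Topology

variable {F G H η : E d → ℝ}

/-- The map `x ↦ (1 + τ) x - τ y` is the dilation about `y`, with Jacobian at least one. -/
theorem integral_comp_affine_le (F : E d → ℝ) (hF : 0 ≤ F) {τ : ℝ} (hτ : 0 ≤ τ) (y : E d) :
    ∫ x, F ((1 + τ) • x - τ • y) ≤ ∫ x, F x := by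
  rw [Measure.integral_comp_smul volume (fun x => F (x - τ • y)) (1 + τ),
    integral_sub_right_eq_self, smul_eq_mul]
  refine mul_le_of_le_one_left (integral_nonneg hF) ?_
  rw [abs_of_nonneg (by positivity)]
  exact inv_le_one_of_one_le₀ (one_le_pow₀ (by linarith))

theorem integrable_comp_affine (hF : Integrable F) {τ : ℝ} (hτ : 0 ≤ τ) (y : E d) :
    Integrable fun x => F ((1 + τ) • x - τ • y) :=
  (hF.comp_sub_right (τ • y)).comp_smul (by linarith : (1 + τ) ≠ 0)

theorem integrable_mul_comp_affine (hHm : Measurable H) (hH : MemLp H 2) (hFm : Measurable F)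
    (hF : MemLp F 2) {τ : ℝ} (hτ : 0 ≤ τ) (y : E d) :
    Integrable fun x => H x * F ((1 + τ) • x - τ • y) := by
  have h2 : Integrable fun x => H x ^ 2 + F ((1 + τ) • x - τ • y) ^ 2 :=
    hH.integrable_sq.add (integrable_comp_affine (F := fun x => F x ^ 2) hF.integrable_sq hτ y)
  refine h2.mono' (by fun_prop) (Eventually.of_forall fun x => ?_)
  rw [Real.norm_eq_abs, abs_mul]
  nlinarith [sq_nonneg (|H x| - |F ((1 + τ) • x - τ • y)|), sq_abs (H x),
    sq_abs (F ((1 + τ) • x - τ • y)), abs_nonneg (H x), abs_nonneg (F ((1 + τ) • x - τ • y)),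
    mul_nonneg (abs_nonneg (H x)) (abs_nonneg (F ((1 + τ) • x - τ • y)))]

/-- Young's inequality with weight `s`. The bound depends on neither `τ` nor `y`, as both density
and dominated convergence require. -/
theorem integral_abs_mul_comp_affine_le (hHm : Measurable H) (hH : MemLp H 2)
    (hFm : Measurable F) (hF : MemLp F 2) {τ : ℝ} (hτ : 0 ≤ τ) (y : E d) {s : ℝ} (hs : 0 < s) :
    ∫ x, |H x * F ((1 + τ) • x - τ • y)| ≤ s * (∫ x, H x ^ 2) + s⁻¹ * ∫ x, F x ^ 2 := by
  have h1 := (integrable_mul_comp_affine hHm hH hFm hF hτ y).abs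
  have h2 := hH.integrable_sq.const_mul s
  have h3 := (integrable_comp_affine (F := fun x => F x ^ 2) hF.integrable_sq hτ y).const_mul s⁻¹
  have h4 := integral_comp_affine_le (fun x => F x ^ 2) (fun x => sq_nonneg _) hτ y
  calc ∫ x, |H x * F ((1 + τ) • x - τ • y)|
      ≤ ∫ x, (s * H x ^ 2 + s⁻¹ * F ((1 + τ) • x - τ • y) ^ 2) := by
        refine integral_mono h1 (h2.add h3) fun x => ?_
        simp only
        set a := H x
        set b := F ((1 + τ) • x - τ • y)
        have h5 : 0 ≤ s⁻¹ * (s * |a| - |b|) ^ 2 := by positivity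
        have h6 : s⁻¹ * (s * |a| - |b|) ^ 2 = s * a ^ 2 + s⁻¹ * b ^ 2 - 2 * |a * b| := by
          rw [abs_mul, ← sq_abs a, ← sq_abs b]
          field_simp
          ring
        have := abs_nonneg (a * b)
        linarith
    _ = s * (∫ x, H x ^ 2) + s⁻¹ * ∫ x, F ((1 + τ) • x - τ • y) ^ 2 := by
        rw [integral_add h2 h3, integral_const_mul, integral_const_mul]
    _ ≤ _ := by gcongr

theorem tendsto_integral_mul_comp_affine (hHm : Measurable H) (hH : MemLp H 2)
    (hH1 : Integrable H) (hGm : Measurable G) (hG : MemLp G 2) (y : E d) :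
    Tendsto (fun τ : ℝ => ∫ x, H x * G ((1 + τ) • x - τ • y)) (𝓝[>] 0)
      (𝓝 (∫ x, H x * G x)) := by
  rw [Metric.tendsto_nhds]
  intro ε hε
  -- First `s` is fixed so that the term in `H` is small, then a compactly supported continuous `K`
  -- is chosen so close to `G` that the term weighted by `s⁻¹` is small as well. For `K` the limit
  -- is dominated convergence.
  obtain ⟨s, hs, hsε⟩ : ∃ s : ℝ, 0 < s ∧ s * (∫ x, H x ^ 2) ≤ ε / 8 := by
    have h0 : 0 ≤ ∫ x, H x ^ 2 := integral_nonneg fun x => sq_nonneg _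
    refine ⟨ε / 8 / ((∫ x, H x ^ 2) + 1), by positivity, ?_⟩
    rw [div_mul_eq_mul_div, div_le_iff₀ (by positivity)]
    nlinarith
  obtain ⟨K, hKc, hKε, hKcont, hK⟩ := MemLp.exists_hasCompactSupport_integral_rpow_sub_le
    (μ := (volume : Measure (E d))) (p := 2) (by norm_num) (by simpa using hG)
    (ε := s * (ε / 8)) (by positivity)
  simp only [ENNReal.ofReal_ofNat] at hK
  have hKm : Measurable K := hKcont.measurable
  have hGK : ∫ x, (G - K) x ^ 2 ≤ s * (ε / 8) := by
    refine le_trans (le_of_eq ?_) hKε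
    refine integral_congr_ae (Eventually.of_forall fun x => ?_)
    simp
  have hsmall : ∀ τ : ℝ, 0 ≤ τ →
      |(∫ x, H x * G ((1 + τ) • x - τ • y)) - ∫ x, H x * K ((1 + τ) • x - τ • y)| ≤ ε / 4 := by
    intro τ hτ
    rw [← integral_sub (integrable_mul_comp_affine hHm hH hGm hG hτ y)
      (integrable_mul_comp_affine hHm hH hKm hK hτ y)]
    refine (abs_integral_le_integral_abs).trans ?_
    have h1 := integral_abs_mul_comp_affine_le hHm hH (hGm.sub hKm) (hG.sub hK) hτ y hs
    have h2 : s⁻¹ * (∫ x, (G - K) x ^ 2) ≤ ε / 8 := by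
      rw [inv_mul_le_iff₀ hs]; exact hGK
    simp only [← mul_sub]
    simp only [Pi.sub_apply] at h1 h2
    linarith
  obtain ⟨C, hC⟩ := hKc.exists_bound_of_continuous hKcont
  have hlim : Tendsto (fun τ : ℝ => ∫ x, H x * K ((1 + τ) • x - τ • y)) (𝓝[>] 0)
      (𝓝 (∫ x, H x * K x)) := by
    refine tendsto_integral_filter_of_dominated_convergence (fun x => |H x| * C)
      (Eventually.of_forall fun τ => by fun_prop) (Eventually.of_forall fun τ =>
        Eventually.of_forall fun x => ?_) (hH1.abs.mul_const C)
      (Eventually.of_forall fun x => ?_)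
    · rw [norm_mul, Real.norm_eq_abs (H x)]
      exact mul_le_mul_of_nonneg_left (hC _) (abs_nonneg _)
    · have : Continuous fun τ : ℝ => H x * K ((1 + τ) • x - τ • y) := by fun_prop
      have h1 := (this.tendsto 0).mono_left (nhdsWithin_le_nhds (s := Ioi 0))
      simpa using h1
  have h0 := hsmall 0 le_rfl
  simp only [add_zero, one_smul, zero_smul, sub_zero] at h0
  filter_upwards [Metric.tendsto_nhds.1 hlim (ε / 4) (by positivity), self_mem_nhdsWithin]
    with τ h1 hτ
  have h2 := hsmall τ (le_of_lt hτ)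
  rw [Real.dist_eq] at h1 ⊢
  rw [abs_lt] at *
  rw [abs_le] at h0 h2
  constructor <;> linarith [h0.1, h0.2, h1.1, h1.2, h2.1, h2.2]

theorem integral_mul_average (hHm : Measurable H) (hH : MemLp H 2)
    (hGm : Measurable G) (hG : MemLp G 2) (hη : Continuous η) (hηc : HasCompactSupport η)
    {τ : ℝ} (hτ : 0 ≤ τ) :
    ∫ x, H x * ∫ y, η y * G ((1 + τ) • x - τ • y) =
      ∫ y, η y * ∫ x, H x * G ((1 + τ) • x - τ • y) := by
  have hηm := hη.measurable
  have hm : Measurable fun p : E d × E d => η p.2 * (H p.1 * G ((1 + τ) • p.1 - τ • p.2)) := by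
    fun_prop
  have hi : Integrable (fun p : E d × E d => η p.2 * (H p.1 * G ((1 + τ) • p.1 - τ • p.2)))
      (volume.prod volume) := by
    rw [integrable_prod_iff' hm.aestronglyMeasurable]
    refine ⟨Eventually.of_forall fun y =>
      (integrable_mul_comp_affine hHm hH hGm hG hτ y).const_mul (η y), ?_⟩
    refine (((hη.integrable_of_hasCompactSupport hηc).abs).mul_const
      (1 * (∫ x, H x ^ 2) + 1⁻¹ * ∫ x, G x ^ 2)).mono'
      (hm.norm.stronglyMeasurable.integral_prod_left').aestronglyMeasurable
      (Eventually.of_forall fun y => ?_)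
    simp only [norm_mul, Real.norm_eq_abs]
    rw [integral_const_mul, abs_mul, abs_abs, abs_of_nonneg (integral_nonneg fun x => by positivity)]
    refine mul_le_mul_of_nonneg_left ?_ (abs_nonneg _)
    simpa only [abs_mul] using integral_abs_mul_comp_affine_le hHm hH hGm hG hτ y one_pos
  have := integral_integral_swap (f := fun x y => η y * (H x * G ((1 + τ) • x - τ • y))) hi
  simp only [integral_const_mul] at this
  rw [← this]
  refine integral_congr_ae (Eventually.of_forall fun x => ?_)
  simp only [← integral_const_mul]
  refine integral_congr_ae (Eventually.of_forall fun y => ?_)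
  simp only
  ring

/-- By Fubini the average over the centres `y` can be taken last; each dilation converges weakly,
and the bound of Young's inequality with weight one dominates. -/
theorem tendsto_integral_mul_average (hHm : Measurable H) (hH : MemLp H 2) (hH1 : Integrable H)
    (hGm : Measurable G) (hG : MemLp G 2) (hη : Continuous η) (hηc : HasCompactSupport η)
    (hη1 : ∫ y, η y = 1) :
    Tendsto (fun τ : ℝ => ∫ x, H x * ∫ y, η y * G ((1 + τ) • x - τ • y)) (𝓝[>] 0)
      (𝓝 (∫ x, H x * G x)) := by
  have hηm := hη.measurable
  have h1 : Tendsto (fun τ : ℝ => ∫ y, η y * ∫ x, H x * G ((1 + τ) • x - τ • y)) (𝓝[>] 0)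
      (𝓝 (∫ y, η y * ∫ x, H x * G x)) := by
    refine tendsto_integral_filter_of_dominated_convergence
      (fun y => |η y| * (1 * (∫ x, H x ^ 2) + 1⁻¹ * ∫ x, G x ^ 2))
      (Eventually.of_forall fun τ => ?_) ?_
      ((hη.integrable_of_hasCompactSupport hηc).abs.mul_const _) (Eventually.of_forall fun y =>
        (tendsto_integral_mul_comp_affine hHm hH hH1 hGm hG y).const_mul _)
    · have hm : Measurable fun p : E d × E d => H p.1 * G ((1 + τ) • p.1 - τ • p.2) := by
        fun_prop
      exact hη.aestronglyMeasurable.mul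
        (hm.stronglyMeasurable.integral_prod_left').aestronglyMeasurable
    · filter_upwards [self_mem_nhdsWithin] with τ hτ
      refine Eventually.of_forall fun y => ?_
      rw [norm_mul, Real.norm_eq_abs]
      refine mul_le_mul_of_nonneg_left (abs_integral_le_integral_abs.trans ?_) (abs_nonneg _)
      exact integral_abs_mul_comp_affine_le hHm hH hGm hG (le_of_lt hτ) y one_pos
  rw [integral_mul_const, hη1, one_mul] at h1
  refine h1.congr' ?_
  filter_upwards [self_mem_nhdsWithin] with τ hτ
  exact (integral_mul_average hHm hH hGm hG hη hηc (le_of_lt hτ)).symm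

end WeakLimit

/-! ## Mollification of functions extended by zero -/

variable {d : ℕ} {U : Set (E d)} {k g u v w : E d → ℝ}

/-- Convolution of `k` with the extension of `g` by zero outside `U`. -/
def moll (k : E d → ℝ) (U : Set (E d)) (g : E d → ℝ) (x : E d) : ℝ :=
  ∫ z in U, k (x - z) * g z

theorem moll_eq_convolution (hU : MeasurableSet U) (k g : E d → ℝ) :
    moll k U g = convolution k (U.indicator g) (ContinuousLinearMap.mul ℝ ℝ) volume := by
  funext x
  rw [convolution_eq_swap, moll, ← integral_indicator hU]
  refine integral_congr_ae (Filter.Eventually.of_forall fun z => ?_)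
  by_cases hz : z ∈ U <;> simp [hz]

theorem moll_congr (h : u =ᵐ[volume.restrict U] v) : moll k U u = moll k U v := by
  funext x
  exact integral_congr_ae (h.mono fun z hz => by simp only [hz])

theorem locallyIntegrable_indicator (hU : MeasurableSet U)
    (hg : MemLp g 2 (volume.restrict U)) : LocallyIntegrable (U.indicator g) :=
  ((memLp_indicator_iff_restrict hU).2 hg).locallyIntegrable (by norm_num)

theorem contDiff_moll (hU : MeasurableSet U) (hk : IsTest univ k)
    (hg : MemLp g 2 (volume.restrict U)) : ContDiff ℝ ∞ (moll k U g) := by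
  rw [moll_eq_convolution hU]
  exact hk.2.1.contDiff_convolution_left (n := ⊤) _ hk.1 (locallyIntegrable_indicator hU hg)

theorem pderiv_moll (hU : MeasurableSet U) (hk : IsTest univ k)
    (hg : MemLp g 2 (volume.restrict U)) (i : Fin d) :
    pderiv i (moll k U g) = moll (pderiv i k) U g := by
  have hloc := locallyIntegrable_indicator hU hg
  funext x
  have h1 := hk.2.1.hasFDerivAt_convolution_left (ContinuousLinearMap.mul ℝ ℝ)
    (hk.1.of_le (by simp)) hloc x
  rw [pderiv, moll_eq_convolution hU, h1.fderiv, moll_eq_convolution hU, convolution_eq_swap,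
    convolution_eq_swap]
  have h2 := (hk.2.1.fderiv ℝ).convolutionExists_left
    ((ContinuousLinearMap.mul ℝ ℝ).precompL (E d)) (hk.1.continuous_fderiv (by simp)) hloc x
  rw [ContinuousLinearMap.integral_apply]
  · rfl
  · exact h2.integrable_swap

/-- `w` extended by zero is the weak `i`-th partial derivative of `u` extended by zero. -/
def IsWeakPartialZero (U : Set (E d)) (i : Fin d) (u w : E d → ℝ) : Prop :=
  MemLp w 2 (volume.restrict U) ∧
    ∀ φ, IsTest univ φ → ∫ x in U, u x * pderiv i φ x = - ∫ x in U, w x * φ x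

theorem IsTest.comp_affine {φ : E d → ℝ} (h : IsTest Set.univ φ) (x : E d) {a : ℝ} (ha : a ≠ 0) :
    IsTest Set.univ fun z => φ (x + a • z) := by
  refine ⟨h.1.comp (by fun_prop), ?_, subset_univ _⟩
  let e : E d ≃ₜ E d := (Homeomorph.smulOfNeZero a ha).trans (Homeomorph.addLeft x)
  exact h.2.1.comp_homeomorph e

theorem pderiv_comp_affine {φ : E d → ℝ} (h : ContDiff ℝ ∞ φ) (x : E d) (a : ℝ) (i : Fin d) :
    pderiv i (fun z => φ (x + a • z)) = fun z => a * pderiv i φ (x + a • z) := by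
  funext z
  have h1 : HasFDerivAt (fun z : E d => x + a • z) (a • ContinuousLinearMap.id ℝ (E d)) z :=
    ((hasFDerivAt_id z).const_smul a).const_add x
  have h2 := (h.differentiable (by simp) (x + a • z)).hasFDerivAt.comp z h1
  have h3 : fderiv ℝ (fun z => φ (x + a • z)) z = _ := h2.fderiv
  rw [pderiv, h3]
  simp [pderiv]

/-- The kernel `z ↦ k (x - z)` need not be supported in `U`, so an interior weak derivative would
not suffice; the extension by zero is what allows the derivative to move from the kernel to `u`. -/
theorem pderiv_moll_zero (hU : MeasurableSet U) (hk : IsTest univ k)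
    (hu : MemLp u 2 (volume.restrict U)) {i : Fin d} (h : IsWeakPartialZero U i u w) :
    pderiv i (moll k U u) = moll k U w := by
  rw [pderiv_moll hU hk hu]
  funext x
  have h1 := hk.comp_affine x (a := -1) (by norm_num)
  have h2 := h.2 _ h1
  rw [pderiv_comp_affine hk.1] at h2
  simp only [neg_smul, one_smul, ← sub_eq_add_neg, neg_one_mul, mul_neg, integral_neg,
    neg_inj] at h2
  simp only [moll, mul_comm _ (u _), mul_comm _ (w _)]
  exact h2

/-- The kernel `η` scaled to the size `τ`. -/
def scaledKernel (η : E d → ℝ) (τ : ℝ) (w : E d) : ℝ := (τ ^ d)⁻¹ * η (τ⁻¹ • w)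

theorem isTest_scaledKernel {η : E d → ℝ} (hη : IsTest univ η) {τ : ℝ} (hτ : 0 < τ) :
    IsTest univ (scaledKernel η τ) := by
  have := (hη.comp_affine 0 (inv_ne_zero hτ.ne')).smul (τ ^ d)⁻¹
  simp only [zero_add] at this
  exact this

/-- Contraction of `g` towards the support of `η`, and simultaneous mollification. -/
def contract (η : E d → ℝ) (U : Set (E d)) (τ : ℝ) (g : E d → ℝ) (x : E d) : ℝ :=
  moll (scaledKernel η τ) U g ((1 + τ) • x)

variable {η : E d → ℝ} {τ : ℝ}

theorem contract_congr (h : u =ᵐ[volume.restrict U] v) : contract η U τ u = contract η U τ v := by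
  unfold contract
  rw [moll_congr h]

/-- The substitution `z = (1 + τ) x - τ y` exhibits the contraction as an average of dilations about
the points of the support of `η`; the scaling of the kernel compensates the Jacobian. -/
theorem contract_eq_average (hU : MeasurableSet U) (hτ : 0 < τ) (g : E d → ℝ) (x : E d) :
    contract η U τ g x = ∫ y, η y * U.indicator g ((1 + τ) • x - τ • y) := by
  have h1 : contract η U τ g x =
      ∫ z, scaledKernel η τ ((1 + τ) • x - z) * U.indicator g z := by
    rw [contract, moll, ← integral_indicator hU]
    refine integral_congr_ae (Filter.Eventually.of_forall fun z => ?_)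
    by_cases hz : z ∈ U <;> simp [hz]
  rw [h1, ← integral_sub_left_eq_self _ volume ((1 + τ) • x)]
  have h2 := Measure.integral_comp_smul (volume : Measure (E d))
    (fun y => η y * U.indicator g ((1 + τ) • x - τ • y)) τ⁻¹
  rw [finrank_euclideanSpace_fin, inv_pow, inv_inv, abs_of_pos (by positivity), smul_eq_mul,
    ← inv_mul_eq_iff_eq_mul₀ (by positivity), ← integral_const_mul] at h2
  rw [← h2]
  refine integral_congr_ae (Filter.Eventually.of_forall fun z => ?_)
  simp only [scaledKernel, sub_sub_cancel, smul_smul, mul_inv_cancel₀ hτ.ne', one_smul, mul_assoc]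

theorem contDiff_contract (hU : MeasurableSet U) (hη : IsTest univ η) (hτ : 0 < τ)
    (hg : MemLp g 2 (volume.restrict U)) : ContDiff ℝ ∞ (contract η U τ g) :=
  (contDiff_moll hU (isTest_scaledKernel hη hτ) hg).comp (contDiff_const_smul _)

theorem pderiv_contract (hU : MeasurableSet U) (hη : IsTest univ η) (hτ : 0 < τ)
    (hu : MemLp u 2 (volume.restrict U)) {i : Fin d} (h : IsWeakPartialZero U i u w) :
    pderiv i (contract η U τ u) = (1 + τ) • contract η U τ w := by
  have hk := isTest_scaledKernel hη hτ
  have h1 := pderiv_comp_affine (contDiff_moll hU hk hu) 0 (1 + τ) i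
  simp only [zero_add] at h1
  rw [pderiv_moll_zero hU hk hu h] at h1
  exact h1

/-- If the value at `x` is nonzero, then `x = y + (1 + τ)⁻¹ (z - y)` with `z ∈ U` and `y` in the
support of `η`. All such points lie in a compact set, which is inside `U` by `star_mem`. -/
theorem isTest_contract {c : E d} {r r' : ℝ} (hUo : IsOpen U) (hUb : Bornology.IsBounded U)
    (hr : r' < r) (hs : ∀ y ∈ Metric.ball c r, StarConvex ℝ y U) (hη : IsTest univ η)
    (hηs : tsupport η ⊆ Metric.closedBall c r') (hτ : 0 < τ)
    (hg : MemLp g 2 (volume.restrict U)) : IsTest U (contract η U τ g) := by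
  let K : Set (E d) := (fun p : E d × E d => p.2 + (1 + τ)⁻¹ • (p.1 - p.2)) ''
    (closure U ×ˢ Metric.closedBall c r')
  have hK : IsCompact K :=
    (hUb.isCompact_closure.prod (isCompact_closedBall c r')).image (by fun_prop)
  have hKU : K ⊆ U := by
    rintro _ ⟨⟨z, y⟩, ⟨hz, hy⟩, rfl⟩
    exact star_mem hs hz (Metric.closedBall_subset_ball hr hy)
      ⟨by positivity, inv_lt_one_of_one_lt₀ (by linarith)⟩
  have hsupp : Function.support (contract η U τ g) ⊆ K := by
    intro x hx
    rw [Function.mem_support, contract_eq_average hUo.measurableSet hτ] at hx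
    by_contra hxK
    refine hx (integral_eq_zero_of_ae (Filter.Eventually.of_forall fun y => ?_))
    by_contra hy
    have hy1 : η y ≠ 0 := fun h => hy (by simp [h])
    have hy2 : (1 + τ) • x - τ • y ∈ U := by
      by_contra h
      exact hy (by simp [h])
    refine hxK ⟨⟨_, y⟩, ⟨subset_closure hy2, hηs (subset_tsupport _ hy1)⟩, ?_⟩
    have h1 : (1 + τ) ≠ 0 := by positivity
    have h2 : (1 + τ) • x - τ • y - y = (1 + τ) • (x - y) := by module
    simp only [h2, smul_smul, inv_mul_cancel₀ h1, one_smul]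
    abel
  have hts : tsupport (contract η U τ g) ⊆ K := closure_minimal hsupp hK.isClosed
  exact ⟨contDiff_contract hUo.measurableSet hη hτ hg,
    hK.of_isClosed_subset (isClosed_tsupport _) hts, hts.trans hKU⟩

theorem tendsto_integral_mul_contract {h : E d → ℝ} (hU : MeasurableSet U)
    (hUb : Bornology.IsBounded U) (hη : IsTest univ η) (hη1 : ∫ y, η y = 1)
    (hh : MemLp h 2 (volume.restrict U)) (hg : MemLp g 2 (volume.restrict U)) :
    Filter.Tendsto (fun τ : ℝ => ∫ x in U, h x * contract η U τ g x) (nhdsWithin 0 (Ioi 0))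
      (nhds (∫ x in U, h x * g x)) := by
  have hfin := isFiniteMeasure_restrict hUb
  -- The Fubini arguments ask for measurable functions, so measurable representatives are used.
  set h' := hh.1.mk h with hh'
  set g' := hg.1.mk g with hg'
  have eh : h =ᵐ[volume.restrict U] h' := hh.1.ae_eq_mk
  have eg : g =ᵐ[volume.restrict U] g' := hg.1.ae_eq_mk
  have mh : MemLp h' 2 (volume.restrict U) := hh.ae_eq eh
  have mg : MemLp g' 2 (volume.restrict U) := hg.ae_eq eg
  have key := tendsto_integral_mul_average (H := U.indicator h') (G := U.indicator g')
    (hh.1.stronglyMeasurable_mk.measurable.indicator hU) ((memLp_indicator_iff_restrict hU).2 mh)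
    ((integrable_indicator_iff hU).2 (mh.integrable (by norm_num)))
    (hg.1.stronglyMeasurable_mk.measurable.indicator hU) ((memLp_indicator_iff_restrict hU).2 mg)
    hη.1.continuous hη.2.1 hη1
  have hind : ∀ f : E d → ℝ, ∫ x, U.indicator h' x * f x = ∫ x in U, h' x * f x := by
    intro f
    rw [← integral_indicator hU]
    refine integral_congr_ae (Filter.Eventually.of_forall fun x => ?_)
    by_cases hx : x ∈ U <;> simp [hx]
  rw [hind] at key
  have e1 : ∫ x in U, h x * g x = ∫ x in U, h' x * U.indicator g' x := by
    refine integral_congr_ae ?_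
    filter_upwards [eh, eg, ae_restrict_mem hU] with x h1 h2 h3
    rw [h1, h2, indicator_of_mem h3]
  rw [e1]
  refine key.congr' ?_
  filter_upwards [self_mem_nhdsWithin] with τ hτ
  rw [hind, contract_congr eg, integral_mul_congr eh]
  simp only [contract_eq_average hU hτ]

/-! ## Uniqueness for the Laplace and biharmonic equations -/

theorem exists_kernel (c : E d) {r : ℝ} (hr : 0 < r) :
    ∃ η : E d → ℝ, IsTest univ η ∧ tsupport η ⊆ Metric.closedBall c (r / 2) ∧ ∫ y, η y = 1 := by
  let b : ContDiffBump c := ⟨r / 4, r / 2, by positivity, by linarith⟩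
  exact ⟨b.normed volume, ⟨b.contDiff_normed, b.hasCompactSupport_normed, subset_univ _⟩,
    (b.tsupport_normed_eq (μ := volume)).subset, b.integral_normed⟩

theorem ae_eq_zero_of_integral_sq (hu : MemLp u 2 (volume.restrict U))
    (h : ∫ x in U, u x * u x = 0) : u =ᵐ[volume.restrict U] 0 := by
  have := (integral_eq_zero_iff_of_nonneg (fun x => mul_self_nonneg (u x))
    (integrable_mul hu hu)).1 h
  exact this.mono fun x hx => mul_self_eq_zero.1 hx

/-- The function is constant and vanishes at a point outside the bounded set; such a point exists
because the dimension `d + 1` is positive. -/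
theorem eq_zero_of_pderiv_eq_zero {d : ℕ} {U : Set (E (d + 1))} {φ : E (d + 1) → ℝ}
    (hU : Bornology.IsBounded U) (hφ : IsTest U φ) (h : ∀ i, pderiv i φ = 0) : φ = 0 := by
  have hfd : ∀ x, fderiv ℝ φ x = 0 := by
    intro x
    ext y
    rw [← (EuclideanSpace.basisFun (Fin (d + 1)) ℝ).sum_repr y, map_sum]
    simp only [map_smul, EuclideanSpace.basisFun_apply]
    refine (Finset.sum_eq_zero fun i _ => ?_).trans (by simp)
    have := congrFun (h i) x
    simp only [pderiv, Pi.zero_apply] at this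
    rw [this, smul_zero]
  obtain ⟨R, hR⟩ := hU.subset_closedBall 0
  obtain ⟨x₀, hx₀⟩ := NormedSpace.exists_lt_norm ℝ (E (d + 1)) R
  funext x
  rw [is_const_of_fderiv_eq_zero (hφ.1.differentiable (by simp)) hfd x x₀]
  refine hφ.eq_zero fun hm => ?_
  have := hR hm
  rw [mem_closedBall_zero_iff] at this
  linarith

section Uniqueness

variable {d : ℕ} {U : Set (E (d + 1))} {v ψ : E (d + 1) → ℝ} {w s : Fin (d + 1) → E (d + 1) → ℝ}
  {c : E (d + 1)} {r : ℝ}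

/-- The contractions of `v` are test functions with zero gradient, hence zero, and they converge
weakly to `v`. -/
theorem ae_eq_zero_of_weakPartialZero (hUo : IsOpen U) (hUb : Bornology.IsBounded U) (hr : 0 < r)
    (hs : ∀ y ∈ Metric.ball c r, StarConvex ℝ y U) (hv : MemLp v 2 (volume.restrict U))
    (hw : ∀ i, IsWeakPartialZero U i v (w i)) (h0 : ∀ i, w i =ᵐ[volume.restrict U] 0) :
    v =ᵐ[volume.restrict U] 0 := by
  obtain ⟨η, hη, hηs, hη1⟩ := exists_kernel c hr
  have hz : ∀ τ : ℝ, 0 < τ → contract η U τ v = 0 := by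
    intro τ hτ
    refine eq_zero_of_pderiv_eq_zero hUb
      (isTest_contract hUo hUb (by linarith : r / 2 < r) hs hη hηs hτ hv) fun i => ?_
    rw [pderiv_contract hUo.measurableSet hη hτ hv (hw i), contract_congr (h0 i)]
    funext x
    simp [contract, moll]
  have hlim := tendsto_integral_mul_contract hUo.measurableSet hUb hη hη1 hv hv
  refine ae_eq_zero_of_integral_sq hv (tendsto_nhds_unique hlim ?_)
  refine tendsto_const_nhds.congr' ?_
  filter_upwards [self_mem_nhdsWithin] with τ hτ
  simp [hz τ hτ]

/-- Testing the equation with the contraction of `v` gives `∑ ∫ wᵢ contract(wᵢ) = 0` after removing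
the factor `1 + τ`, and `τ → 0` leaves `∑ ‖wᵢ‖² = 0`. -/
theorem ae_eq_zero_of_hasLaplacian_zero (hUo : IsOpen U) (hUb : Bornology.IsBounded U)
    (hr : 0 < r) (hs : ∀ y ∈ Metric.ball c r, StarConvex ℝ y U)
    (hv : MemLp v 2 (volume.restrict U)) (hw : ∀ i, IsWeakPartialZero U i v (w i))
    (hL : HasLaplacian U v 0) : v =ᵐ[volume.restrict U] 0 := by
  obtain ⟨η, hη, hηs, hη1⟩ := exists_kernel c hr
  have h1 : ∀ φ, IsTest U φ → ∑ i, ∫ x in U, w i x * pderiv i φ x = 0 := by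
    intro φ hφ
    have h2 := hL φ hφ
    rw [laplacian_eq_sum hφ.1] at h2
    simp only [Finset.mul_sum, Pi.zero_apply, zero_mul, integral_zero] at h2
    rw [integral_finsetSum _ fun i _ => integrable_mul hv (((hφ.pderiv i).pderiv i).memLp _)] at h2
    rw [← neg_eq_zero, ← Finset.sum_neg_distrib, ← h2]
    exact Finset.sum_congr rfl fun i _ => ((hw i).2 _ (hφ.pderiv i).univ).symm
  have hlim := tendsto_finsetSum (Finset.univ : Finset (Fin (d + 1))) fun i _ =>
    tendsto_integral_mul_contract hUo.measurableSet hUb hη hη1 (hw i).1 (hw i).1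
  have h0 : ∑ i, ∫ x in U, w i x * w i x = 0 := by
    refine tendsto_nhds_unique hlim (tendsto_const_nhds.congr' ?_)
    filter_upwards [self_mem_nhdsWithin] with τ hτ
    have hτ0 : 0 < τ := hτ
    have h3 := h1 _ (isTest_contract hUo hUb (by linarith : r / 2 < r) hs hη hηs hτ hv)
    simp only [fun i => pderiv_contract hUo.measurableSet hη hτ hv (hw i), Pi.smul_apply,
      smul_eq_mul, mul_left_comm _ (1 + τ), integral_const_mul, ← Finset.mul_sum] at h3
    exact ((mul_eq_zero.1 h3).resolve_left (by positivity)).symm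
  have h0' := (Finset.sum_eq_zero_iff_of_nonneg fun i _ =>
    integral_nonneg fun x => mul_self_nonneg (w i x)).1 h0
  exact ae_eq_zero_of_weakPartialZero hUo hUb hr hs hv hw fun i =>
    ae_eq_zero_of_integral_sq (hw i).1 (h0' i (Finset.mem_univ i))

/-- Only the pure second derivatives `sᵢ` occur in `Δψ`. Testing with the contraction of `ψ` and
letting `τ → 0` gives `‖∑ sᵢ‖² = 0`, so `ψ` is harmonic and the Laplace case applies. -/
theorem ae_eq_zero_of_hasBilaplacian_zero (hUo : IsOpen U) (hUb : Bornology.IsBounded U)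
    (hr : 0 < r) (hst : ∀ y ∈ Metric.ball c r, StarConvex ℝ y U)
    (hv : MemLp ψ 2 (volume.restrict U)) (hw : ∀ i, IsWeakPartialZero U i ψ (w i))
    (hs : ∀ i, IsWeakPartialZero U i (w i) (s i))
    (hL : HasBilaplacian U ψ 0) : ψ =ᵐ[volume.restrict U] 0 := by
  obtain ⟨η, hη, hηs, hη1⟩ := exists_kernel c hr
  have hlap : ∀ φ, IsTest U φ →
      ∫ x in U, ψ x * Laplacian.laplacian φ x = ∑ i, ∫ x in U, s i x * φ x := by
    intro φ hφ
    rw [laplacian_eq_sum hφ.1]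
    simp only [Finset.mul_sum]
    rw [integral_finsetSum _ fun i _ => integrable_mul hv (((hφ.pderiv i).pderiv i).memLp _)]
    refine Finset.sum_congr rfl fun i _ => ?_
    rw [(hw i).2 _ (hφ.pderiv i).univ, (hs i).2 _ hφ.univ, neg_neg]
  have h1 : ∀ φ, IsTest U φ →
      ∑ i, ∑ j, ∫ x in U, s i x * pderiv j (pderiv j φ) x = 0 := by
    intro φ hφ
    have h2 := hL φ hφ
    rw [hlap _ hφ.laplacian] at h2
    simp only [Pi.zero_apply, zero_mul, integral_zero] at h2
    rw [← h2, laplacian_eq_sum hφ.1]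
    refine Finset.sum_congr rfl fun i _ => ?_
    simp only [Finset.mul_sum]
    rw [integral_finsetSum _ fun j _ =>
      integrable_mul (hs i).1 (((hφ.pderiv j).pderiv j).memLp _)]
  have hlim := tendsto_finsetSum (Finset.univ : Finset (Fin (d + 1))) fun i _ =>
    tendsto_finsetSum (Finset.univ : Finset (Fin (d + 1))) fun j _ =>
      tendsto_integral_mul_contract hUo.measurableSet hUb hη hη1 (hs i).1 (hs j).1
  have h0 : ∑ i, ∑ j, ∫ x in U, s i x * s j x = 0 := by
    refine tendsto_nhds_unique hlim (tendsto_const_nhds.congr' ?_)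
    filter_upwards [self_mem_nhdsWithin] with τ hτ
    have hτ0 : 0 < τ := hτ
    have h3 := h1 _ (isTest_contract hUo hUb (by linarith : r / 2 < r) hst hη hηs hτ hv)
    have h4 : ∀ j, pderiv j (pderiv j (contract η U τ ψ)) =
        ((1 + τ) * (1 + τ)) • contract η U τ (s j) := fun j => by
      rw [pderiv_contract hUo.measurableSet hη hτ hv (hw j),
        pderiv_smul (contDiff_contract hUo.measurableSet hη hτ (hw j).1),
        pderiv_contract hUo.measurableSet hη hτ (hw j).1 (hs j), smul_smul]
    simp only [h4, Pi.smul_apply, smul_eq_mul, mul_left_comm _ ((1 + τ) * (1 + τ)),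
      integral_const_mul, ← Finset.mul_sum] at h3
    exact ((mul_eq_zero.1 h3).resolve_left (by positivity)).symm
  set S : E (d + 1) → ℝ := fun x => ∑ i, s i x with hS
  have hSm : MemLp S 2 (volume.restrict U) := memLp_finsetSum _ fun i _ => (hs i).1
  have hS0 : S =ᵐ[volume.restrict U] 0 := by
    refine ae_eq_zero_of_integral_sq hSm ?_
    simp only [hS, Finset.sum_mul_sum]
    rw [integral_finsetSum _ fun i _ => integrable_finsetSum _ fun j _ =>
      integrable_mul (hs i).1 (hs j).1, ← h0]
    exact Finset.sum_congr rfl fun i _ => integral_finsetSum _ fun j _ =>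
      integrable_mul (hs i).1 (hs j).1
  refine ae_eq_zero_of_hasLaplacian_zero hUo hUb hr hst hv hw fun φ hφ => ?_
  rw [hlap φ hφ, ← integral_finsetSum _ fun i _ => integrable_mul (hs i).1 (hφ.memLp _)]
  simp only [← Finset.sum_mul]
  exact integral_mul_congr hS0

end Uniqueness

/-! ## Uniqueness of traces, and functions with vanishing traces -/

namespace FlatDomain

variable {d : ℕ} {D : Faceted (d + 1)} (X : FlatDomain D)

include X

/-- The complement of the other closed pieces is open and contains the interior of piece `k`; test
functions supported there see only the `k`-th term. -/
theorem ae_eq_zero_of_forall_sum {g : Fin D.n → E (d + 1) → ℝ}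
    (hg : ∀ k, MemLp (g k) 2 (D.meas k))
    (h : ∀ φ, IsTest univ φ → ∑ k, ∫ x, g k x * φ x ∂(D.meas k) = 0) (k : Fin D.n) :
    g k =ᵐ[D.meas k] 0 := by
  have hfin := X.isFiniteMeasure_meas k
  set U : Set (E (d + 1)) := (⋃ l ∈ ({k}ᶜ : Set (Fin D.n)), X.chart l '' closure (X.base l))ᶜ
    with hU
  have hUo : IsOpen U := by
    rw [hU, isOpen_compl_iff]
    refine Set.Finite.isClosed_biUnion (Set.toFinite _) fun l _ => ?_
    exact ((X.base_bounded l).isCompact_closure.image (X.chart l).continuous).isClosed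
  have hkU : X.chart k '' X.base k ⊆ U := by
    intro x hx hx'
    simp only [mem_iUnion] at hx'
    obtain ⟨l, hl, hxl⟩ := hx'
    exact Set.disjoint_left.1 (X.disjoint k l (Ne.symm hl)) hx hxl
  have hloc : LocallyIntegrableOn (g k) U (D.meas k) :=
    ((hg k).integrable (by norm_num)).locallyIntegrable.locallyIntegrableOn U
  have := hUo.ae_eq_zero_of_integral_contDiff_smul_eq_zero hloc fun φ h1 h2 h3 => by
    have h4 := h φ ⟨h1, h2, subset_univ _⟩
    rw [Finset.sum_eq_single_of_mem k (Finset.mem_univ k)] at h4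
    · rw [← h4]
      exact integral_congr_ae (Filter.Eventually.of_forall fun x => by
        simp only [smul_eq_mul, mul_comm])
    · intro l _ hl
      refine integral_eq_zero_of_ae ?_
      filter_upwards [X.ae_meas_mem l] with x hx
      have hxU : x ∉ U := fun hxU => hxU (by
        simp only [mem_iUnion]
        exact ⟨l, hl, image_mono subset_closure hx⟩)
      have : φ x = 0 := image_eq_zero_of_notMem_tsupport fun h' => hxU (h3 h')
      simp [this]
  filter_upwards [this, X.ae_meas_mem k] with x hx hxk
  exact hx (hkU hxk)

theorem exists_normal_ne_zero (k : Fin D.n) : ∃ i, D.normal k i ≠ 0 := by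
  by_contra! h
  have : D.normal k = 0 := by ext i; simp [h i]
  have h1 := X.norm_normal k
  rw [this, norm_zero] at h1
  exact one_ne_zero h1.symm

/-- Green's formula determines `nᵢ g` for each `i`, and on each flat piece some component of the
unit normal is a nonzero constant. -/
theorem trace_unique {u g g' : E (d + 1) → ℝ} (h : HasTrace D u g) (h' : HasTrace D u g')
    (k : Fin D.n) : g =ᵐ[D.meas k] g' := by
  have hfin := X.isFiniteMeasure_meas
  obtain ⟨i, hi⟩ := X.exists_normal_ne_zero k
  have := X.ae_eq_zero_of_forall_sum (g := fun k => D.normal k i • ((-1 : ℝ) • g' + g))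
    (fun k => (memLp_lincomb (-1) (h'.2.1 k) (h.2.1 k)).const_smul _) (fun φ hφ => by
      have h1 := h.2.2 i φ hφ
      rw [h'.2.2 i φ hφ, ← sub_eq_zero, ← Finset.sum_sub_distrib] at h1
      rw [← neg_eq_zero, ← h1, ← Finset.sum_neg_distrib]
      refine Finset.sum_congr rfl fun k _ => ?_
      have h2 := integral_lincomb_mul (-1) (h'.2.1 k) (h.2.1 k) (hφ.memLp (p := 2) (D.meas k))
      simp only [Pi.smul_apply (D.normal k i), smul_eq_mul (D.normal k i), mul_assoc,
        integral_const_mul, h2]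
      ring) k
  filter_upwards [this] with x hx
  have h3 := (mul_eq_zero.1 hx).resolve_left hi
  simp only [Pi.add_apply, Pi.smul_apply, smul_eq_mul] at h3
  linarith

omit X in
theorem isWeakPartialZero {u g : E (d + 1) → ℝ} (h : HasTrace D u g)
    (h0 : ∀ k, g =ᵐ[D.meas k] 0) (i : Fin (d + 1)) :
    IsWeakPartialZero D.carrier i u (weakDeriv D.carrier i u) := by
  refine ⟨h.1.memLp_weakDeriv i, fun φ hφ => ?_⟩
  have h1 := h.2.2 i φ hφ
  rw [integral_add (integrable_mul h.1.1 ((hφ.pderiv i).memLp _))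
    (integrable_mul (h.1.memLp_weakDeriv i) (hφ.memLp _))] at h1
  rw [Finset.sum_eq_zero fun k _ => by
    rw [integral_mul_congr (h0 k)]; simp] at h1
  linarith

section Star

variable {c : E (d + 1)} {r : ℝ} (hr : 0 < r)
  (hs : ∀ y ∈ Metric.ball c r, StarConvex ℝ y D.carrier)

include hr hs in
theorem ae_eq_zero_of_hasLaplacian {u g : E (d + 1) → ℝ} (h : HasTrace D u g)
    (h0 : ∀ k, g =ᵐ[D.meas k] 0) (hL : HasLaplacian D.carrier u 0) :
    u =ᵐ[volume.restrict D.carrier] 0 :=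
  ae_eq_zero_of_hasLaplacian_zero X.isOpen X.bounded hr hs h.1.1 (isWeakPartialZero h h0) hL

/-- A vanishing trace has vanishing tangential derivatives. Green's formula for `∂ᵢu` in direction
`j` and for `∂ⱼu` in direction `i` has the same volume terms, so `nⱼ Gᵢ = nᵢ Gⱼ`. Together with `n ·
G = 0` and `|n| = 1` this gives `G = 0`. -/
theorem grad_trace_eq_zero {u g : E (d + 1) → ℝ} {G : Fin (d + 1) → E (d + 1) → ℝ}
    (hu : MemH2 D.carrier u) (h : HasTrace D u g) (h0 : ∀ k, g =ᵐ[D.meas k] 0)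
    (hG : ∀ i, HasTrace D (weakDeriv D.carrier i u) (G i))
    (hn : ∀ k, (fun x => ∑ i, G i x * D.normal k i) =ᵐ[D.meas k] 0) (j : Fin (d + 1))
    (k : Fin D.n) : G j =ᵐ[D.meas k] 0 := by
  have hfin := X.isFiniteMeasure_meas
  have hsymm : ∀ i j k, D.normal k j • G i =ᵐ[D.meas k] D.normal k i • G j := by
    intro i j k
    have := X.ae_eq_zero_of_forall_sum
      (g := fun k => D.normal k j • G i + (-1 : ℝ) • (D.normal k i • G j))
      (fun k => (((hG i).2.1 k).const_smul _).add ((((hG j).2.1 k).const_smul _).const_smul _))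
      (fun φ hφ => by
        have key : ∀ i j, ∑ k, D.normal k j * ∫ x, G i x * φ x ∂(D.meas k) =
            -(∫ x in D.carrier, u x * pderiv i (pderiv j φ) x) +
              ∫ x in D.carrier, weakDeriv D.carrier j (weakDeriv D.carrier i u) x * φ x := by
          intro i j
          rw [← (hG i).2.2 j φ hφ, integral_add
            (integrable_mul (hu.1.memLp_weakDeriv i) ((hφ.pderiv j).memLp _))
            (integrable_mul ((hu.2 i).memLp_weakDeriv j) (hφ.memLp _)),
            (isWeakPartialZero h h0 i).2 _ (hφ.pderiv j), neg_neg]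
        have h1 := key i j
        have h2 := key j i
        rw [pderiv_comm hφ.1, ← integral_mul_congr (hu.weakDeriv_comm X.isOpen i j)] at h2
        rw [← h1, ← sub_eq_zero, ← Finset.sum_sub_distrib] at h2
        rw [← neg_eq_zero, ← h2, ← Finset.sum_neg_distrib]
        refine Finset.sum_congr rfl fun k _ => ?_
        have e1 := integrable_mul ((hG i).2.1 k) (hφ.memLp (p := 2) (D.meas k))
        have e2 := integrable_mul ((hG j).2.1 k) (hφ.memLp (p := 2) (D.meas k))
        rw [← integral_const_mul, ← integral_const_mul,
          ← integral_sub (e2.const_mul _) (e1.const_mul _), ← integral_neg]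
        refine integral_congr_ae (Filter.Eventually.of_forall fun x => ?_)
        simp only [Pi.add_apply, Pi.smul_apply, smul_eq_mul]
        ring) k
    filter_upwards [this] with x hx
    simp only [Pi.add_apply, Pi.smul_apply, smul_eq_mul, Pi.zero_apply] at hx ⊢
    linarith
  have hall : ∀ᵐ x ∂(D.meas k), ∀ i, D.normal k i * G j x = D.normal k j * G i x :=
    ae_all_iff.2 fun i => (hsymm j i k).mono fun x hx => by simpa using hx
  have hnn : ∑ i, D.normal k i * D.normal k i = 1 := by
    have := X.norm_normal k
    rw [EuclideanSpace.norm_eq, Real.sqrt_eq_one] at this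
    rw [← this]
    exact Finset.sum_congr rfl fun i _ => by rw [Real.norm_eq_abs, sq_abs, sq]
  filter_upwards [hall, hn k] with x hx hx2
  simp only [Pi.zero_apply] at hx2 ⊢
  calc G j x = (∑ i, D.normal k i * D.normal k i) * G j x := by rw [hnn, one_mul]
    _ = ∑ i, D.normal k j * (G i x * D.normal k i) := by
      rw [Finset.sum_mul]
      refine Finset.sum_congr rfl fun i _ => ?_
      rw [mul_assoc, hx i]; ring
    _ = 0 := by rw [← Finset.mul_sum, hx2, mul_zero]

include hr hs in
theorem ae_eq_zero_of_hasBilaplacian {u g : E (d + 1) → ℝ} {G : Fin (d + 1) → E (d + 1) → ℝ}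
    (hu : MemH2 D.carrier u) (h : HasTrace D u g) (h0 : ∀ k, g =ᵐ[D.meas k] 0)
    (hG : ∀ i, HasTrace D (weakDeriv D.carrier i u) (G i))
    (hn : ∀ k, (fun x => ∑ i, G i x * D.normal k i) =ᵐ[D.meas k] 0)
    (hL : HasBilaplacian D.carrier u 0) : u =ᵐ[volume.restrict D.carrier] 0 :=
  ae_eq_zero_of_hasBilaplacian_zero X.isOpen X.bounded hr hs hu.1.1 (isWeakPartialZero h h0)
    (fun i => isWeakPartialZero (hG i) (X.grad_trace_eq_zero hu h h0 hG hn i) i) hL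

include hr hs in
-- An affine function is harmonic and its own trace, so uniqueness for the Dirichlet problem
-- applies. This makes boundary moments a definite normalisation on `ℙ₁`.
theorem affine_eq_zero {q : E (d + 1) → ℝ} (hq : q ∈ Poly (d + 1) 1)
    (h : ∀ k, q =ᵐ[D.meas k] 0) : q = 0 := by
  have hc := Poly.contDiff hq
  have hL := hasLaplacian_of_contDiff (U := D.carrier) hc
  rw [laplacian_eq_sum hc, show (fun x => ∑ i, pderiv i (pderiv i q) x) = 0 by
    funext x
    exact Finset.sum_eq_zero fun i _ => by
      rw [pderiv_eq_zero (Poly.pderiv hq i)]; rfl] at hL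
  exact Poly.eq_of_ae_eq hq (Poly.zero (k := 0)) X.isOpen X.nonempty
    (X.ae_eq_zero_of_hasLaplacian hr hs (X.hasTrace_of_contDiff hr hs hc) h hL)

end Star

end FlatDomain

/-! ## The energy forms -/

section Forms

variable {d : ℕ} {U V : Set (E d)} {u v w u' : E d → ℝ}

theorem gradForm_comm (u v : E d → ℝ) : gradForm U u v = gradForm U v u := by
  simp only [gradForm, mul_comm]

theorem gradForm_congr (h : u =ᵐ[volume.restrict U] u') (v : E d → ℝ) :
    gradForm U u v = gradForm U u' v := by
  simp only [gradForm, weakDeriv_congr h]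

theorem gradForm_eq_sum (hu : MemH1 U u) (hv : MemH1 U v) :
    gradForm U u v = ∑ i, ∫ x in U, weakDeriv U i u x * weakDeriv U i v x :=
  integral_finsetSum _ fun i _ => integrable_mul (hu.memLp_weakDeriv i) (hv.memLp_weakDeriv i)

theorem gradForm_lincomb (hU : IsOpen U) (c : ℝ) (hu : MemH1 U u) (hv : MemH1 U v)
    (hw : MemH1 U w) : gradForm U (c • u + v) w = c * gradForm U u w + gradForm U v w := by
  rw [gradForm_eq_sum (hu.lincomb c hv) hw, gradForm_eq_sum hu hw, gradForm_eq_sum hv hw,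
    Finset.mul_sum, ← Finset.sum_add_distrib]
  refine Finset.sum_congr rfl fun i _ => ?_
  rw [integral_mul_congr (weakDeriv_lincomb hU c hu hv i),
    integral_lincomb_mul c (hu.memLp_weakDeriv i) (hv.memLp_weakDeriv i) (hw.memLp_weakDeriv i)]

theorem gradForm_self_nonneg (u : E d → ℝ) : 0 ≤ gradForm U u u :=
  integral_nonneg fun _ => Finset.sum_nonneg fun _ _ => mul_self_nonneg _

theorem weakDeriv_eq_zero_of_gradForm (hu : MemH1 U u) (h : gradForm U u u = 0) (i : Fin d) :
    weakDeriv U i u =ᵐ[volume.restrict U] 0 := by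
  rw [gradForm_eq_sum hu hu, Finset.sum_eq_zero_iff_of_nonneg fun i _ =>
    integral_nonneg fun x => mul_self_nonneg _] at h
  exact ae_eq_zero_of_integral_sq (hu.memLp_weakDeriv i) (h i (Finset.mem_univ i))

theorem hessForm_comm (u v : E d → ℝ) : hessForm U u v = hessForm U v u := by
  simp only [hessForm, mul_comm]

theorem hessForm_congr (h : u =ᵐ[volume.restrict U] u') (v : E d → ℝ) :
    hessForm U u v = hessForm U u' v := by
  simp only [hessForm, weakDeriv_congr h]

theorem hessForm_eq_sum (hu : MemH2 U u) (hv : MemH2 U v) :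
    hessForm U u v = ∑ i, gradForm U (weakDeriv U i u) (weakDeriv U i v) :=
  integral_finsetSum _ fun i _ => integrable_finsetSum _ fun j _ =>
    integrable_mul ((hu.2 i).memLp_weakDeriv j) ((hv.2 i).memLp_weakDeriv j)

theorem hessForm_lincomb (hU : IsOpen U) (c : ℝ) (hu : MemH2 U u) (hv : MemH2 U v)
    (hw : MemH2 U w) : hessForm U (c • u + v) w = c * hessForm U u w + hessForm U v w := by
  rw [hessForm_eq_sum (hu.lincomb hU c hv) hw, hessForm_eq_sum hu hw, hessForm_eq_sum hv hw,
    Finset.mul_sum, ← Finset.sum_add_distrib]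
  refine Finset.sum_congr rfl fun i _ => ?_
  rw [gradForm_congr (weakDeriv_lincomb hU c hu.1 hv.1 i),
    gradForm_lincomb hU c (hu.2 i) (hv.2 i) (hw.2 i)]

theorem hessForm_self_nonneg (u : E d → ℝ) : 0 ≤ hessForm U u u :=
  integral_nonneg fun _ => Finset.sum_nonneg fun _ _ => Finset.sum_nonneg fun _ _ =>
    mul_self_nonneg _

theorem weakDeriv_eq_zero_of_hessForm (hu : MemH2 U u) (h : hessForm U u u = 0) (i j : Fin d) :
    weakDeriv U j (weakDeriv U i u) =ᵐ[volume.restrict U] 0 := by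
  rw [hessForm_eq_sum hu hu, Finset.sum_eq_zero_iff_of_nonneg fun i _ =>
    gradForm_self_nonneg _] at h
  exact weakDeriv_eq_zero_of_gradForm (hu.2 i) (h i (Finset.mem_univ i)) j

theorem poly_const_of_pderiv {k : ℕ} {q : E d → ℝ} (hq : q ∈ Poly d k)
    (h : ∀ i, pderiv i q = 0) : q ∈ Poly d 0 := by
  have hfd : ∀ x, fderiv ℝ q x = 0 := by
    intro x
    ext y
    rw [← (EuclideanSpace.basisFun (Fin d) ℝ).sum_repr y, map_sum]
    simp only [map_smul, EuclideanSpace.basisFun_apply]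
    refine (Finset.sum_eq_zero fun i _ => ?_).trans (by simp)
    have := congrFun (h i) x
    simp only [pderiv, Pi.zero_apply] at this
    rw [this, smul_zero]
  have : q = fun _ => q 0 := by
    funext x
    exact is_const_of_fderiv_eq_zero ((Poly.contDiff hq).differentiable (by simp)) hfd x 0
  rw [this]
  exact Poly.const _

/-- The first derivatives are constants `aᵢ`; subtracting `∑ aᵢ xᵢ` leaves a function with zero
gradient. -/
theorem poly_affine_of_pderiv {k : ℕ} {q : E d → ℝ} (hq : q ∈ Poly d k)
    (h : ∀ i j, pderiv j (pderiv i q) = 0) : q ∈ Poly d 1 := by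
  choose a ha using fun i => Poly.eq_const (poly_const_of_pderiv (Poly.pderiv hq i) (h i))
  let l : E d → ℝ := fun x => ∑ i, a i * x i
  have hl : l ∈ Poly d 1 := Poly.sum _ fun i _ => Poly.smul (a i) (Poly.coord i)
  have hld : ∀ i, pderiv i l = fun _ => a i := by
    intro i
    funext x
    have : l = ⇑(∑ i, a i • (EuclideanSpace.proj i : E d →L[ℝ] ℝ)) := by
      funext y; simp [l]
    rw [pderiv, this, ContinuousLinearMap.fderiv]
    simp
  have hql : q - l ∈ Poly d (max k 1) :=
    Poly.sub (Poly.mono (le_max_left _ _) hq) (Poly.mono (le_max_right _ _) hl)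
  have h0 := poly_const_of_pderiv hql fun i => by
    have e : q - l = (-1 : ℝ) • l + q := by
      funext x; simp only [Pi.sub_apply, Pi.add_apply, Pi.smul_apply, smul_eq_mul]; ring
    have hlc := Poly.contDiff hl
    rw [e, pderiv_add (Poly.contDiff (Poly.smul (-1) hl)) (Poly.contDiff hq), pderiv_smul hlc, hld, ha]
    funext x; simp
  have e : q = (q - l) + l := by simp
  rw [e]
  exact Poly.add (Poly.mono zero_le_one h0) hl

/-- The properties of an energy form that make the projection onto `ℙₖ` well defined. -/
structure IsEnergyForm (U : Set (E d)) (k : ℕ) (M : (E d → ℝ) → Prop)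
    (a : (E d → ℝ) → (E d → ℝ) → ℝ) : Prop where
  mem_poly : ∀ {l : ℕ} {q : E d → ℝ}, q ∈ Poly d l → M q
  lincomb : ∀ (c : ℝ) {u v w : E d → ℝ}, M u → M v → M w → a (c • u + v) w = c * a u w + a v w
  comm : ∀ u v, a u v = a v u
  eq_zero : ∀ (v : E d → ℝ) {w : E d → ℝ}, w ∈ Poly d (k - 1) → a v w = 0
  definite : ∀ {q : E d → ℝ}, q ∈ Poly d k → a q q = 0 → q ∈ Poly d (k - 1)

theorem isEnergyForm_gradForm (hU : IsOpen U) (hne : U.Nonempty) (hb : Bornology.IsBounded U) :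
    IsEnergyForm U 1 (MemH1 U) (gradForm U) where
  mem_poly hq := memH1_of_contDiff hU hb (Poly.contDiff hq)
  lincomb c _ _ _ hu hv hw := gradForm_lincomb hU c hu hv hw
  comm := gradForm_comm
  eq_zero v w hw := by
    refine integral_eq_zero_of_ae ?_
    filter_upwards [ae_all_iff.2 fun i => weakDeriv_of_contDiff hU hb (Poly.contDiff hw) i]
      with x hx
    exact Finset.sum_eq_zero fun i _ => by rw [hx, pderiv_eq_zero hw]; simp
  definite {q} hq h := by
    have hc := Poly.contDiff hq
    refine poly_const_of_pderiv hq fun i => Poly.eq_of_ae_eq (Poly.pderiv hq i)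
      (Poly.zero (k := 0)) hU hne ?_
    exact (weakDeriv_of_contDiff hU hb hc i).symm.trans
      (weakDeriv_eq_zero_of_gradForm (memH1_of_contDiff hU hb hc) h i)

theorem isEnergyForm_hessForm (hU : IsOpen U) (hne : U.Nonempty) (hb : Bornology.IsBounded U) :
    IsEnergyForm U 2 (MemH2 U) (hessForm U) where
  mem_poly hq := memH2_of_contDiff hU hb (Poly.contDiff hq)
  lincomb c _ _ _ hu hv hw := hessForm_lincomb hU c hu hv hw
  comm := hessForm_comm
  eq_zero v w hw := by
    refine integral_eq_zero_of_ae ?_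
    filter_upwards [ae_all_iff.2 fun i => ae_all_iff.2 fun j =>
      weakDeriv_weakDeriv_of_contDiff hU hb (Poly.contDiff hw) i j] with x hx
    exact Finset.sum_eq_zero fun i _ => Finset.sum_eq_zero fun j _ => by
      rw [hx, pderiv_eq_zero (Poly.pderiv hw i)]; simp
  definite {q} hq h := by
    have hc := Poly.contDiff hq
    refine poly_affine_of_pderiv hq fun i j => Poly.eq_of_ae_eq (Poly.pderiv (Poly.pderiv hq i) j)
      (Poly.zero (k := 0)) hU hne ?_
    exact (weakDeriv_weakDeriv_of_contDiff hU hb hc i j).symm.trans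
      (weakDeriv_eq_zero_of_hessForm (memH2_of_contDiff hU hb hc) h i j)

end Forms

/-! ## Projections onto polynomials -/

/-- With a linear projection onto `W`, both sets of conditions merge into one square system. Testing
on `W` isolates `b`, because `a` and `α` vanish there; what remains is the condition on `a`.
Injectivity is `hab`, and in finite dimension it gives surjectivity. -/
theorem exists_projection {V : Type*} [AddCommGroup V] [Module ℝ V] [Module.Finite ℝ V]
    (W : Submodule ℝ V) (a b : V →ₗ[ℝ] Module.Dual ℝ V) (ha : ∀ v, ∀ w ∈ W, a v w = 0)
    (hab : ∀ v, (∀ p, a v p = 0) → (∀ w ∈ W, b v w = 0) → v = 0)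
    (α β : Module.Dual ℝ V) (hα : ∀ w ∈ W, α w = 0) :
    ∃ v, (∀ p, a v p = α p) ∧ ∀ w ∈ W, b v w = β w := by
  obtain ⟨π, hπ⟩ := W.subtype.exists_leftInverse_of_injective (by simp)
  have hπW : ∀ w (hw : w ∈ W), (π w : V) = w := fun w hw => by
    have := LinearMap.congr_fun hπ ⟨w, hw⟩
    exact congrArg Subtype.val this
  let T : Module.Dual ℝ V →ₗ[ℝ] Module.Dual ℝ V := (W.subtype ∘ₗ π).dualMap
  have hT : ∀ f v, T f v = f (π v) := fun f v => rfl
  let B : V →ₗ[ℝ] Module.Dual ℝ V := a + T ∘ₗ b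
  have hB : ∀ v p, B v p = a v p + b v (π p) := fun v p => rfl
  have hsolve : ∀ v (α β : Module.Dual ℝ V), (∀ w ∈ W, α w = 0) → B v = α + T β →
      (∀ p, a v p = α p) ∧ ∀ w ∈ W, b v w = β w := by
    intro v α β hα h
    have h1 : ∀ w ∈ W, b v w = β w := fun w hw => by
      have := LinearMap.congr_fun h w
      rw [hB, ha v w hw, LinearMap.add_apply, hα w hw, hT, hπW w hw] at this
      simpa using this
    refine ⟨fun p => ?_, h1⟩
    have := LinearMap.congr_fun h p
    rw [hB, LinearMap.add_apply, hT, h1 _ (π p).2] at this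
    simpa using this
  have hinj : Function.Injective B := by
    rw [injective_iff_map_eq_zero]
    intro v hv
    obtain ⟨h1, h2⟩ := hsolve v 0 0 (by simp) (by rw [hv]; simp)
    exact hab v h1 h2
  have hsurj := (LinearMap.injective_iff_surjective_of_finrank_eq_finrank
    (Subspace.dual_finrank_eq (K := ℝ) (V := V)).symm).1 hinj
  obtain ⟨v, hv⟩ := hsurj (α + T β)
  exact ⟨v, hsolve v α β hα hv⟩

/-- A domain with flat boundary pieces that is star-shaped with respect to a ball. -/
structure StarDomain {d : ℕ} (D : Faceted (d + 1)) extends FlatDomain D where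
  center : E (d + 1)
  radius : ℝ
  radius_pos : 0 < radius
  star : ∀ y ∈ Metric.ball center radius, StarConvex ℝ y D.carrier

/-- `q ∈ ℙₖ` is the projection of `v` with respect to the form `a`, normalised by the boundary
moments against `ℙₖ₋₁`. -/
def IsEnergyProj {d : ℕ} (D : Faceted d) (k : ℕ) (a : (E d → ℝ) → (E d → ℝ) → ℝ)
    (v q : E d → ℝ) : Prop :=
  q ∈ Poly d k ∧ (∀ p ∈ Poly d k, a q p = a v p) ∧
    ∃ g, HasTrace D v g ∧ ∀ w ∈ Poly d (k - 1),
      D.bdryInt (fun x => q x * w x) = D.bdryInt (fun x => g x * w x)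

namespace StarDomain

variable {d : ℕ} {D : Faceted (d + 1)} (X : StarDomain D) {k : ℕ}
  {M : (E (d + 1) → ℝ) → Prop} {a : (E (d + 1) → ℝ) → (E (d + 1) → ℝ) → ℝ}
  {u v q q' g g' w : E (d + 1) → ℝ}

include X

theorem hasTrace_poly {l : ℕ} (hq : q ∈ Poly (d + 1) l) : HasTrace D q q :=
  X.hasTrace_of_contDiff X.radius_pos X.star (Poly.contDiff hq)

theorem memLp_poly {l : ℕ} (hq : q ∈ Poly (d + 1) l) (k : Fin D.n) : MemLp q 2 (D.meas k) :=
  X.memLp_meas_of_continuous k (Poly.continuous hq)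

omit X in
theorem bdryInt_lincomb (c : ℝ) (hg : ∀ k, MemLp g 2 (D.meas k))
    (hg' : ∀ k, MemLp g' 2 (D.meas k)) (hw : ∀ k, MemLp w 2 (D.meas k)) :
    D.bdryInt (fun x => (c • g + g') x * w x) =
      c * D.bdryInt (fun x => g x * w x) + D.bdryInt (fun x => g' x * w x) := by
  simp only [Faceted.bdryInt, Finset.mul_sum, ← Finset.sum_add_distrib]
  exact Finset.sum_congr rfl fun k _ => integral_lincomb_mul c (hg k) (hg' k) (hw k)

theorem bdryInt_trace_unique (h : HasTrace D v g) (h' : HasTrace D v g') (w : E (d + 1) → ℝ) :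
    D.bdryInt (fun x => g x * w x) = D.bdryInt (fun x => g' x * w x) :=
  Finset.sum_congr rfl fun k _ => integral_mul_congr (X.trace_unique h h' k)

theorem affine_eq_zero_of_bdryInt (hq : q ∈ Poly (d + 1) 1)
    (h : D.bdryInt (fun x => q x * q x) = 0) : q = 0 := by
  refine X.affine_eq_zero X.radius_pos X.star hq fun k => ?_
  rw [Faceted.bdryInt, Finset.sum_eq_zero_iff_of_nonneg fun k _ =>
    integral_nonneg fun x => mul_self_nonneg _] at h
  have h1 := (integral_eq_zero_iff_of_nonneg (fun x => mul_self_nonneg (q x))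
    (integrable_mul (X.memLp_poly hq k) (X.memLp_poly hq k))).1 (h k (Finset.mem_univ k))
  exact h1.mono fun x hx => mul_self_eq_zero.1 hx

/-- Zero energy lowers the degree to `k - 1`, so `q` can be its own moment test. Since `k ≤ 2`, it
is then affine and determined by its boundary values. -/
theorem poly_eq_zero (ha : IsEnergyForm D.carrier k M a) (hk : k ≤ 2)
    (hq : q ∈ Poly (d + 1) k) (h : a q q = 0)
    (hb : ∀ w ∈ Poly (d + 1) (k - 1), D.bdryInt (fun x => q x * w x) = 0) : q = 0 := by
  have h1 := ha.definite hq h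
  exact X.affine_eq_zero_of_bdryInt (Poly.mono (by omega) h1) (hb q h1)

theorem isEnergyProj_lincomb (ha : IsEnergyForm D.carrier k M a) (c : ℝ) (hu : M u) (hv : M v)
    (h : IsEnergyProj D k a u q) (h' : IsEnergyProj D k a v q') :
    IsEnergyProj D k a (c • u + v) (c • q + q') := by
  obtain ⟨h1, h2, g, h3, h4⟩ := h
  obtain ⟨h1', h2', g', h3', h4'⟩ := h'
  have hfin := X.isFiniteMeasure_meas
  refine ⟨Poly.add (Poly.smul c h1) h1', fun p hp => ?_, c • g + g',
    h3.lincomb X.isOpen c h3', fun w hw => ?_⟩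
  · rw [ha.lincomb c (ha.mem_poly h1) (ha.mem_poly h1') (ha.mem_poly hp),
      ha.lincomb c hu hv (ha.mem_poly hp), h2 p hp, h2' p hp]
  · rw [bdryInt_lincomb c (X.memLp_poly h1) (X.memLp_poly h1') (X.memLp_poly hw),
      bdryInt_lincomb c h3.2.1 h3'.2.1 (X.memLp_poly hw), h4 w hw, h4' w hw]

theorem isEnergyProj_unique (ha : IsEnergyForm D.carrier k M a) (hk : k ≤ 2)
    (h : IsEnergyProj D k a v q) (h' : IsEnergyProj D k a v q') : q = q' := by
  obtain ⟨h1, h2, g, h3, h4⟩ := h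
  obtain ⟨h1', h2', g', h3', h4'⟩ := h'
  have hm := Poly.add (Poly.smul (-1) h1') h1
  have : (-1 : ℝ) • q' + q = 0 := by
    refine X.poly_eq_zero ha hk hm ?_ fun w hw => ?_
    · rw [ha.lincomb (-1) (ha.mem_poly h1') (ha.mem_poly h1) (ha.mem_poly hm), h2 _ hm, h2' _ hm]
      ring
    · rw [bdryInt_lincomb (-1) (X.memLp_poly h1') (X.memLp_poly h1) (X.memLp_poly hw),
        h4 w hw, h4' w hw, X.bdryInt_trace_unique h3 h3']
      ring
  rw [neg_one_smul, neg_add_eq_zero] at this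
  exact this.symm

theorem isEnergyProj_poly (hq : q ∈ Poly (d + 1) k) : IsEnergyProj D k a q q :=
  ⟨hq, fun _ _ => rfl, q, X.hasTrace_poly hq, fun _ _ => rfl⟩

theorem exists_isEnergyProj (ha : IsEnergyForm D.carrier k M a) (hk : k ≤ 2) (hv : M v)
    (hg : HasTrace D v g) : ∃ q, IsEnergyProj D k a v q := by
  have hp : ∀ q : polySub (d + 1) k, (q : E (d + 1) → ℝ) ∈ Poly (d + 1) k :=
    fun q => mem_polySub.1 q.2
  let W : Submodule ℝ (polySub (d + 1) k) := (polySub (d + 1) (k - 1)).comap (Submodule.subtype _)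
  have hW : ∀ w ∈ W, (w : E (d + 1) → ℝ) ∈ Poly (d + 1) (k - 1) := fun w hw =>
    mem_polySub.1 hw
  have hal : ∀ {u : E (d + 1) → ℝ}, M u → ∀ (c : ℝ) (p p' : polySub (d + 1) k),
      a u ((c • p + p' : polySub (d + 1) k) : E (d + 1) → ℝ) = c * a u p + a u p' := by
    intro u hu c p p'
    simp only [Submodule.coe_add, Submodule.coe_smul]
    rw [ha.comm, ha.lincomb c (ha.mem_poly (hp p)) (ha.mem_poly (hp p')) hu, ha.comm u, ha.comm u]
  have hbl : ∀ {f : E (d + 1) → ℝ}, (∀ k, MemLp f 2 (D.meas k)) →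
      ∀ (c : ℝ) (p p' : polySub (d + 1) k),
      D.bdryInt (fun x => f x * (c • p + p' : polySub (d + 1) k).1 x) =
        c * D.bdryInt (fun x => f x * p.1 x) + D.bdryInt (fun x => f x * p'.1 x) := by
    intro f hf c p p'
    simp only [mul_comm (f _)]
    exact bdryInt_lincomb c (X.memLp_poly (hp p)) (X.memLp_poly (hp p')) hf
  have mkLin : ∀ (F : polySub (d + 1) k → ℝ),
      (∀ (c : ℝ) p p', F (c • p + p') = c * F p + F p') →
      ∃ L : Module.Dual ℝ (polySub (d + 1) k), ∀ p, L p = F p := by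
    intro F hF
    have h0 : F 0 = 0 := by have := hF 1 0 0; simp at this; exact this
    exact ⟨{ toFun := F
             map_add' := fun p p' => by have := hF 1 p p'; simpa using this
             map_smul' := fun c p => by have := hF c p 0; simpa [h0] using this },
      fun _ => rfl⟩
  obtain ⟨α, hα⟩ := mkLin (fun p => a v p) (hal hv)
  obtain ⟨β, hβ⟩ := mkLin (fun p => D.bdryInt (fun x => g x * p.1 x)) (hbl hg.2.1)
  let A : polySub (d + 1) k →ₗ[ℝ] Module.Dual ℝ (polySub (d + 1) k) :=
    LinearMap.mk₂' ℝ ℝ (fun q p => a q p)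
      (fun q q' p => by
        have := ha.lincomb 1 (ha.mem_poly (hp q)) (ha.mem_poly (hp q')) (ha.mem_poly (hp p))
        simpa using this)
      (fun c q p => by
        have := ha.lincomb c (ha.mem_poly (hp q)) (ha.mem_poly (Poly.zero (k := 0)))
          (ha.mem_poly (hp p))
        have h0 : a 0 p = 0 := by rw [ha.comm]; exact ha.eq_zero _ Poly.zero
        simpa [h0] using this)
      (fun q p p' => by have := hal (ha.mem_poly (hp q)) 1 p p'; simpa using this)
      (fun c q p => by
        have := hal (ha.mem_poly (hp q)) c p 0
        have h0 : a q 0 = 0 := ha.eq_zero _ Poly.zero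
        simpa [h0] using this)
  let B : polySub (d + 1) k →ₗ[ℝ] Module.Dual ℝ (polySub (d + 1) k) :=
    LinearMap.mk₂' ℝ ℝ (fun q p => D.bdryInt (fun x => q.1 x * p.1 x))
      (fun q q' p => by
        have := bdryInt_lincomb 1 (X.memLp_poly (hp q)) (X.memLp_poly (hp q')) (X.memLp_poly (hp p))
        simpa using this)
      (fun c q p => by
        have := bdryInt_lincomb c (X.memLp_poly (hp q)) (X.memLp_poly (Poly.zero (k := 0)))
          (X.memLp_poly (hp p))
        have h0 : D.bdryInt (fun _ => 0) = 0 := by simp [Faceted.bdryInt]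
        simpa [h0] using this)
      (fun q p p' => by have := hbl (X.memLp_poly (hp q)) 1 p p'; simpa using this)
      (fun c q p => by
        have := hbl (X.memLp_poly (hp q)) c p 0
        have h0 : D.bdryInt (fun _ => 0) = 0 := by simp [Faceted.bdryInt]
        simpa [h0] using this)
  obtain ⟨q, hq1, hq2⟩ := exists_projection W A B
    (fun q w hw => ha.eq_zero _ (hW w hw))
    (fun q h1 h2 => Subtype.ext (X.poly_eq_zero ha hk (hp q) (h1 q) fun w hw =>
      h2 ⟨w, mem_polySub.2 (Poly.mono (by omega) hw)⟩ (mem_polySub.2 hw)))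
    α β (fun w hw => by rw [hα]; exact ha.eq_zero _ (hW w hw))
  refine ⟨q, hp q, fun p hpp => ?_, g, hg, fun w hw => ?_⟩
  · have := hq1 ⟨p, mem_polySub.2 hpp⟩
    rwa [hα] at this
  · have := hq2 ⟨w, mem_polySub.2 (Poly.mono (by omega) hw)⟩ (mem_polySub.2 hw)
    rwa [hβ] at this

/-! ### The `H¹`-projection -/

theorem energyForm_grad : IsEnergyForm D.carrier 1 (MemH1 D.carrier) (gradForm D.carrier) :=
  isEnergyForm_gradForm X.isOpen X.nonempty X.bounded

theorem energyForm_hess : IsEnergyForm D.carrier 2 (MemH2 D.carrier) (hessForm D.carrier) :=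
  isEnergyForm_hessForm X.isOpen X.nonempty X.bounded

omit X in
theorem sub_form_eq_zero_iff (ha : IsEnergyForm D.carrier k M a) (hv : M v)
    (hq : q ∈ Poly (d + 1) k) :
    (∀ p ∈ Poly (d + 1) k, a (fun x => q x - v x) p = 0) ↔
      ∀ p ∈ Poly (d + 1) k, a q p = a v p := by
  have e : (fun x => q x - v x) = (-1 : ℝ) • v + q := by
    funext x; simp only [Pi.add_apply, Pi.smul_apply, smul_eq_mul]; ring
  refine forall₂_congr fun p hp => ?_
  rw [e, ha.lincomb (-1) hv (ha.mem_poly hq) (ha.mem_poly hp)]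
  constructor <;> intro h <;> linarith

theorem bdryInt_sub_eq_zero_iff (hq : q ∈ Poly (d + 1) k) (hg : ∀ k, MemLp g 2 (D.meas k))
    {l : ℕ} (hw : w ∈ Poly (d + 1) l) :
    D.bdryInt (fun x => (q x - g x) * w x) = 0 ↔
      D.bdryInt (fun x => q x * w x) = D.bdryInt (fun x => g x * w x) := by
  have e : (fun x => (q x - g x) * w x) = fun x => ((-1 : ℝ) • g + q) x * w x := by
    funext x; simp only [Pi.add_apply, Pi.smul_apply, smul_eq_mul]; ring
  rw [e, bdryInt_lincomb (-1) hg (X.memLp_poly hq) (X.memLp_poly hw)]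
  constructor <;> intro h <;> linarith

/-- The mean value condition is the moment condition against `ℙ₀`, since those polynomials are
constants. -/
theorem isGradProj_iff (hv : MemH1 D.carrier v) :
    IsGradProj D v q ↔ IsEnergyProj D 1 (gradForm D.carrier) v q := by
  refine and_congr_right fun hq => and_congr (sub_form_eq_zero_iff X.energyForm_grad hv hq)
    (exists_congr fun g => and_congr_right fun hg => ?_)
  constructor
  · intro h w hw
    obtain ⟨c, rfl⟩ := Poly.eq_const hw
    rw [← X.bdryInt_sub_eq_zero_iff hq hg.2.1 hw]
    simp only [Faceted.bdryInt, integral_mul_const, ← Finset.sum_mul] at h ⊢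
    rw [h, zero_mul]
  · intro h
    have h1 : (fun _ => (1 : ℝ)) ∈ Poly (d + 1) 0 := Poly.const 1
    have := (X.bdryInt_sub_eq_zero_iff hq hg.2.1 h1).2 (h _ h1)
    simpa using this

theorem isHessProj_iff (hv : MemH2 D.carrier v) :
    IsHessProj D v q ↔ IsEnergyProj D 2 (hessForm D.carrier) v q :=
  and_congr_right fun hq => and_congr (sub_form_eq_zero_iff X.energyForm_hess hv hq)
    (exists_congr fun _ => and_congr_right fun hg => forall₂_congr fun _ hw =>
      X.bdryInt_sub_eq_zero_iff hq hg.2.1 hw)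

theorem gradProj_spec (hg : HasTrace D v g) :
    IsEnergyProj D 1 (gradForm D.carrier) v (gradProj D v) := by
  have h : ∃ q, IsGradProj D v q := by
    simpa only [X.isGradProj_iff hg.1] using
      X.exists_isEnergyProj X.energyForm_grad (by norm_num) hg.1 hg
  rw [← X.isGradProj_iff hg.1, gradProj, dif_pos h]
  exact h.choose_spec

theorem hessProj_spec (hv : MemH2 D.carrier v) (hg : HasTrace D v g) :
    IsEnergyProj D 2 (hessForm D.carrier) v (hessProj D v) := by
  have h : ∃ q, IsHessProj D v q := by
    simpa only [X.isHessProj_iff hv] using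
      X.exists_isEnergyProj X.energyForm_hess le_rfl hv hg
  rw [← X.isHessProj_iff hv, hessProj, dif_pos h]
  exact h.choose_spec

theorem gradProj_eq (hg : HasTrace D v g)
    (h : IsEnergyProj D 1 (gradForm D.carrier) v q) : gradProj D v = q :=
  X.isEnergyProj_unique X.energyForm_grad (by norm_num) (X.gradProj_spec hg) h

theorem hessProj_eq (hv : MemH2 D.carrier v) (hg : HasTrace D v g)
    (h : IsEnergyProj D 2 (hessForm D.carrier) v q) : hessProj D v = q :=
  X.isEnergyProj_unique X.energyForm_hess le_rfl (X.hessProj_spec hv hg) h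

theorem gradProj_lincomb (c : ℝ) (hg : HasTrace D u g) (hg' : HasTrace D v g') :
    gradProj D (c • u + v) = c • gradProj D u + gradProj D v := by
  have hfin := X.isFiniteMeasure_meas
  exact X.gradProj_eq (hg.lincomb X.isOpen c hg') (X.isEnergyProj_lincomb X.energyForm_grad c
    hg.1 hg'.1 (X.gradProj_spec hg) (X.gradProj_spec hg'))

theorem hessProj_lincomb (c : ℝ) (hu : MemH2 D.carrier u) (hv : MemH2 D.carrier v)
    (hg : HasTrace D u g) (hg' : HasTrace D v g') :
    hessProj D (c • u + v) = c • hessProj D u + hessProj D v := by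
  have hfin := X.isFiniteMeasure_meas
  exact X.hessProj_eq (hu.lincomb X.isOpen c hv) (hg.lincomb X.isOpen c hg')
    (X.isEnergyProj_lincomb X.energyForm_hess c hu hv (X.hessProj_spec hu hg)
      (X.hessProj_spec hv hg'))

theorem gradProj_poly (hq : q ∈ Poly (d + 1) 1) : gradProj D q = q :=
  X.gradProj_eq (X.hasTrace_poly hq) (X.isEnergyProj_poly hq)

theorem hessProj_poly (hq : q ∈ Poly (d + 1) 2) : hessProj D q = q :=
  X.hessProj_eq (memH2_of_contDiff X.isOpen X.bounded (Poly.contDiff hq)) (X.hasTrace_poly hq)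
    (X.isEnergyProj_poly hq)

omit X in
theorem gradProj_congr (h : u =ᵐ[volume.restrict D.carrier] v) : gradProj D u = gradProj D v := by
  have : IsGradProj D u = IsGradProj D v := by
    funext q
    have e : ∀ p, gradForm D.carrier (fun x => q x - u x) p =
        gradForm D.carrier (fun x => q x - v x) p :=
      gradForm_congr (h.mono fun x hx => by simp only [hx])
    have t : ∀ g, HasTrace D u g ↔ HasTrace D v g := fun g => ⟨fun t => t.congr h,
      fun t => t.congr h.symm⟩
    simp only [IsGradProj, e, t]
  unfold gradProj
  rw [this]

omit X in
theorem hessProj_congr (h : u =ᵐ[volume.restrict D.carrier] v) : hessProj D u = hessProj D v := by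
  have : IsHessProj D u = IsHessProj D v := by
    funext q
    have e : ∀ p, hessForm D.carrier (fun x => q x - u x) p =
        hessForm D.carrier (fun x => q x - v x) p :=
      hessForm_congr (h.mono fun x hx => by simp only [hx])
    have t : ∀ g, HasTrace D u g ↔ HasTrace D v g := fun g => ⟨fun t => t.congr h,
      fun t => t.congr h.symm⟩
    simp only [IsHessProj, e, t]
  unfold hessProj
  rw [this]

end StarDomain

/-! ## Polygons and polyhedra as domains with flat boundary pieces -/

namespace FlatDomain

variable {d : ℕ} {D : Faceted (d + 1)} (X : FlatDomain D)

include X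

/-- Each flat piece lies in a proper affine subspace. -/
theorem volume_frontier : volume (frontier D.carrier) = 0 := by
  rw [X.frontier_eq]
  refine measure_iUnion_null fun k => ?_
  let n := D.normal k
  let A : AffineSubspace ℝ (E (d + 1)) :=
    AffineSubspace.mk' (X.chart k 0) (LinearMap.ker (innerSL ℝ n : E (d + 1) →ₗ[ℝ] ℝ))
  have hA : A ≠ ⊤ := by
    intro h
    have h1 : n +ᵥ X.chart k 0 ∈ A := h ▸ AffineSubspace.mem_top ℝ _ _
    rw [AffineSubspace.mem_mk', vadd_vsub, LinearMap.mem_ker] at h1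
    have h2 : inner ℝ n n = 0 := h1
    rw [real_inner_self_eq_norm_sq, X.norm_normal] at h2
    norm_num at h2
  refine measure_mono_null ?_ (Measure.addHaar_affineSubspace volume A hA)
  rintro _ ⟨y, -, rfl⟩
  exact AffineSubspace.mem_mk'.2 (X.normal_orth k y 0)

end FlatDomain

/-- The coordinate on the one-dimensional Euclidean space. -/
def lineHomeo : E 1 ≃ₜ ℝ :=
  (EuclideanSpace.equiv (Fin 1) ℝ).toHomeomorph.trans (Homeomorph.funUnique (Fin 1) ℝ)

theorem lineHomeo_apply (y : E 1) : lineHomeo y = y 0 := rfl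

theorem measurePreserving_lineHomeo : MeasurePreserving lineHomeo volume volume :=
  (volume_preserving_funUnique (Fin 1) ℝ).comp
    (EuclideanSpace.volume_preserving_symm_measurableEquiv_toLp (Fin 1))

/-- Arc length parametrisation of the line through `a` and `b`. -/
def lineChart (a b : E 2) (h : a ≠ b) : E 1 →ᵃⁱ[ℝ] E 2 where
  toFun y := a + y 0 • ((dist a b)⁻¹ • (b - a))
  linear :=
    { toFun := fun y => y 0 • ((dist a b)⁻¹ • (b - a))
      map_add' := fun y z => by simp [add_smul]
      map_smul' := fun c y => by simp [mul_smul] }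
  map_vadd' y z := by
    simp only [LinearMap.coe_mk, AddHom.coe_mk, vadd_eq_add, PiLp.add_apply, add_smul]
    abel
  norm_map y := by
    have h0 : dist a b ≠ 0 := dist_ne_zero.2 h
    simp only [LinearMap.coe_mk, AddHom.coe_mk]
    rw [norm_smul, norm_smul, ← dist_eq_norm, dist_comm b a, norm_inv, Real.norm_eq_abs (dist a b),
      abs_of_nonneg dist_nonneg, inv_mul_cancel₀ h0, mul_one, EuclideanSpace.norm_eq]
    simp [Real.sqrt_sq_eq_abs]

theorem lineChart_eq (a b : E 2) (h : a ≠ b) (y : E 1) :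
    lineChart a b h y = AffineMap.lineMap a b (lineHomeo y / dist a b) := by
  rw [AffineMap.lineMap_apply, lineHomeo_apply]
  simp only [lineChart, vsub_eq_sub, vadd_eq_add, smul_smul, div_eq_mul_inv]
  exact add_comm _ _

/-- The parameter interval of an edge. -/
def lineBase (l : ℝ) : Set (E 1) := lineHomeo ⁻¹' Ioo 0 l

theorem closure_lineBase {l : ℝ} (hl : 0 < l) : closure (lineBase l) = lineHomeo ⁻¹' Icc 0 l := by
  rw [lineBase, ← lineHomeo.preimage_closure, closure_Ioo hl.ne]

theorem lineChart_image (a b : E 2) (h : a ≠ b) (s : Set ℝ) :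
    lineChart a b h '' (lineHomeo ⁻¹' ((fun t => t / dist a b) ⁻¹' s)) =
      AffineMap.lineMap a b '' s := by
  have h0 : dist a b ≠ 0 := dist_ne_zero.2 h
  ext x
  constructor
  · rintro ⟨y, hy, rfl⟩
    exact ⟨_, hy, (lineChart_eq a b h y).symm⟩
  · rintro ⟨t, ht, rfl⟩
    have e : lineHomeo (lineHomeo.symm (t * dist a b)) / dist a b = t := by
      rw [lineHomeo.apply_symm_apply, mul_div_cancel_right₀ _ h0]
    exact ⟨lineHomeo.symm (t * dist a b), by rw [mem_preimage, mem_preimage, e]; exact ht,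
      by rw [lineChart_eq, e]⟩

theorem preimage_div_Ioo {l : ℝ} (hl : 0 < l) : (fun t => t / l) ⁻¹' Ioo (0 : ℝ) 1 = Ioo 0 l := by
  ext t
  simp [div_pos_iff_of_pos_right hl, div_lt_one hl]

theorem preimage_div_Icc {l : ℝ} (hl : 0 < l) : (fun t => t / l) ⁻¹' Icc (0 : ℝ) 1 = Icc 0 l := by
  ext t
  rw [mem_preimage, mem_Icc, mem_Icc, le_div_iff₀ hl, zero_mul, div_le_one hl]

theorem lineChart_image_base (a b : E 2) (h : a ≠ b) :
    lineChart a b h '' lineBase (dist a b) = openSegment ℝ a b := by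
  have h0 : 0 < dist a b := dist_pos.2 h
  rw [openSegment_eq_image_lineMap, ← lineChart_image a b h, lineBase,
    preimage_div_Ioo h0]

theorem lineChart_image_closure (a b : E 2) (h : a ≠ b) :
    lineChart a b h '' closure (lineBase (dist a b)) = segment ℝ a b := by
  have h0 : 0 < dist a b := dist_pos.2 h
  rw [segment_eq_image_lineMap, ← lineChart_image a b h, closure_lineBase h0,
    preimage_div_Icc h0]

/-- The edge measure is given by a parametrisation over `[0, 1]` scaled by the length, whereas a
flat piece needs an isometric chart; the two endpoints are negligible. -/
theorem lineChart_measure (a b : E 2) (h : a ≠ b) :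
    (ENNReal.ofReal (dist a b) • volume.restrict (Icc (0 : ℝ) 1)).map
        (fun t => AffineMap.lineMap a b t) =
      (volume.restrict (lineBase (dist a b))).map (lineChart a b h) := by
  have h0 : 0 < dist a b := dist_pos.2 h
  have e1 : (lineChart a b h : E 1 → E 2) =
      (fun t : ℝ => AffineMap.lineMap a b t) ∘ (fun t => t * (dist a b)⁻¹) ∘ lineHomeo := by
    funext y
    exact lineChart_eq a b h y
  have hm : Measurable fun t : ℝ => AffineMap.lineMap a b t :=
    (AffineMap.lineMap_continuous (p := a) (q := b)).measurable
  have hd : Measurable fun t : ℝ => t * (dist a b)⁻¹ := by fun_prop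
  rw [e1, ← Measure.map_map hm (hd.comp lineHomeo.continuous.measurable),
    ← Measure.map_map hd lineHomeo.continuous.measurable, lineBase,
    ← Measure.restrict_map lineHomeo.continuous.measurable measurableSet_Ioo,
    measurePreserving_lineHomeo.map_eq]
  have e2 : Ioo 0 (dist a b) = (fun t => t * (dist a b)⁻¹) ⁻¹' Ioo (0 : ℝ) 1 :=
    (preimage_div_Ioo h0).symm
  rw [e2, ← Measure.restrict_map hd measurableSet_Ioo,
    Real.map_volume_mul_right (inv_ne_zero h0.ne'), inv_inv, abs_of_pos h0,
    Measure.restrict_smul, Measure.restrict_congr_set Ioo_ae_eq_Icc]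

/-- A polygon as a domain with flat boundary pieces. -/
def Polygon.flatDomain (F : Polygon) : FlatDomain (d := 1) F.faceted where
  chart e := lineChart (F.fst e) (F.snd e) (F.ne e)
  base e := lineBase (dist (F.fst e) (F.snd e))
  base_open e := isOpen_Ioo.preimage lineHomeo.continuous
  base_bounded e := by
    refine Bornology.IsBounded.subset (t := lineHomeo.symm '' Icc 0 (dist (F.fst e) (F.snd e)))
      (isCompact_Icc.image lineHomeo.symm.continuous).isBounded ?_
    intro y hy
    exact ⟨lineHomeo y, Ioo_subset_Icc_self hy, lineHomeo.symm_apply_apply y⟩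
  base_frontier e := by
    have h0 : 0 < dist (F.fst e) (F.snd e) := dist_pos.2 (F.ne e)
    rw [lineBase, ← lineHomeo.preimage_frontier, frontier_Ioo h0]
    exact ((toFinite {0, dist (F.fst e) (F.snd e)}).preimage
      lineHomeo.injective.injOn).measure_zero _
  meas_eq e := lineChart_measure _ _ (F.ne e)
  isOpen := F.isOpen
  nonempty := F.nonempty
  bounded := F.bounded
  frontier_eq := by
    have := F.frontier_eq
    simp only [← lineChart_image_closure _ _ (F.ne _)] at this
    exact this
  disjoint e e' h := by
    have := F.edges_disjoint e e' h
    rwa [← lineChart_image_base _ _ (F.ne e), ← lineChart_image_closure _ _ (F.ne e')] at this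
  norm_normal := F.norm_normal
  normal_orth e y z := by
    have e1 : lineChart (F.fst e) (F.snd e) (F.ne e) y - lineChart (F.fst e) (F.snd e) (F.ne e) z =
        ((y 0 - z 0) * (dist (F.fst e) (F.snd e))⁻¹) • (F.snd e - F.fst e) := by
      change (F.fst e + y 0 • _) - (F.fst e + z 0 • _) = _
      rw [add_sub_add_left_eq_sub, ← sub_smul, smul_smul]
    rw [e1, inner_smul_right]
    exact mul_eq_zero_of_right _ (F.normal_orth e)
  outward e x hx := by
    rw [lineChart_image_base] at hx
    exact F.outward e x hx

/-- A polyhedron as a domain with flat boundary pieces. -/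
def Polyhedron.flatDomain (P : Polyhedron) : FlatDomain (d := 2) P.faceted where
  chart := P.chart
  base f := (P.face f).carrier
  base_open f := (P.face f).isOpen
  base_bounded f := (P.face f).bounded
  -- A face is itself a flat domain one dimension lower.
  base_frontier f := (P.face f).flatDomain.volume_frontier
  meas_eq _ := rfl
  isOpen := P.isOpen
  nonempty := P.nonempty
  bounded := P.bounded
  frontier_eq := P.frontier_eq
  disjoint := P.faces_disjoint
  norm_normal := P.norm_normal
  normal_orth := P.normal_orth
  outward := P.outward

theorem diam_pos_of_isOpen {d : ℕ} {U : Set (E (d + 1))} (hU : IsOpen U) (hne : U.Nonempty)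
    (hb : Bornology.IsBounded U) : 0 < Metric.diam U := by
  obtain ⟨x, hx⟩ := hne
  exact Metric.diam_pos (infinite_of_mem_nhds x (hU.mem_nhds hx)).nontrivial hb

/-- A shape regular domain with flat boundary pieces is star-shaped with respect to a ball. -/
theorem FlatDomain.exists_starDomain {d : ℕ} {D : Faceted (d + 1)} (X : FlatDomain D) {ρ : ℝ}
    (hρ : 0 < ρ) (h : StarShapedBall D.carrier (ρ * Metric.diam D.carrier)) :
    Nonempty (StarDomain D) := by
  obtain ⟨c, r, hr, hs⟩ := h
  exact ⟨⟨X, c, r, (mul_pos hρ (diam_pos_of_isOpen X.isOpen X.nonempty X.bounded)).trans_le hr,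
    hs⟩⟩

/-! ## Virtual element functions and the polynomial data that determine them -/

theorem continuousOn_lincomb {X : Type*} [TopologicalSpace X] {f g : X → ℝ} {s : Set X} (c : ℝ)
    (hf : ContinuousOn f s) (hg : ContinuousOn g s) : ContinuousOn (c • f + g) s :=
  (hf.const_smul c).add hg

theorem eqOn_lincomb {X : Type*} {f g p q : X → ℝ} {s : Set X} (c : ℝ)
    (hf : EqOn f p s) (hg : EqOn g q s) : EqOn (c • f + g) (c • p + q) s := fun x hx => by
  simp [hf hx, hg hx]

theorem hasLaplacian_polySub_lincomb {d k : ℕ} {U : Set (E d)} (hU : IsOpen U)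
    (hb : Bornology.IsBounded U) {u v : E d → ℝ} (c : ℝ) (p q : polySub d k)
    (hu : MemLp u 2 (volume.restrict U)) (hv : MemLp v 2 (volume.restrict U))
    (h : HasLaplacian U u p) (h' : HasLaplacian U v q) :
    HasLaplacian U (c • u + v) (c • p + q : polySub d k) :=
  h.lincomb c hu hv (polySub_memLp (mem_polySub.1 p.2) hU hb)
    (polySub_memLp (mem_polySub.1 q.2) hU hb) h'

theorem hasBilaplacian_polySub_lincomb {d k : ℕ} {U : Set (E d)} (hU : IsOpen U)
    (hb : Bornology.IsBounded U) {u v : E d → ℝ} (c : ℝ) (p q : polySub d k)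
    (hu : MemLp u 2 (volume.restrict U)) (hv : MemLp v 2 (volume.restrict U))
    (h : HasBilaplacian U u p) (h' : HasBilaplacian U v q) :
    HasBilaplacian U (c • u + v) (c • p + q : polySub d k) :=
  h.lincomb c hu hv (polySub_memLp (mem_polySub.1 p.2) hU hb)
    (polySub_memLp (mem_polySub.1 q.2) hU hb) h'

theorem moments_lincomb {d k l : ℕ} {U : Set (E d)} (hU : IsOpen U) (hb : Bornology.IsBounded U)
    {u v P Q R : E d → ℝ} (c : ℝ) (hu : MemLp u 2 (volume.restrict U))
    (hv : MemLp v 2 (volume.restrict U)) (hP : P ∈ Poly d k) (hQ : Q ∈ Poly d k)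
    (hR : R = c • P + Q)
    (h : ∀ q ∈ Poly d l, ∫ x in U, P x * q x = ∫ x in U, u x * q x)
    (h' : ∀ q ∈ Poly d l, ∫ x in U, Q x * q x = ∫ x in U, v x * q x) :
    ∀ q ∈ Poly d l, ∫ x in U, R x * q x = ∫ x in U, (c • u + v) x * q x := fun q hq => by
  rw [hR, integral_lincomb_mul c (polySub_memLp hP hU hb) (polySub_memLp hQ hU hb)
    (polySub_memLp hq hU hb), integral_lincomb_mul c hu hv (polySub_memLp hq hU hb), h q hq, h' q hq]

theorem Polygon.ae_meas_mem_edge (F : Polygon) (e : Fin F.n) :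
    ∀ᵐ x ∂(F.faceted.meas e), x ∈ F.edge e := by
  filter_upwards [F.flatDomain.ae_meas_mem e] with x hx
  have h1 : F.flatDomain.chart e '' F.flatDomain.base e = openSegment ℝ (F.fst e) (F.snd e) :=
    lineChart_image_base _ _ (F.ne e)
  rw [h1] at hx
  exact openSegment_subset_segment ℝ _ _ hx

theorem Polygon.ae_meas_of_eqOn (F : Polygon) {g h : E 2 → ℝ} (e : Fin F.n)
    (hg : EqOn g h (F.edge e)) : g =ᵐ[F.faceted.meas e] h :=
  (F.ae_meas_mem_edge e).mono fun _ hx => hg hx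

theorem Polyhedron.ae_meas_eq (P : Polyhedron) {g h : E 3 → ℝ} (f : Fin P.n)
    (hg : g ∘ P.chart f =ᵐ[volume.restrict (P.face f).carrier] h ∘ P.chart f) :
    g =ᵐ[P.faceted.meas f] h :=
  (P.flatDomain.ae_meas_iff f).2 hg

theorem chart_coord_mem_poly (P : Polyhedron) (f : Fin P.n) {k : ℕ} {q : E 3 → ℝ}
    (hq : q ∈ Poly 3 k) : q ∘ P.chart f ∈ Poly 2 k :=
  Poly.comp_affine hq (P.chart f).toAffineMap

/-! ### The `C⁰` spaces -/

/-- The Laplacian and the edge values of a function in the `C⁰` face space. -/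
abbrev C0FaceData (F : Polygon) := polySub 2 1 × (Fin F.n → polySub 2 1)

/-- `v` belongs to the `C⁰` face space, with Laplacian and edge values `D`. -/
def C0FaceRel (F : Polygon) (v : E 2 → ℝ) (D : C0FaceData F) : Prop :=
  MemH1 F.carrier v ∧ ContinuousOn v (closure F.carrier) ∧
  HasLaplacian F.carrier v D.1 ∧
  HasTrace F.faceted v v ∧ (∀ e, EqOn v (D.2 e : E 2 → ℝ) (F.edge e)) ∧
  ∀ q ∈ Poly 2 1,
    ∫ x in F.carrier, gradProj F.faceted v x * q x = ∫ x in F.carrier, v x * q x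

/-- Collects the existentially quantified polynomials into one element of a finite-dimensional
space. It is only a relation: an edge polynomial lives on the plane and is not determined by its
values on the edge. -/
theorem isC0Face_iff {F : Polygon} {v : E 2 → ℝ} : IsC0Face F v ↔ ∃ D, C0FaceRel F v D := by
  constructor
  · rintro ⟨h1, h2, ⟨p, hp, h3⟩, h4, h5, h6⟩
    choose q hq h5 using h5
    exact ⟨(⟨p, mem_polySub.2 hp⟩, fun e => ⟨q e, mem_polySub.2 (hq e)⟩), h1, h2, h3, h4, h5, h6⟩
  · rintro ⟨D, h1, h2, h3, h4, h5, h6⟩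
    exact ⟨h1, h2, ⟨_, mem_polySub.1 D.1.2, h3⟩, h4,
      fun e => ⟨_, mem_polySub.1 (D.2 e).2, h5 e⟩, h6⟩

/-- The moment condition is linear in `v` because the projection is, which is where star-shapedness
enters. -/
theorem C0FaceRel.lincomb {F : Polygon} (Y : StarDomain (d := 1) F.faceted) (c : ℝ)
    {v v' : E 2 → ℝ} {D D' : C0FaceData F} (h : C0FaceRel F v D) (h' : C0FaceRel F v' D') :
    C0FaceRel F (c • v + v') (c • D + D') := by
  obtain ⟨h1, h2, h3, h4, h5, h6⟩ := h
  obtain ⟨h1', h2', h3', h4', h5', h6'⟩ := h'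
  have hfin := Y.isFiniteMeasure_meas
  exact ⟨h1.lincomb c h1', continuousOn_lincomb c h2 h2',
    hasLaplacian_polySub_lincomb F.isOpen F.bounded c _ _ h1.1 h1'.1 h3 h3',
    h4.lincomb F.isOpen c h4', fun e => eqOn_lincomb c (h5 e) (h5' e),
    moments_lincomb F.isOpen F.bounded c h1.1 h1'.1 (Y.gradProj_spec h4).1 (Y.gradProj_spec h4').1
      (Y.gradProj_lincomb c h4 h4') h6 h6'⟩

theorem C0FaceRel.eq_zero {F : Polygon} (Y : StarDomain (d := 1) F.faceted)
    {v : E 2 → ℝ} (h : C0FaceRel F v 0) : v =ᵐ[volume.restrict F.carrier] 0 := by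
  obtain ⟨-, -, h3, h4, h5, -⟩ := h
  exact Y.ae_eq_zero_of_hasLaplacian Y.radius_pos Y.star h4
    (fun e => F.ae_meas_of_eqOn e (h5 e)) h3

theorem isC0Face_poly {F : Polygon} (Y : StarDomain (d := 1) F.faceted) {q : E 2 → ℝ}
    (hq : q ∈ Poly 2 1) : IsC0Face F q := by
  have hc := Poly.contDiff hq
  refine ⟨memH1_of_contDiff F.isOpen F.bounded hc, hc.continuous.continuousOn,
    ⟨_, Poly.mono (by norm_num) (laplacian_mem_poly hq), hasLaplacian_of_contDiff hc⟩,
    Y.hasTrace_poly hq, fun e => ⟨q, hq, fun x _ => rfl⟩, fun p _ => ?_⟩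
  rw [Y.gradProj_poly hq]

/-- The data that determine a function in the `C⁰` element space. -/
abbrev C0PolyData (P : Polyhedron) := polySub 3 1 × (∀ f, C0FaceData (P.face f))

/-- `v` belongs to the `C⁰` element space, with Laplacian and face data `D`. -/
def C0PolyRel (P : Polyhedron) (v : E 3 → ℝ) (D : C0PolyData P) : Prop :=
  MemH1 P.carrier v ∧ HasLaplacian P.carrier v D.1 ∧
  (∃ g : E 3 → ℝ, HasTrace P.faceted v g ∧ ContinuousOn g (frontier P.carrier) ∧
    ∀ f, C0FaceRel (P.face f) (g ∘ P.chart f) (D.2 f)) ∧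
  ∀ q ∈ Poly 3 1,
    ∫ x in P.carrier, gradProj P.faceted v x * q x = ∫ x in P.carrier, v x * q x

theorem isC0Poly_iff {P : Polyhedron} {v : E 3 → ℝ} : IsC0Poly P v ↔ ∃ D, C0PolyRel P v D := by
  constructor
  · rintro ⟨h1, ⟨p, hp, h2⟩, ⟨g, h3, h4, h5⟩, h6⟩
    choose D hD using fun f => isC0Face_iff.1 (h5 f)
    exact ⟨(⟨p, mem_polySub.2 hp⟩, D), h1, h2, ⟨g, h3, h4, hD⟩, h6⟩
  · rintro ⟨D, h1, h2, ⟨g, h3, h4, h5⟩, h6⟩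
    exact ⟨h1, ⟨_, mem_polySub.1 D.1.2, h2⟩, ⟨g, h3, h4, fun f => isC0Face_iff.2 ⟨_, h5 f⟩⟩, h6⟩

theorem C0PolyRel.congr {P : Polyhedron} {v v' : E 3 → ℝ} {D : C0PolyData P}
    (h : C0PolyRel P v D) (hv : v =ᵐ[volume.restrict P.carrier] v') : C0PolyRel P v' D := by
  obtain ⟨h1, h2, ⟨g, h3, h4, h5⟩, h6⟩ := h
  refine ⟨h1.congr hv, h2.congr hv, ⟨g, h3.congr hv, h4, h5⟩, fun q hq => ?_⟩
  rw [← StarDomain.gradProj_congr (D := P.faceted) hv, h6 q hq, integral_mul_congr hv]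

theorem C0PolyRel.lincomb {P : Polyhedron} (X : StarDomain (d := 2) P.faceted)
    (Y : ∀ f, StarDomain (d := 1) (P.face f).faceted) (c : ℝ)
    {v v' : E 3 → ℝ} {D D' : C0PolyData P} (h : C0PolyRel P v D) (h' : C0PolyRel P v' D') :
    C0PolyRel P (c • v + v') (c • D + D') := by
  obtain ⟨h1, h2, ⟨g, h3, h4, h5⟩, h6⟩ := h
  obtain ⟨h1', h2', ⟨g', h3', h4', h5'⟩, h6'⟩ := h'
  have hfin := X.isFiniteMeasure_meas
  exact ⟨h1.lincomb c h1',
    hasLaplacian_polySub_lincomb P.isOpen P.bounded c _ _ h1.1 h1'.1 h2 h2',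
    ⟨c • g + g', h3.lincomb P.isOpen c h3', continuousOn_lincomb c h4 h4',
      fun f => (h5 f).lincomb (Y f) c (h5' f)⟩,
    moments_lincomb P.isOpen P.bounded c h1.1 h1'.1 (X.gradProj_spec h3).1 (X.gradProj_spec h3').1
      (X.gradProj_lincomb c h3 h3') h6 h6'⟩

/-- Uniqueness at two levels: zero edge values and zero face Laplacians make the trace vanish on
every face, and then the Dirichlet problem in `P` applies. -/
theorem C0PolyRel.eq_zero {P : Polyhedron} (X : StarDomain (d := 2) P.faceted)
    (Y : ∀ f, StarDomain (d := 1) (P.face f).faceted)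
    {v : E 3 → ℝ} (h : C0PolyRel P v 0) : v =ᵐ[volume.restrict P.carrier] 0 := by
  obtain ⟨-, h2, ⟨g, h3, -, h5⟩, -⟩ := h
  exact X.ae_eq_zero_of_hasLaplacian X.radius_pos X.star h3
    (fun f => P.ae_meas_eq f ((h5 f).eq_zero (Y f))) h2

theorem isC0Poly_poly {P : Polyhedron} (X : StarDomain (d := 2) P.faceted)
    (Y : ∀ f, StarDomain (d := 1) (P.face f).faceted) {q : E 3 → ℝ}
    (hq : q ∈ Poly 3 1) : IsC0Poly P q := by
  have hc := Poly.contDiff hq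
  refine ⟨memH1_of_contDiff P.isOpen P.bounded hc,
    ⟨_, Poly.mono (by norm_num) (laplacian_mem_poly hq), hasLaplacian_of_contDiff hc⟩,
    ⟨q, X.hasTrace_poly hq, hc.continuous.continuousOn,
      fun f => isC0Face_poly (Y f) (chart_coord_mem_poly P f hq)⟩, fun p _ => ?_⟩
  rw [X.gradProj_poly hq]

/-! ### The `C¹` spaces -/

/-- The data that determine a function in the face space for normal derivatives. -/
abbrev C1GradData (F : Polygon) := polySub 2 0 × (Fin F.n → polySub 2 1)

/-- `ψ` belongs to the face space for normal derivatives, with Laplacian and edge values `D`. -/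
def C1GradRel (F : Polygon) (ψ : E 2 → ℝ) (D : C1GradData F) : Prop :=
  MemH1 F.carrier ψ ∧ HasLaplacian F.carrier ψ D.1 ∧
  (∃ g : E 2 → ℝ, HasTrace F.faceted ψ g ∧ ContinuousOn g (frontier F.carrier) ∧
    ∀ e, EqOn g (D.2 e : E 2 → ℝ) (F.edge e)) ∧
  ∫ x in F.carrier, gradProj F.faceted ψ x = ∫ x in F.carrier, ψ x

theorem isC1FaceGrad_iff {F : Polygon} {ψ : E 2 → ℝ} :
    IsC1FaceGrad F ψ ↔ ∃ D, C1GradRel F ψ D := by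
  constructor
  · rintro ⟨h1, ⟨p, hp, h3⟩, ⟨g, h4, h5, h6⟩, h7⟩
    choose q hq h6 using h6
    exact ⟨(⟨p, mem_polySub.2 hp⟩, fun e => ⟨q e, mem_polySub.2 (hq e)⟩), h1, h3,
      ⟨g, h4, h5, h6⟩, h7⟩
  · rintro ⟨D, h1, h3, ⟨g, h4, h5, h6⟩, h7⟩
    exact ⟨h1, ⟨_, mem_polySub.1 D.1.2, h3⟩, ⟨g, h4, h5,
      fun e => ⟨_, mem_polySub.1 (D.2 e).2, h6 e⟩⟩, h7⟩

theorem C1GradRel.lincomb {F : Polygon} (Y : StarDomain (d := 1) F.faceted) (c : ℝ)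
    {v v' : E 2 → ℝ} {D D' : C1GradData F} (h : C1GradRel F v D) (h' : C1GradRel F v' D') :
    C1GradRel F (c • v + v') (c • D + D') := by
  obtain ⟨h1, h3, ⟨g, h4, h5, h6⟩, h7⟩ := h
  obtain ⟨h1', h3', ⟨g', h4', h5', h6'⟩, h7'⟩ := h'
  have hfin := Y.isFiniteMeasure_meas
  refine ⟨h1.lincomb c h1',
    hasLaplacian_polySub_lincomb F.isOpen F.bounded c _ _ h1.1 h1'.1 h3 h3',
    ⟨c • g + g', h4.lincomb F.isOpen c h4', continuousOn_lincomb c h5 h5',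
      fun e => eqOn_lincomb c (h6 e) (h6' e)⟩, ?_⟩
  have h := integral_lincomb_mul c h1.1 h1'.1
    (polySub_memLp (Poly.const (k := 0) 1) F.isOpen F.bounded)
  have h' := integral_lincomb_mul c (polySub_memLp (Y.gradProj_spec h4).1 F.isOpen F.bounded)
    (polySub_memLp (Y.gradProj_spec h4').1 F.isOpen F.bounded)
    (polySub_memLp (Poly.const (k := 0) 1) F.isOpen F.bounded)
  simp only [mul_one] at h h'
  rw [h, Y.gradProj_lincomb c h4 h4', h', h7, h7']

theorem C1GradRel.eq_zero {F : Polygon} (Y : StarDomain (d := 1) F.faceted)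
    {v : E 2 → ℝ} (h : C1GradRel F v 0) : v =ᵐ[volume.restrict F.carrier] 0 := by
  obtain ⟨-, h3, ⟨g, h4, -, h6⟩, -⟩ := h
  exact Y.ae_eq_zero_of_hasLaplacian Y.radius_pos Y.star h4
    (fun e => F.ae_meas_of_eqOn e (h6 e)) h3

theorem isC1FaceGrad_poly {F : Polygon} (Y : StarDomain (d := 1) F.faceted) {q : E 2 → ℝ}
    (hq : q ∈ Poly 2 1) : IsC1FaceGrad F q := by
  have hc := Poly.contDiff hq
  refine ⟨memH1_of_contDiff F.isOpen F.bounded hc,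
    ⟨_, laplacian_mem_poly hq, hasLaplacian_of_contDiff hc⟩,
    ⟨q, Y.hasTrace_poly hq, hc.continuous.continuousOn, fun e => ⟨q, hq, fun x _ => rfl⟩⟩, ?_⟩
  rw [Y.gradProj_poly hq]

/-- The data that determine a function in the `C¹` face space. -/
abbrev C1HessData (F : Polygon) :=
  polySub 2 1 × (Fin F.n → polySub 2 3) × (Fin F.n → polySub 2 1)

/-- `ψ` belongs to the `C¹` face space, with bilaplacian and edge data `D`. -/
def C1HessRel (F : Polygon) (ψ : E 2 → ℝ) (D : C1HessData F) : Prop :=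
  MemH2 F.carrier ψ ∧ HasBilaplacian F.carrier ψ D.1 ∧
  (∃ g : E 2 → ℝ, HasTrace F.faceted ψ g ∧ ContinuousOn g (frontier F.carrier) ∧
    ∀ e, EqOn g (D.2.1 e : E 2 → ℝ) (F.edge e)) ∧
  (∃ G : Fin 2 → E 2 → ℝ,
    (∀ i, HasTrace F.faceted (weakDeriv F.carrier i ψ) (G i) ∧
      ContinuousOn (G i) (frontier F.carrier)) ∧
    ∀ e, EqOn (fun x => ∑ i, G i x * F.normal e i) (D.2.2 e : E 2 → ℝ) (F.edge e)) ∧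
  ∀ q ∈ Poly 2 1,
    ∫ x in F.carrier, hessProj F.faceted ψ x * q x = ∫ x in F.carrier, ψ x * q x

theorem isC1FaceHess_iff {F : Polygon} {ψ : E 2 → ℝ} :
    IsC1FaceHess F ψ ↔ ∃ D, C1HessRel F ψ D := by
  constructor
  · rintro ⟨h1, ⟨p, hp, h3⟩, ⟨g, h4, h5, h6⟩, ⟨G, h7, h8⟩, h9⟩
    choose q hq h6 using h6
    choose r hr h8 using h8
    exact ⟨(⟨p, mem_polySub.2 hp⟩, fun e => ⟨q e, mem_polySub.2 (hq e)⟩,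
      fun e => ⟨r e, mem_polySub.2 (hr e)⟩), h1, h3, ⟨g, h4, h5, h6⟩, ⟨G, h7, h8⟩, h9⟩
  · rintro ⟨D, h1, h3, ⟨g, h4, h5, h6⟩, ⟨G, h7, h8⟩, h9⟩
    exact ⟨h1, ⟨_, mem_polySub.1 D.1.2, h3⟩,
      ⟨g, h4, h5, fun e => ⟨_, mem_polySub.1 (D.2.1 e).2, h6 e⟩⟩,
      ⟨G, h7, fun e => ⟨_, mem_polySub.1 (D.2.2 e).2, h8 e⟩⟩, h9⟩

theorem sum_lincomb_mul {X ι : Type*} [Fintype ι] (c : ℝ) (G G' : ι → X → ℝ) (a : ι → ℝ) :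
    (fun x => ∑ i, (c • G i + G' i) x * a i) =
      c • (fun x => ∑ i, G i x * a i) + fun x => ∑ i, G' i x * a i := by
  funext x
  simp only [Pi.add_apply, Pi.smul_apply, smul_eq_mul, Finset.mul_sum, ← Finset.sum_add_distrib]
  exact Finset.sum_congr rfl fun i _ => by ring

theorem HasTrace.weakDeriv_lincomb {d : ℕ} {D : Faceted (d + 1)} (X : FlatDomain D)
    {u v g g' : E (d + 1) → ℝ} (c : ℝ) (hu : MemH1 D.carrier u) (hv : MemH1 D.carrier v)
    {i : Fin (d + 1)} (h : HasTrace D (weakDeriv D.carrier i u) g)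
    (h' : HasTrace D (weakDeriv D.carrier i v) g') :
    HasTrace D (weakDeriv D.carrier i (c • u + v)) (c • g + g') :=
  have := X.isFiniteMeasure_meas
  (h.lincomb X.isOpen c h').congr (VEM.weakDeriv_lincomb X.isOpen c hu hv i).symm

theorem C1HessRel.lincomb {F : Polygon} (Y : StarDomain (d := 1) F.faceted) (c : ℝ)
    {v v' : E 2 → ℝ} {D D' : C1HessData F} (h : C1HessRel F v D) (h' : C1HessRel F v' D') :
    C1HessRel F (c • v + v') (c • D + D') := by
  obtain ⟨h1, h3, ⟨g, h4, h5, h6⟩, ⟨G, h7, h8⟩, h9⟩ := h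
  obtain ⟨h1', h3', ⟨g', h4', h5', h6'⟩, ⟨G', h7', h8'⟩, h9'⟩ := h'
  have hfin := Y.isFiniteMeasure_meas
  refine ⟨h1.lincomb F.isOpen c h1',
    hasBilaplacian_polySub_lincomb F.isOpen F.bounded c _ _ h1.1.1 h1'.1.1 h3 h3',
    ⟨c • g + g', h4.lincomb F.isOpen c h4', continuousOn_lincomb c h5 h5',
      fun e => eqOn_lincomb c (h6 e) (h6' e)⟩,
    ⟨fun i => c • G i + G' i, fun i =>
      ⟨HasTrace.weakDeriv_lincomb Y.toFlatDomain c h1.1 h1'.1 (h7 i).1 (h7' i).1,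
        continuousOn_lincomb c (h7 i).2 (h7' i).2⟩, fun e => ?_⟩,
    moments_lincomb F.isOpen F.bounded c h1.1.1 h1'.1.1 (Y.hessProj_spec h1 h4).1
      (Y.hessProj_spec h1' h4').1 (Y.hessProj_lincomb c h1 h1' h4 h4') h9 h9'⟩
  rw [sum_lincomb_mul]
  exact eqOn_lincomb c (h8 e) (h8' e)

theorem C1HessRel.eq_zero {F : Polygon} (Y : StarDomain (d := 1) F.faceted)
    {v : E 2 → ℝ} (h : C1HessRel F v 0) : v =ᵐ[volume.restrict F.carrier] 0 := by
  obtain ⟨h1, h3, ⟨g, h4, -, h6⟩, ⟨G, h7, h8⟩, -⟩ := h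
  exact Y.ae_eq_zero_of_hasBilaplacian Y.radius_pos Y.star h1 h4
    (fun e => F.ae_meas_of_eqOn e (h6 e)) (fun i => (h7 i).1)
    (fun e => F.ae_meas_of_eqOn e (h8 e)) h3

theorem hasTrace_weakDeriv_poly {d k : ℕ} {D : Faceted (d + 1)} (X : StarDomain D)
    {q : E (d + 1) → ℝ} (hq : q ∈ Poly (d + 1) k) (i : Fin (d + 1)) :
    HasTrace D (weakDeriv D.carrier i q) (pderiv i q) :=
  (X.hasTrace_poly (Poly.pderiv hq i)).congr
    (weakDeriv_of_contDiff X.isOpen X.bounded (Poly.contDiff hq) i).symm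

theorem normalDeriv_mem_poly {d k : ℕ} {q : E d → ℝ} (hq : q ∈ Poly d k) (n : E d) :
    (fun x => ∑ i, pderiv i q x * n i) ∈ Poly d (k - 1) :=
  Poly.sum _ fun i _ => by
    have := Poly.smul (n i) (Poly.pderiv hq i)
    convert this using 1
    funext x
    exact mul_comm _ _

theorem laplacian_laplacian_mem_poly {d : ℕ} {q : E d → ℝ} (hq : q ∈ Poly d 2) (k : ℕ) :
    Laplacian.laplacian (Laplacian.laplacian q) ∈ Poly d k :=
  Poly.mono (by omega) (laplacian_mem_poly (laplacian_mem_poly hq))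

theorem isC1FaceHess_poly {F : Polygon} (Y : StarDomain (d := 1) F.faceted) {q : E 2 → ℝ}
    (hq : q ∈ Poly 2 2) : IsC1FaceHess F q := by
  have hc := Poly.contDiff hq
  refine ⟨memH2_of_contDiff F.isOpen F.bounded hc,
    ⟨_, laplacian_laplacian_mem_poly hq 1, hasBilaplacian_of_contDiff hc⟩,
    ⟨q, Y.hasTrace_poly hq, hc.continuous.continuousOn,
      fun e => ⟨q, Poly.mono (by norm_num) hq, fun x _ => rfl⟩⟩,
    ⟨fun i => pderiv i q, fun i => ⟨hasTrace_weakDeriv_poly Y hq i,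
      (contDiff_pderiv hc i).continuous.continuousOn⟩,
      fun e => ⟨_, normalDeriv_mem_poly hq (F.normal e), fun x _ => rfl⟩⟩, fun p _ => ?_⟩
  rw [Y.hessProj_poly hq]

/-- The data that determine a function in the `C¹` element space. -/
abbrev C1PolyData (P : Polyhedron) :=
  polySub 3 2 × (∀ f, C1HessData (P.face f) × C1GradData (P.face f))

/-- `ψ` belongs to the `C¹` element space, with bilaplacian and face data `D`. -/
def C1PolyRel (P : Polyhedron) (ψ : E 3 → ℝ) (D : C1PolyData P) : Prop :=
  MemH2 P.carrier ψ ∧ HasBilaplacian P.carrier ψ D.1 ∧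
  (∃ (g : E 3 → ℝ) (G : Fin 3 → E 3 → ℝ),
    HasTrace P.faceted ψ g ∧
    (∀ i, HasTrace P.faceted (weakDeriv P.carrier i ψ) (G i)) ∧
    (∃ s : E 3 → ℝ, ContinuousOn s P.skeleton ∧
      ∀ f, HasTrace (P.face f).faceted (g ∘ P.chart f) (s ∘ P.chart f)) ∧
    (∃ S : Fin 3 → E 3 → ℝ, ∀ i, ContinuousOn (S i) P.skeleton ∧
      ∀ f, HasTrace (P.face f).faceted (G i ∘ P.chart f) (S i ∘ P.chart f)) ∧
    ∀ f, C1HessRel (P.face f) (g ∘ P.chart f) (D.2 f).1 ∧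
      C1GradRel (P.face f) (fun y => ∑ i, G i (P.chart f y) * P.normal f i) (D.2 f).2) ∧
  ∀ q ∈ Poly 3 2,
    ∫ x in P.carrier, hessProj P.faceted ψ x * q x = ∫ x in P.carrier, ψ x * q x

theorem isC1Poly_iff {P : Polyhedron} {ψ : E 3 → ℝ} : IsC1Poly P ψ ↔ ∃ D, C1PolyRel P ψ D := by
  constructor
  · rintro ⟨h1, ⟨p, hp, h2⟩, ⟨g, G, h3, h4, h5, h6, h7⟩, h8⟩
    choose D hD using fun f => isC1FaceHess_iff.1 (h7 f).1
    choose D' hD' using fun f => isC1FaceGrad_iff.1 (h7 f).2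
    exact ⟨(⟨p, mem_polySub.2 hp⟩, fun f => (D f, D' f)), h1, h2,
      ⟨g, G, h3, h4, h5, h6, fun f => ⟨hD f, hD' f⟩⟩, h8⟩
  · rintro ⟨D, h1, h2, ⟨g, G, h3, h4, h5, h6, h7⟩, h8⟩
    exact ⟨h1, ⟨_, mem_polySub.1 D.1.2, h2⟩, ⟨g, G, h3, h4, h5, h6,
      fun f => ⟨isC1FaceHess_iff.2 ⟨_, (h7 f).1⟩, isC1FaceGrad_iff.2 ⟨_, (h7 f).2⟩⟩⟩, h8⟩

theorem C1PolyRel.congr {P : Polyhedron} {v v' : E 3 → ℝ} {D : C1PolyData P}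
    (h : C1PolyRel P v D) (hv : v =ᵐ[volume.restrict P.carrier] v') : C1PolyRel P v' D := by
  obtain ⟨h1, h2, ⟨g, G, h3, h4, h5⟩, h6⟩ := h
  refine ⟨h1.congr hv, h2.congr hv, ⟨g, G, h3.congr hv, fun i => ?_, h5⟩, fun q hq => ?_⟩
  · rw [← weakDeriv_congr hv]; exact h4 i
  · rw [← StarDomain.hessProj_congr (D := P.faceted) hv, h6 q hq, integral_mul_congr hv]

theorem C1PolyRel.lincomb {P : Polyhedron} (X : StarDomain (d := 2) P.faceted)
    (Y : ∀ f, StarDomain (d := 1) (P.face f).faceted) (c : ℝ)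
    {v v' : E 3 → ℝ} {D D' : C1PolyData P} (h : C1PolyRel P v D) (h' : C1PolyRel P v' D') :
    C1PolyRel P (c • v + v') (c • D + D') := by
  obtain ⟨h1, h2, ⟨g, G, h3, h4, ⟨s, h5, h6⟩, ⟨S, h7⟩, h8⟩, h9⟩ := h
  obtain ⟨h1', h2', ⟨g', G', h3', h4', ⟨s', h5', h6'⟩, ⟨S', h7'⟩, h8'⟩, h9'⟩ := h'
  have hfin := X.isFiniteMeasure_meas
  have hfin' := fun f => (Y f).isFiniteMeasure_meas
  refine ⟨h1.lincomb P.isOpen c h1',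
    hasBilaplacian_polySub_lincomb P.isOpen P.bounded c _ _ h1.1.1 h1'.1.1 h2 h2',
    ⟨c • g + g', fun i => c • G i + G' i, h3.lincomb P.isOpen c h3',
      fun i => HasTrace.weakDeriv_lincomb X.toFlatDomain c h1.1 h1'.1 (h4 i) (h4' i),
      ⟨c • s + s', continuousOn_lincomb c h5 h5',
        fun f => (h6 f).lincomb (P.face f).isOpen c (h6' f)⟩,
      ⟨fun i => c • S i + S' i, fun i => ⟨continuousOn_lincomb c (h7 i).1 (h7' i).1,
        fun f => ((h7 i).2 f).lincomb (P.face f).isOpen c ((h7' i).2 f)⟩⟩,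
      fun f => ⟨(h8 f).1.lincomb (Y f) c (h8' f).1, ?_⟩⟩,
    moments_lincomb P.isOpen P.bounded c h1.1.1 h1'.1.1 (X.hessProj_spec h1 h3).1
      (X.hessProj_spec h1' h3').1 (X.hessProj_lincomb c h1 h1' h3 h3') h9 h9'⟩
  have e : (fun y => ∑ i, (c • G i + G' i) (P.chart f y) * P.normal f i) =
      c • (fun y => ∑ i, G i (P.chart f y) * P.normal f i) +
        fun y => ∑ i, G' i (P.chart f y) * P.normal f i :=
    sum_lincomb_mul c (fun i => G i ∘ P.chart f) (fun i => G' i ∘ P.chart f) _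
  rw [e]
  exact (h8 f).2.lincomb (Y f) c (h8' f).2

/-- On each face the trace solves a clamped plate problem and the normal derivative a Dirichlet
problem, both with zero data; their vanishing gives the clamped plate problem in `P`. -/
theorem C1PolyRel.eq_zero {P : Polyhedron} (X : StarDomain (d := 2) P.faceted)
    (Y : ∀ f, StarDomain (d := 1) (P.face f).faceted)
    {v : E 3 → ℝ} (h : C1PolyRel P v 0) : v =ᵐ[volume.restrict P.carrier] 0 := by
  obtain ⟨h1, h2, ⟨g, G, h3, h4, -, -, h8⟩, -⟩ := h
  exact X.ae_eq_zero_of_hasBilaplacian X.radius_pos X.star h1 h3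
    (fun f => P.ae_meas_eq f ((h8 f).1.eq_zero (Y f))) h4
    (fun f => P.ae_meas_eq f ((h8 f).2.eq_zero (Y f))) h2

/-- A quadratic polynomial has zero bilaplacian and affine normal derivatives on the flat faces, and
the moment conditions hold because the projections reproduce polynomials. -/
theorem isC1Poly_poly {P : Polyhedron} (X : StarDomain (d := 2) P.faceted)
    (Y : ∀ f, StarDomain (d := 1) (P.face f).faceted) {q : E 3 → ℝ}
    (hq : q ∈ Poly 3 2) : IsC1Poly P q := by
  have hc := Poly.contDiff hq
  refine ⟨memH2_of_contDiff P.isOpen P.bounded hc,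
    ⟨_, laplacian_laplacian_mem_poly hq 2, hasBilaplacian_of_contDiff hc⟩,
    ⟨q, fun i => pderiv i q, X.hasTrace_poly hq, hasTrace_weakDeriv_poly X hq,
      ⟨q, hc.continuous.continuousOn,
        fun f => (Y f).hasTrace_poly (chart_coord_mem_poly P f hq)⟩,
      ⟨fun i => pderiv i q, fun i => ⟨(contDiff_pderiv hc i).continuous.continuousOn,
        fun f => (Y f).hasTrace_poly (chart_coord_mem_poly P f (Poly.pderiv hq i))⟩⟩,
      fun f => ⟨isC1FaceHess_poly (Y f) (chart_coord_mem_poly P f hq),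
        isC1FaceGrad_poly (Y f)
          (chart_coord_mem_poly P f (normalDeriv_mem_poly hq (P.normal f)))⟩⟩, fun p _ => ?_⟩
  rw [X.hessProj_poly hq]

/-! ## Linear algebra -/

section LinearAlgebra

variable {H : Type*} [AddCommGroup H] [Module ℝ H]

theorem IsBilinOn.of_lincomb {S : Submodule ℝ H} {b : H → H → ℝ}
    (hl : ∀ c : ℝ, ∀ u ∈ S, ∀ v ∈ S, ∀ w ∈ S, b (c • u + v) w = c * b u w + b v w)
    (hr : ∀ c : ℝ, ∀ u ∈ S, ∀ v ∈ S, ∀ w ∈ S, b w (c • u + v) = c * b w u + b w v) :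
    IsBilinOn (S : Set H) b := by
  have h0l : ∀ w ∈ S, b 0 w = 0 := fun w hw => by
    simpa using hl 1 0 S.zero_mem 0 S.zero_mem w hw
  have h0r : ∀ w ∈ S, b w 0 = 0 := fun w hw => by
    simpa using hr 1 0 S.zero_mem 0 S.zero_mem w hw
  refine ⟨fun u hu v hv w hw => ?_, fun c u hu w hw => ?_, fun w hw u hu v hv => ?_,
    fun c w hw u hu => ?_⟩
  · simpa using hl 1 u hu v hv w hw
  · simpa [h0l w hw] using hl c u hu 0 S.zero_mem w hw
  · simpa using hr 1 u hu v hv w hw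
  · simpa [h0r w hw] using hr c u hu 0 S.zero_mem w hw

theorem IsBilinOn.lincomb_left {S : Submodule ℝ H} {b : H → H → ℝ} (h : IsBilinOn (S : Set H) b)
    (c : ℝ) {u v w : H} (hu : u ∈ S) (hv : v ∈ S) (hw : w ∈ S) :
    b (c • u + v) w = c * b u w + b v w := by
  rw [h.add_left _ (S.smul_mem c hu) _ hv _ hw, h.smul_left c _ hu _ hw]

theorem IsBilinOn.lincomb_right {S : Submodule ℝ H} {b : H → H → ℝ} (h : IsBilinOn (S : Set H) b)
    (c : ℝ) {u v w : H} (hu : u ∈ S) (hv : v ∈ S) (hw : w ∈ S) :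
    b w (c • u + v) = c * b w u + b w v := by
  rw [h.add_right _ hw _ (S.smul_mem c hu) _ hv, h.smul_right c _ hw _ hu]

/-- A set that is closed under linear combinations, as a subspace. -/
def submoduleOfLincomb (S : Set H) (h0 : (0 : H) ∈ S)
    (h : ∀ (c : ℝ) {u v}, u ∈ S → v ∈ S → c • u + v ∈ S) : Submodule ℝ H where
  carrier := S
  zero_mem' := h0
  add_mem' hu hv := by simpa using h 1 hu hv
  smul_mem' c u hu := by simpa using h c hu h0

/-- `l` is linear on the subspace `S`. -/
def IsLinOn (S : Submodule ℝ H) (l : H → ℝ) : Prop :=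
  ∀ c : ℝ, ∀ u ∈ S, ∀ v ∈ S, l (c • u + v) = c * l u + l v

theorem IsLinOn.map_zero {S : Submodule ℝ H} {l : H → ℝ} (h : IsLinOn S l) : l 0 = 0 := by
  simpa using h 1 0 S.zero_mem 0 S.zero_mem

theorem IsLinOn.neg {S : Submodule ℝ H} {l : H → ℝ} (h : IsLinOn S l) :
    IsLinOn S fun v => -l v := fun c u hu v hv => by
  simp only [h c u hu v hv]; ring

/-- The linear map on `S` given by a function that is linear on `S`. -/
def IsLinOn.toLin {S : Submodule ℝ H} {l : H → ℝ} (h : IsLinOn S l) : S →ₗ[ℝ] ℝ where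
  toFun v := l v
  map_add' u v := by simpa using h 1 u u.2 v v.2
  map_smul' c u := by simpa [h.map_zero] using h c u u.2 0 S.zero_mem

theorem IsBilinOn.isLinOn {S : Submodule ℝ H} {b : H → H → ℝ} (h : IsBilinOn (S : Set H) b)
    {w : H} (hw : w ∈ S) : IsLinOn S (b w) := fun c _ hu _ hv => h.lincomb_right c hu hv hw

/-- A definite bilinear form on a finite-dimensional space represents every linear form. -/
theorem existsUnique_of_definite (S : Submodule ℝ H) [Module.Finite ℝ S] {b : H → H → ℝ}
    (hb : IsBilinOn (S : Set H) b) (hdef : ∀ v ∈ S, b v v = 0 → v = 0) {l : H → ℝ}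
    (hl : IsLinOn S l) : ∃! u, u ∈ S ∧ ∀ v ∈ S, b u v = l v := by
  let B : S →ₗ[ℝ] Module.Dual ℝ S :=
    { toFun := fun u => (hb.isLinOn u.2).toLin
      map_add' := fun u v => LinearMap.ext fun w => hb.add_left _ u.2 _ v.2 _ w.2
      map_smul' := fun c u => LinearMap.ext fun w => hb.smul_left c _ u.2 _ w.2 }
  have hB : ∀ u v : S, B u v = b u v := fun u v => rfl
  have hinj : Function.Injective B := by
    rw [injective_iff_map_eq_zero]
    intro v hv
    have := LinearMap.congr_fun hv v
    exact Subtype.ext (hdef v v.2 (by simpa [hB] using this))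
  have hsurj := (LinearMap.injective_iff_surjective_of_finrank_eq_finrank
    (Subspace.dual_finrank_eq (K := ℝ) (V := S)).symm).1 hinj
  obtain ⟨u, hu⟩ := hsurj hl.toLin
  refine ⟨u, ⟨u.2, fun v hv => LinearMap.congr_fun hu ⟨v, hv⟩⟩, fun u' ⟨hu', h'⟩ => ?_⟩
  have : B ⟨u', hu'⟩ = B u := by
    rw [hu]
    exact LinearMap.ext fun v => h' v v.2
  exact congrArg Subtype.val (hinj this)

/-- A space is finite-dimensional if its elements are determined linearly by finitely many data. -/
theorem finite_of_linear_relation (S : Submodule ℝ H) {A : Type*} [AddCommGroup A] [Module ℝ A]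
    [Module.Finite ℝ A] (R : H → A → Prop)
    (hR : ∀ (c : ℝ) {u v a b}, u ∈ S → v ∈ S → R u a → R v b → R (c • u + v) (c • a + b))
    (htot : ∀ v ∈ S, ∃ a, R v a) (hinj : ∀ v ∈ S, R v 0 → v = 0) : Module.Finite ℝ S := by
  have hsub : ∀ {u v a}, u ∈ S → v ∈ S → R u a → R v a → u = v := fun {u v a} hu hv h h' => by
    have := hR (-1) hu hv h h'
    rw [show (-1 : ℝ) • a + a = 0 by module] at this
    have := hinj _ (S.add_mem (S.smul_mem _ hu) hv) this
    rw [neg_one_smul, neg_add_eq_zero] at this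
    exact this
  have h00 : R 0 0 := by
    obtain ⟨a, ha⟩ := htot 0 S.zero_mem
    simpa using hR (-1) S.zero_mem S.zero_mem ha ha
  -- One `v` may have several data, but a datum belongs to at most one `v`. The linear map therefore
  -- goes from the attained data onto `S`.
  let T : Submodule ℝ A :=
    { carrier := {a | ∃ v ∈ S, R v a}
      zero_mem' := ⟨0, S.zero_mem, h00⟩
      add_mem' := by
        rintro a b ⟨u, hu, h⟩ ⟨v, hv, h'⟩
        exact ⟨1 • u + v, S.add_mem (by simpa using hu) hv, by simpa using hR 1 hu hv h h'⟩
      smul_mem' := by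
        rintro c a ⟨u, hu, h⟩
        exact ⟨c • u, S.smul_mem c hu, by simpa using hR c hu S.zero_mem h h00⟩ }
  choose φ hφS hφ using fun a : T => a.2
  let Φ : T →ₗ[ℝ] S :=
    { toFun := fun a => ⟨φ a, hφS a⟩
      map_add' := fun a b => Subtype.ext <|
        hsub (hφS _) (S.add_mem (hφS a) (hφS b)) (hφ (a + b))
          (by simpa using hR 1 (hφS a) (hφS b) (hφ a) (hφ b))
      map_smul' := fun c a => Subtype.ext <|
        hsub (hφS _) (S.smul_mem c (hφS a)) (hφ (c • a))
          (by simpa using hR c (hφS a) S.zero_mem (hφ a) h00) }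
  refine Module.Finite.of_surjective Φ fun v => ?_
  obtain ⟨a, ha⟩ := htot v v.2
  exact ⟨⟨a, v, v.2, ha⟩, Subtype.ext (hsub (hφS _) v.2 (hφ _) ha)⟩

end LinearAlgebra

/-! ## Square integrable functions -/

section L2

variable {d : ℕ} {U V : Set (E d)} {u v : E d → ℝ}

theorem coeFn_toL2 (h : MemLp u 2 (volume.restrict U)) : toL2 U u =ᵐ[volume.restrict U] u := by
  rw [toL2, dif_pos h]
  exact h.coeFn_toLp

theorem coeFn_lincomb (c : ℝ) (u v : L2 U) :
    ⇑(c • u + v) =ᵐ[volume.restrict U] c • ⇑u + ⇑v :=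
  (Lp.coeFn_add _ _).trans ((Lp.coeFn_smul c u).add (Filter.EventuallyEq.refl _ _))

theorem toL2_lincomb (c : ℝ) (hu : MemLp u 2 (volume.restrict U))
    (hv : MemLp v 2 (volume.restrict U)) : toL2 U (c • u + v) = c • toL2 U u + toL2 U v := by
  refine Lp.ext ((coeFn_toL2 (memLp_lincomb c hu hv)).trans
    (Filter.EventuallyEq.trans ?_ (coeFn_lincomb c _ _).symm))
  exact (((coeFn_toL2 hu).const_smul c).add (coeFn_toL2 hv)).symm

theorem toL2_congr (hu : MemLp u 2 (volume.restrict U)) (h : u =ᵐ[volume.restrict U] v) :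
    toL2 U u = toL2 U v :=
  Lp.ext ((coeFn_toL2 hu).trans (h.trans (coeFn_toL2 (hu.ae_eq h)).symm))

theorem memLp_mono (hVU : V ⊆ U) (v : L2 U) : MemLp v 2 (volume.restrict V) :=
  (Lp.memLp v).mono_measure (Measure.restrict_mono hVU le_rfl)

theorem coeFn_toL2_restrict (hVU : V ⊆ U) (v : L2 U) : toL2 V v =ᵐ[volume.restrict V] v :=
  coeFn_toL2 (memLp_mono hVU v)

theorem toL2_restrict_lincomb (hVU : V ⊆ U) (c : ℝ) (u v : L2 U) :
    toL2 V ⇑(c • u + v) = c • toL2 V u + toL2 V v := by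
  rw [← toL2_lincomb c (memLp_mono hVU u) (memLp_mono hVU v)]
  exact toL2_congr (memLp_mono hVU _)
    (ae_mono (Measure.restrict_mono hVU le_rfl) (coeFn_lincomb c u v))

theorem l2_sub_eq (u v : L2 U) : u - v = (-1 : ℝ) • v + u := by module

/-! ### Projection onto polynomials -/

theorem exists_isL2Proj (hU : IsOpen U) (hne : U.Nonempty) (hb : Bornology.IsBounded U) (k : ℕ)
    (hv : MemLp v 2 (volume.restrict U)) : ∃ q, IsL2Proj U k v q := by
  have hL : ∀ q : polySub d k, MemLp q 2 (volume.restrict U) := fun q =>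
    polySub_memLp (mem_polySub.1 q.2) hU hb
  have hlin : ∀ {u : E d → ℝ}, MemLp u 2 (volume.restrict U) → ∀ (c : ℝ) (p q : polySub d k),
      ∫ x in U, u x * (c • p + q : polySub d k).1 x =
        c * (∫ x in U, u x * p.1 x) + ∫ x in U, u x * q.1 x := fun {u} hu c p q => by
    simp only [mul_comm (u _)]
    exact integral_lincomb_mul c (hL p) (hL q) hu
  let l : ∀ {u : E d → ℝ}, MemLp u 2 (volume.restrict U) → Module.Dual ℝ (polySub d k) :=
    fun {u} hu =>
      { toFun := fun q => ∫ x in U, u x * q.1 x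
        map_add' := fun p q => by simpa using hlin hu 1 p q
        map_smul' := fun c p => by simpa using hlin hu c p 0 }
  let b : polySub d k →ₗ[ℝ] Module.Dual ℝ (polySub d k) :=
    { toFun := fun p => l (hL p)
      map_add' := fun p q => LinearMap.ext fun r => by
        have := integral_lincomb_mul 1 (hL p) (hL q) (hL r)
        rw [one_smul, one_mul] at this
        exact this
      map_smul' := fun c p => LinearMap.ext fun r => by
        have := integral_lincomb_mul c (hL p) (hL 0) (hL r)
        simp only [ZeroMemClass.coe_zero, Pi.zero_apply, zero_mul, integral_zero, add_zero] at this
        exact this }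
  -- The degenerate case with zero energy form, in which all polynomials serve as moment tests.
  obtain ⟨q, -, hq⟩ := exists_projection ⊤ 0 b (by simp)
    (fun p _ h => Subtype.ext <| Poly.eq_of_ae_eq (mem_polySub.1 p.2) (Poly.zero (k := k)) hU hne
      (ae_eq_zero_of_integral_sq (hL p) (h p trivial))) 0 (l hv) (by simp)
  exact ⟨q, mem_polySub.1 q.2, fun p hp => hq ⟨p, mem_polySub.2 hp⟩ trivial⟩

theorem l2Proj_spec (hU : IsOpen U) (hne : U.Nonempty) (hb : Bornology.IsBounded U) (k : ℕ)
    (hv : MemLp v 2 (volume.restrict U)) : IsL2Proj U k v (l2Proj U k v) := by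
  have h := exists_isL2Proj hU hne hb k hv
  rw [l2Proj, dif_pos h]
  exact h.choose_spec

theorem integral_mul_l2Proj_lincomb (hU : IsOpen U) (hne : U.Nonempty)
    (hb : Bornology.IsBounded U) (k : ℕ) (c : ℝ) (u v : L2 U) {w : E d → ℝ}
    (hw : MemLp w 2 (volume.restrict U)) :
    ∫ x in U, w x * l2Proj U k ⇑(c • u + v) x =
      c * (∫ x in U, w x * l2Proj U k u x) + ∫ x in U, w x * l2Proj U k v x := by
  have s := fun v : L2 U => l2Proj_spec hU hne hb k (Lp.memLp v)
  have hm : ∀ v : L2 U, MemLp (l2Proj U k v) 2 (volume.restrict U) := fun v =>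
    polySub_memLp (s v).1 hU hb
  have key : l2Proj U k ⇑(c • u + v) = c • l2Proj U k u + l2Proj U k v := by
    have hP : c • l2Proj U k u + l2Proj U k v ∈ Poly d k :=
      Poly.add (Poly.smul c (s u).1) (s v).1
    -- The difference of the two candidates is orthogonal to `ℙₖ`, hence to itself.
    have hD := Poly.add (Poly.smul (-1) hP) (s (c • u + v)).1
    have h0 := Poly.eq_of_ae_eq hD (Poly.zero (k := k)) hU hne
      (ae_eq_zero_of_integral_sq (polySub_memLp hD hU hb) ?_)
    · rw [neg_one_smul, neg_add_eq_zero] at h0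
      exact h0.symm
    · rw [integral_lincomb_mul (-1) (polySub_memLp hP hU hb) (hm _) (polySub_memLp hD hU hb),
        integral_lincomb_mul c (hm u) (hm v) (polySub_memLp hD hU hb), (s u).2 _ hD, (s v).2 _ hD,
        (s (c • u + v)).2 _ hD, integral_mul_congr (coeFn_lincomb c u v),
        integral_lincomb_mul c (Lp.memLp u) (Lp.memLp v) (polySub_memLp hD hU hb)]
      ring
  rw [key]
  simpa only [mul_comm (w _)] using integral_lincomb_mul c (hm u) (hm v) hw

end L2

theorem locMass_lincomb (P : Polyhedron) (c : ℝ) (σ u v : L2 P.carrier) :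
    locMass P σ (c • u + v) = c * locMass P σ u + locMass P σ v :=
  integral_mul_l2Proj_lincomb P.isOpen P.nonempty P.bounded 2 c u v
    (polySub_memLp (l2Proj_spec P.isOpen P.nonempty P.bounded 1 (Lp.memLp σ)).1 P.isOpen P.bounded)

theorem locLoad_lincomb (P : Polyhedron) (c : ℝ) (f u v : L2 P.carrier) :
    locLoad P f (c • u + v) = c * locLoad P f u + locLoad P f v := by
  have hf := polySub_memLp (l2Proj_spec P.isOpen P.nonempty P.bounded 1 (Lp.memLp f)).1
    P.isOpen P.bounded
  have := integral_lincomb_mul c (Lp.memLp u) (Lp.memLp v) hf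
  rw [← integral_mul_congr (coeFn_lincomb c u v)] at this
  simp only [locLoad, mul_comm (l2Proj P.carrier 1 f _), this]
  ring

/-! ## The local spaces and forms -/

section Local

variable {P : Polyhedron} {S : Submodule ℝ (L2 P.carrier)} {k : ℕ} {M : (E 3 → ℝ) → Prop}
  {a : (E 3 → ℝ) → (E 3 → ℝ) → ℝ} {π : (E 3 → ℝ) → E 3 → ℝ}
  {s : L2 P.carrier → L2 P.carrier → ℝ}

/-- A linear projection `π` of the local space `S` onto the polynomials of degree `k`, together
with a semidefinite energy form. -/
structure IsProjected (P : Polyhedron) (S : Submodule ℝ (L2 P.carrier)) (k : ℕ)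
    (M : (E 3 → ℝ) → Prop) (a : (E 3 → ℝ) → (E 3 → ℝ) → ℝ) (π : (E 3 → ℝ) → E 3 → ℝ) :
    Prop where
  form : IsEnergyForm P.carrier k M a
  nonneg : ∀ v, 0 ≤ a v v
  mem_proj : ∀ v ∈ S, π v ∈ Poly 3 k
  proj_lincomb : ∀ c : ℝ, ∀ u ∈ S, ∀ v ∈ S, π ⇑(c • u + v) = c • π u + π v
  mem_poly : ∀ q ∈ Poly 3 k, toL2 P.carrier q ∈ S
  proj_poly : ∀ q ∈ Poly 3 k, π (toL2 P.carrier q) = q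

/-- The local form built from the energy form `a`, the projection `π` and the stabilisation `s`. -/
def locForm (P : Polyhedron) (a : (E 3 → ℝ) → (E 3 → ℝ) → ℝ) (π : (E 3 → ℝ) → E 3 → ℝ)
    (s : L2 P.carrier → L2 P.carrier → ℝ) (u v : L2 P.carrier) : ℝ :=
  a (π u) (π v) + s (u - toL2 P.carrier (π u)) (v - toL2 P.carrier (π v))

namespace IsProjected

variable (h : IsProjected P S k M a π)
include h

theorem sub_proj_mem {v : L2 P.carrier} (hv : v ∈ S) : v - toL2 P.carrier (π v) ∈ S :=
  S.sub_mem hv (h.mem_poly _ (h.mem_proj v hv))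

/-- Places `v - πv` in the kernel of the projection, the only place where the stabilisation is
controlled. -/
theorem proj_sub_proj {v : L2 P.carrier} (hv : v ∈ S) :
    π ⇑(v - toL2 P.carrier (π v)) = 0 := by
  rw [l2_sub_eq, h.proj_lincomb _ _ (h.mem_poly _ (h.mem_proj v hv)) _ hv,
    h.proj_poly _ (h.mem_proj v hv), neg_one_smul, neg_add_cancel]

theorem sub_proj_lincomb (c : ℝ) {u v : L2 P.carrier} (hu : u ∈ S) (hv : v ∈ S) :
    c • u + v - toL2 P.carrier (π ⇑(c • u + v)) =
      c • (u - toL2 P.carrier (π u)) + (v - toL2 P.carrier (π v)) := by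
  rw [h.proj_lincomb c u hu v hv, toL2_lincomb c
    (polySub_memLp (h.mem_proj u hu) P.isOpen P.bounded)
    (polySub_memLp (h.mem_proj v hv) P.isOpen P.bounded)]
  module

theorem isBilinOn_locForm (hs : IsBilinOn (S : Set (L2 P.carrier)) s) :
    IsBilinOn (S : Set (L2 P.carrier)) (locForm P a π s) := by
  refine .of_lincomb (fun c u hu v hv w hw => ?_) (fun c u hu v hv w hw => ?_) <;>
  have hu' := h.form.mem_poly (h.mem_proj u hu) <;>
  have hv' := h.form.mem_poly (h.mem_proj v hv) <;>
  have hw' := h.form.mem_poly (h.mem_proj w hw)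
  · simp only [locForm]
    rw [h.sub_proj_lincomb c hu hv, h.proj_lincomb c u hu v hv, h.form.lincomb c hu' hv' hw',
      hs.lincomb_left c (h.sub_proj_mem hu) (h.sub_proj_mem hv) (h.sub_proj_mem hw)]
    ring
  · simp only [locForm]
    rw [h.sub_proj_lincomb c hu hv, h.proj_lincomb c u hu v hv, h.form.comm,
      h.form.lincomb c hu' hv' hw', h.form.comm (π u), h.form.comm (π v),
      hs.lincomb_right c (h.sub_proj_mem hu) (h.sub_proj_mem hv) (h.sub_proj_mem hw)]
    ring

variable {β : ℝ} (hβ : 0 < β) (hs : ∀ v ∈ S, π v = 0 → β * a v v ≤ s v v)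
include hβ hs

theorem locForm_nonneg {v : L2 P.carrier} (hv : v ∈ S) : 0 ≤ locForm P a π s v v :=
  add_nonneg (h.nonneg _) ((mul_nonneg hβ.le (h.nonneg _)).trans
    (hs _ (h.sub_proj_mem hv) (h.proj_sub_proj hv)))

theorem energy_eq_zero_of_locForm {v : L2 P.carrier} (hv : v ∈ S) (h0 : locForm P a π s v v = 0) :
    a (π v) (π v) = 0 ∧
      a ⇑(v - toL2 P.carrier (π v)) ⇑(v - toL2 P.carrier (π v)) = 0 := by
  have h1 := h.nonneg (π v)
  have h2 := hs _ (h.sub_proj_mem hv) (h.proj_sub_proj hv)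
  have h3 := h.nonneg ⇑(v - toL2 P.carrier (π v))
  have h4 := mul_nonneg hβ.le h3
  unfold locForm at h0
  refine ⟨by linarith, ?_⟩
  have : β * a ⇑(v - toL2 P.carrier (π v)) ⇑(v - toL2 P.carrier (π v)) = 0 := by linarith
  exact (mul_eq_zero.1 this).resolve_left hβ.ne'

end IsProjected

/-! ### The `C⁰` space -/

section C0

variable (X : StarDomain (d := 2) P.faceted) (Y : ∀ f, StarDomain (d := 1) (P.face f).faceted)

theorem IsC0Poly.congr {u v : E 3 → ℝ} (h : IsC0Poly P u)
    (huv : u =ᵐ[volume.restrict P.carrier] v) : IsC0Poly P v := by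
  obtain ⟨D, hD⟩ := isC0Poly_iff.1 h
  exact isC0Poly_iff.2 ⟨D, hD.congr huv⟩

include X Y in
theorem IsC0Poly.lincomb (c : ℝ) {u v : E 3 → ℝ} (h : IsC0Poly P u) (h' : IsC0Poly P v) :
    IsC0Poly P (c • u + v) := by
  obtain ⟨D, hD⟩ := isC0Poly_iff.1 h
  obtain ⟨D', hD'⟩ := isC0Poly_iff.1 h'
  exact isC0Poly_iff.2 ⟨_, hD.lincomb X Y c hD'⟩

include X Y in
theorem toL2_poly_mem_Vloc {q : E 3 → ℝ} (hq : q ∈ Poly 3 1) : toL2 P.carrier q ∈ Vloc P :=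
  (isC0Poly_poly X Y hq).congr (coeFn_toL2 (polySub_memLp hq P.isOpen P.bounded)).symm

include X Y in
theorem Vloc_zero : (0 : L2 P.carrier) ∈ Vloc P :=
  (isC0Poly_poly X Y Poly.zero).congr (Lp.coeFn_zero _ _ _).symm

include X Y in
theorem Vloc_lincomb (c : ℝ) {u v : L2 P.carrier} (hu : u ∈ Vloc P) (hv : v ∈ Vloc P) :
    c • u + v ∈ Vloc P :=
  (IsC0Poly.lincomb X Y c hu hv).congr (coeFn_lincomb c u v).symm

/-- `V_h(P)` as a subspace. -/
def VlocSub : Submodule ℝ (L2 P.carrier) :=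
  submoduleOfLincomb (Vloc P) (Vloc_zero X Y) (Vloc_lincomb X Y)

theorem isProjected_Vloc : IsProjected P (VlocSub X Y) 1 (MemH1 P.carrier) (gradForm P.carrier)
    (gradProj P.faceted) where
  form := X.energyForm_grad
  nonneg := gradForm_self_nonneg
  mem_proj v hv := by
    obtain ⟨-, -, ⟨g, hg, -⟩, -⟩ := hv
    exact (X.gradProj_spec hg).1
  proj_lincomb c u hu v hv := by
    obtain ⟨-, -, ⟨g, hg, -⟩, -⟩ := hu
    obtain ⟨-, -, ⟨g', hg', -⟩, -⟩ := hv
    rw [StarDomain.gradProj_congr (D := P.faceted) (coeFn_lincomb c u v),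
      X.gradProj_lincomb c hg hg']
  mem_poly q hq := toL2_poly_mem_Vloc X Y hq
  proj_poly q hq := by
    exact (StarDomain.gradProj_congr (D := P.faceted)
      (coeFn_toL2 (polySub_memLp hq P.isOpen P.bounded))).trans (X.gradProj_poly hq)

include X Y in
theorem isBilinOn_locGrad (hs : IsBilinOn (Vloc P) s) : IsBilinOn (Vloc P) (locGrad P s) :=
  (isProjected_Vloc X Y).isBilinOn_locForm hs

section

variable {β₀ β₁ : ℝ} (hβ : 0 < β₀) (hs : IsGradStab P β₀ β₁ s)
include X Y hβ hs

theorem locGrad_nonneg {v : L2 P.carrier} (hv : v ∈ Vloc P) : 0 ≤ locGrad P s v v :=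
  (isProjected_Vloc X Y).locForm_nonneg hβ hs.lower hv

/-- Both `Πv` and `v - Πv` have zero energy, so the gradients of both summands of `v` vanish. -/
theorem weakDeriv_eq_zero_of_locGrad {v : L2 P.carrier} (hv : v ∈ Vloc P)
    (h0 : locGrad P s v v = 0) (i : Fin 3) :
    weakDeriv P.carrier i v =ᵐ[volume.restrict P.carrier] 0 := by
  have A := isProjected_Vloc X Y
  obtain ⟨h1, h2⟩ := A.energy_eq_zero_of_locForm hβ hs.lower hv h0
  have hp := A.mem_proj v hv
  have m1 : MemH1 P.carrier (gradProj P.faceted v) := A.form.mem_poly hp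
  have m2 : MemH1 P.carrier ⇑(v - toL2 P.carrier (gradProj P.faceted v)) :=
    (A.sub_proj_mem hv).1
  have e : ⇑v =ᵐ[volume.restrict P.carrier] (1 : ℝ) • gradProj P.faceted v +
      ⇑(v - toL2 P.carrier (gradProj P.faceted v)) := by
    filter_upwards [coeFn_toL2 (polySub_memLp hp P.isOpen P.bounded),
      Lp.coeFn_sub v (toL2 P.carrier (gradProj P.faceted v))] with x hx hx'
    rw [Pi.add_apply, hx', Pi.sub_apply, hx]
    simp
  rw [weakDeriv_congr e]
  filter_upwards [weakDeriv_lincomb P.isOpen 1 m1 m2 i, weakDeriv_eq_zero_of_gradForm m1 h1 i,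
    weakDeriv_eq_zero_of_gradForm m2 h2 i] with x hx hx1 hx2
  rw [hx, Pi.add_apply, Pi.smul_apply, hx1, hx2]
  simp

end

end C0

/-! ### The `C¹` space -/

section C1

variable (X : StarDomain (d := 2) P.faceted) (Y : ∀ f, StarDomain (d := 1) (P.face f).faceted)

theorem IsC1Poly.congr {u v : E 3 → ℝ} (h : IsC1Poly P u)
    (huv : u =ᵐ[volume.restrict P.carrier] v) : IsC1Poly P v := by
  obtain ⟨D, hD⟩ := isC1Poly_iff.1 h
  exact isC1Poly_iff.2 ⟨D, hD.congr huv⟩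

include X Y in
theorem IsC1Poly.lincomb (c : ℝ) {u v : E 3 → ℝ} (h : IsC1Poly P u) (h' : IsC1Poly P v) :
    IsC1Poly P (c • u + v) := by
  obtain ⟨D, hD⟩ := isC1Poly_iff.1 h
  obtain ⟨D', hD'⟩ := isC1Poly_iff.1 h'
  exact isC1Poly_iff.2 ⟨_, hD.lincomb X Y c hD'⟩

include X Y in
theorem toL2_poly_mem_Psiloc {q : E 3 → ℝ} (hq : q ∈ Poly 3 2) : toL2 P.carrier q ∈ Psiloc P :=
  (isC1Poly_poly X Y hq).congr (coeFn_toL2 (polySub_memLp hq P.isOpen P.bounded)).symm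

include X Y in
theorem Psiloc_zero : (0 : L2 P.carrier) ∈ Psiloc P :=
  (isC1Poly_poly X Y Poly.zero).congr (Lp.coeFn_zero _ _ _).symm

include X Y in
theorem Psiloc_lincomb (c : ℝ) {u v : L2 P.carrier} (hu : u ∈ Psiloc P) (hv : v ∈ Psiloc P) :
    c • u + v ∈ Psiloc P :=
  (IsC1Poly.lincomb X Y c hu hv).congr (coeFn_lincomb c u v).symm

/-- `Ψ_h(P)` as a subspace. -/
def PsilocSub : Submodule ℝ (L2 P.carrier) :=
  submoduleOfLincomb (Psiloc P) (Psiloc_zero X Y) (Psiloc_lincomb X Y)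

theorem isProjected_Psiloc : IsProjected P (PsilocSub X Y) 2 (MemH2 P.carrier)
    (hessForm P.carrier) (hessProj P.faceted) where
  form := X.energyForm_hess
  nonneg := hessForm_self_nonneg
  mem_proj v hv := by
    obtain ⟨h1, -, ⟨g, _, hg, -⟩, -⟩ := hv
    exact (X.hessProj_spec h1 hg).1
  proj_lincomb c u hu v hv := by
    obtain ⟨h1, -, ⟨g, _, hg, -⟩, -⟩ := hu
    obtain ⟨h1', -, ⟨g', _, hg', -⟩, -⟩ := hv
    rw [StarDomain.hessProj_congr (D := P.faceted) (coeFn_lincomb c u v),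
      X.hessProj_lincomb c h1 h1' hg hg']
  mem_poly q hq := toL2_poly_mem_Psiloc X Y hq
  proj_poly q hq := by
    exact (StarDomain.hessProj_congr (D := P.faceted)
      (coeFn_toL2 (polySub_memLp hq P.isOpen P.bounded))).trans (X.hessProj_poly hq)

include X Y in
theorem isBilinOn_locHess (hs : IsBilinOn (Psiloc P) s) : IsBilinOn (Psiloc P) (locHess P s) :=
  (isProjected_Psiloc X Y).isBilinOn_locForm hs

section

variable {α₀ α₁ : ℝ} (hα : 0 < α₀) (hs : IsHessStab P α₀ α₁ s)
include X Y hα hs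

theorem locHess_nonneg {v : L2 P.carrier} (hv : v ∈ Psiloc P) : 0 ≤ locHess P s v v :=
  (isProjected_Psiloc X Y).locForm_nonneg hα hs.lower hv

theorem weakDeriv_eq_zero_of_locHess {v : L2 P.carrier} (hv : v ∈ Psiloc P)
    (h0 : locHess P s v v = 0) (i j : Fin 3) :
    weakDeriv P.carrier j (weakDeriv P.carrier i v) =ᵐ[volume.restrict P.carrier] 0 := by
  have A := isProjected_Psiloc X Y
  obtain ⟨h1, h2⟩ := A.energy_eq_zero_of_locForm hα hs.lower hv h0
  have hp := A.mem_proj v hv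
  have m1 : MemH2 P.carrier (hessProj P.faceted v) := A.form.mem_poly hp
  have m2 : MemH2 P.carrier ⇑(v - toL2 P.carrier (hessProj P.faceted v)) :=
    (A.sub_proj_mem hv).1
  have e : ⇑v =ᵐ[volume.restrict P.carrier] (1 : ℝ) • hessProj P.faceted v +
      ⇑(v - toL2 P.carrier (hessProj P.faceted v)) := by
    filter_upwards [coeFn_toL2 (polySub_memLp hp P.isOpen P.bounded),
      Lp.coeFn_sub v (toL2 P.carrier (hessProj P.faceted v))] with x hx hx'
    rw [Pi.add_apply, hx', Pi.sub_apply, hx]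
    simp
  rw [weakDeriv_congr e]
  filter_upwards [weakDeriv_weakDeriv_lincomb P.isOpen 1 m1 m2 i j,
    weakDeriv_eq_zero_of_hessForm m1 h1 i j,
    weakDeriv_eq_zero_of_hessForm m2 h2 i j] with x hx hx1 hx2
  rw [hx, Pi.add_apply, Pi.smul_apply, hx1, hx2]
  simp

end

end C1

end Local

/-! ## Functions vanishing on the boundary -/

section H10

variable {d : ℕ} {U : Set (E d)} {u v : E d → ℝ}

theorem integral_sq_le_of_ae_le {X : Type*} [MeasurableSpace X] {μ : Measure X} {f g h : X → ℝ}
    {a b : ℝ} (hf : MemLp f 2 μ) (hg : MemLp g 2 μ) (hh : MemLp h 2 μ)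
    (H : ∀ᵐ x ∂μ, f x ^ 2 ≤ a * g x ^ 2 + b * h x ^ 2) :
    ∫ x, f x ^ 2 ∂μ ≤ a * ∫ x, g x ^ 2 ∂μ + b * ∫ x, h x ^ 2 ∂μ := by
  rw [← integral_const_mul, ← integral_const_mul,
    ← integral_add (hg.integrable_sq.const_mul a) (hh.integrable_sq.const_mul b)]
  exact integral_mono_ae hf.integrable_sq
    ((hg.integrable_sq.const_mul a).add (hh.integrable_sq.const_mul b)) H

theorem MemH10.congr (h : MemH10 U u) (huv : u =ᵐ[volume.restrict U] v) : MemH10 U v := by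
  refine ⟨h.1.congr huv, fun ε hε => ?_⟩
  obtain ⟨φ, hφ, H⟩ := h.2 ε hε
  refine ⟨φ, hφ, ?_⟩
  have e : ∫ x in U, (v x - φ x) ^ 2 = ∫ x in U, (u x - φ x) ^ 2 :=
    integral_congr_ae (huv.mono fun x hx => by simp only [hx])
  simpa only [e, ← weakDeriv_congr huv] using H

theorem memH10_zero (hU : IsOpen U) (hb : Bornology.IsBounded U) : MemH10 U (0 : E d → ℝ) := by
  have hc : ContDiff ℝ ∞ (0 : E d → ℝ) := contDiff_const
  refine ⟨memH1_of_contDiff hU hb hc, fun ε hε => ⟨0, IsTest.zero, ?_⟩⟩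
  have h : ∀ i, ∫ x in U, (weakDeriv U i 0 x - pderiv i 0 x) ^ 2 = 0 := fun i =>
    integral_eq_zero_of_ae ((weakDeriv_of_contDiff hU hb hc i).mono fun x hx => by simp [hx])
  simp only [h]
  simpa using hε

theorem integral_sq_lincomb_le {X : Type*} [MeasurableSpace X] {μ : Measure X} {f g h : X → ℝ}
    (c : ℝ) (hf : MemLp f 2 μ) (hg : MemLp g 2 μ) (hh : h =ᵐ[μ] c • f + g) :
    ∫ x, h x ^ 2 ∂μ ≤ 2 * c ^ 2 * ∫ x, f x ^ 2 ∂μ + 2 * ∫ x, g x ^ 2 ∂μ :=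
  integral_sq_le_of_ae_le ((memLp_lincomb c hf hg).ae_eq hh.symm) hf hg (hh.mono fun x hx => by
    rw [hx, Pi.add_apply, Pi.smul_apply, smul_eq_mul]
    nlinarith [sq_nonneg (c * f x - g x)])

theorem MemH10.lincomb (hU : IsOpen U) (c : ℝ) (hu : MemH10 U u) (hv : MemH10 U v) :
    MemH10 U (c • u + v) := by
  refine ⟨hu.1.lincomb c hv.1, fun ε hε => ?_⟩
  -- The tolerance comes from `(c a + b)² ≤ 2 c² a² + 2 b²`.
  have hc : 0 < 2 * c ^ 2 + 2 := by positivity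
  obtain ⟨φ, hφ, h1⟩ := hu.2 _ (div_pos hε hc)
  obtain ⟨ψ, hψ, h2⟩ := hv.2 _ (div_pos hε hc)
  refine ⟨c • φ + ψ, (hφ.smul c).add hψ, ?_⟩
  have e0 : ∫ x in U, ((c • u + v) x - (c • φ + ψ) x) ^ 2 ≤
      2 * c ^ 2 * (∫ x in U, (u x - φ x) ^ 2) + 2 * ∫ x in U, (v x - ψ x) ^ 2 :=
    integral_sq_lincomb_le c (hu.1.1.sub (hφ.memLp _)) (hv.1.1.sub (hψ.memLp _))
      (.of_forall fun x => by simp; ring)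
  have e1 : ∀ i, ∫ x in U, (weakDeriv U i (c • u + v) x - pderiv i (c • φ + ψ) x) ^ 2 ≤
      2 * c ^ 2 * (∫ x in U, (weakDeriv U i u x - pderiv i φ x) ^ 2) +
        2 * ∫ x in U, (weakDeriv U i v x - pderiv i ψ x) ^ 2 := fun i =>
    integral_sq_lincomb_le c ((hu.1.memLp_weakDeriv i).sub ((hφ.pderiv i).memLp _))
      ((hv.1.memLp_weakDeriv i).sub ((hψ.pderiv i).memLp _))
      ((weakDeriv_lincomb hU c hu.1 hv.1 i).mono fun x hx => by
        rw [pderiv_add (hφ.smul c).1 hψ.1, pderiv_smul hφ.1]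
        simp only [hx, Pi.add_apply, Pi.smul_apply, smul_eq_mul]
        ring)
  have e2 := Finset.sum_le_sum fun i (_ : i ∈ Finset.univ) => e1 i
  rw [Finset.sum_add_distrib, ← Finset.mul_sum, ← Finset.mul_sum] at e2
  rw [lt_div_iff₀ hc] at h1 h2
  nlinarith [sq_nonneg c]

/-- Poincaré's inequality. -/
theorem integral_sq_le_integral_pderiv_sq {φ : E d → ℝ} (hφ : IsTest U φ) (i : Fin d) {R : ℝ}
    (hR : ∀ x ∈ U, |x i| ≤ R) :
    ∫ x in U, φ x ^ 2 ≤ 4 * R ^ 2 * ∫ x in U, pderiv i φ x ^ 2 := by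
  have hx : ContDiff ℝ ∞ fun x : E d => x i := Poly.contDiff (Poly.coord i)
  have h1 := hφ.integral_mul_pderiv (hx.mul hφ.1) i
  have hxφ := hφ.mul_left hx
  have hp := hφ.pderiv i
  have e : pderiv i ((fun x : E d => x i) * φ) = φ + (fun x : E d => x i) * pderiv i φ := by
    rw [pderiv_mul hx hφ.1, pderiv_coord]
    funext x; simp
  have i1 : Integrable (fun x => x i * φ x * pderiv i φ x) :=
    integrable_mul (hxφ.memLp volume) (hp.memLp _)
  -- Integration by parts of `xᵢ φ` against `∂ᵢφ`, using `∂ᵢ(xᵢ φ) = φ + xᵢ ∂ᵢφ`.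
  have h2 : ∫ x, φ x ^ 2 = -2 * ∫ x, x i * φ x * pderiv i φ x := by
    have h3 : ∫ x, pderiv i ((fun x : E d => x i) * φ) x * φ x =
        (∫ x, φ x ^ 2) + ∫ x, x i * φ x * pderiv i φ x := by
      rw [e, ← integral_add (hφ.memLp volume).integrable_sq i1]
      exact integral_congr_ae (.of_forall fun x => by simp; ring)
    have h4 : ∫ x, ((fun x : E d => x i) * φ) x * pderiv i φ x =
        - ∫ x, pderiv i ((fun x : E d => x i) * φ) x * φ x := h1
    rw [h3] at h4
    simp only [Pi.mul_apply] at h4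
    linarith
  -- Young's inequality with weights chosen so that half of `∫ φ²` can be absorbed on the left,
  -- which gives the constant `4 R²`.
  have h5 : -2 * ∫ x, x i * φ x * pderiv i φ x ≤
      (1 / 2) * (∫ x, φ x ^ 2) + 2 * R ^ 2 * ∫ x, pderiv i φ x ^ 2 := by
    rw [← integral_const_mul, ← integral_const_mul, ← integral_const_mul, ← integral_add
      ((hφ.memLp volume).integrable_sq.const_mul _) ((hp.memLp volume).integrable_sq.const_mul _)]
    refine integral_mono (i1.const_mul _) (((hφ.memLp volume).integrable_sq.const_mul _).add
      ((hp.memLp volume).integrable_sq.const_mul _)) fun x => ?_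
    by_cases hxU : x ∈ U
    · have := sq_le_sq' (neg_le_of_abs_le (hR x hxU)) (le_of_abs_le (hR x hxU))
      have := mul_le_mul_of_nonneg_right this (sq_nonneg (pderiv i φ x))
      simp only
      nlinarith [sq_nonneg (φ x + 2 * (x i * pderiv i φ x))]
    · simp only [hφ.eq_zero hxU, hp.eq_zero hxU]
      simp
  have r1 : ∫ x in U, φ x ^ 2 = ∫ x, φ x ^ 2 := by
    simpa only [sq] using hφ.setIntegral_mul φ
  have r2 : ∫ x in U, pderiv i φ x ^ 2 = ∫ x, pderiv i φ x ^ 2 := by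
    simpa only [sq] using hp.setIntegral_mul (pderiv i φ)
  rw [r1, r2]
  linarith

/-- Since `∇u = 0`, the approximating test functions have small gradients, are themselves small by
Poincaré's inequality, and so force `u` to be small. -/
theorem ae_eq_zero_of_memH10 [NeZero d] (hb : Bornology.IsBounded U)
    (hu : MemH10 U u) (h : ∀ i, weakDeriv U i u =ᵐ[volume.restrict U] 0) :
    u =ᵐ[volume.restrict U] 0 := by
  obtain ⟨R, hR⟩ := hb.exists_norm_le
  have hR' : ∀ x ∈ U, |x 0| ≤ R := fun x hx => by
    simpa using (PiLp.norm_apply_le x 0).trans (hR x hx)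
  refine ae_eq_zero_of_integral_sq hu.1.1 (le_antisymm (le_of_forall_pos_lt_add fun ε hε => ?_)
    (integral_nonneg fun x => mul_self_nonneg _))
  -- One factor `2` for each half of `u = (u - φ) + φ`, the second multiplied by Poincaré's constant
  -- `4 R²`.
  have hC : 0 < 2 + 2 * (4 * R ^ 2) := by positivity
  obtain ⟨φ, hφ, h1⟩ := hu.2 _ (div_pos hε hC)
  have h2 : ∫ x in U, u x ^ 2 ≤ 2 * (∫ x in U, (u x - φ x) ^ 2) + 2 * ∫ x in U, φ x ^ 2 :=
    integral_sq_le_of_ae_le hu.1.1 (hu.1.1.sub (hφ.memLp _)) (hφ.memLp _)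
      (.of_forall fun x => by
        nlinarith [sq_nonneg (u x - 2 * φ x)])
  have h3 := integral_sq_le_integral_pderiv_sq hφ 0 hR'
  have h4 : ∫ x in U, pderiv 0 φ x ^ 2 ≤
      ∑ i, ∫ x in U, (weakDeriv U i u x - pderiv i φ x) ^ 2 := by
    refine le_trans (le_of_eq ?_) (Finset.single_le_sum
      (fun i _ => integral_nonneg fun x => sq_nonneg _) (Finset.mem_univ 0))
    exact integral_congr_ae ((h 0).mono fun x hx => by simp [hx])
  have h5 : 0 ≤ ∫ x in U, (u x - φ x) ^ 2 := integral_nonneg fun x => sq_nonneg _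
  have h6 : 0 ≤ ∫ x in U, pderiv 0 φ x ^ 2 := integral_nonneg fun x => sq_nonneg _
  rw [lt_div_iff₀ hC] at h1
  simp only [← sq]
  have h7 := mul_le_mul_of_nonneg_left h4 (show 0 ≤ 4 * R ^ 2 by positivity)
  nlinarith [sq_nonneg R, mul_nonneg (sq_nonneg R) h5]

/-- Because `∂ᵢ∂ᵢu = 0`, the function `∂ᵢu` is orthogonal to `∂ᵢφ` for all test functions `φ`. By
Pythagoras its norm is at most that of `∂ᵢu - ∂ᵢφ`, which is arbitrarily small since `u ∈ H¹₀`. -/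
theorem weakDeriv_eq_zero_of_memH10 (hu : MemH2 U u) (h0 : MemH10 U u) (i : Fin d)
    (h : weakDeriv U i (weakDeriv U i u) =ᵐ[volume.restrict U] 0) :
    weakDeriv U i u =ᵐ[volume.restrict U] 0 := by
  refine ae_eq_zero_of_integral_sq (h0.1.memLp_weakDeriv i)
    (le_antisymm (le_of_forall_pos_lt_add fun ε hε => ?_)
    (integral_nonneg fun x => mul_self_nonneg _))
  obtain ⟨φ, hφ, h1⟩ := h0.2 ε hε
  have hw := h0.1.memLp_weakDeriv i
  have hp := (hφ.pderiv i).memLp (p := 2) (volume.restrict U)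
  have h2 : ∫ x in U, weakDeriv U i u x * pderiv i φ x = 0 := by
    rw [((hu.2 i).weak i).2 φ hφ, integral_mul_congr h]
    simp
  have h3 : ∫ x in U, (weakDeriv U i u x - pderiv i φ x) ^ 2 =
      (∫ x in U, weakDeriv U i u x * weakDeriv U i u x) + ∫ x in U, pderiv i φ x ^ 2 := by
    have i1 := (integrable_mul hw hw).add hp.integrable_sq
    have i2 := (integrable_mul hw hp).const_mul (-2)
    have h4 := integral_add i1 i2
    rw [integral_add' (integrable_mul hw hw) hp.integrable_sq, integral_const_mul, h2, mul_zero,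
      add_zero] at h4
    rw [← h4]
    exact integral_congr_ae (.of_forall fun x => by simp only [Pi.add_apply]; ring)
  have h4 : ∫ x in U, (weakDeriv U i u x - pderiv i φ x) ^ 2 ≤
      ∑ i, ∫ x in U, (weakDeriv U i u x - pderiv i φ x) ^ 2 :=
    Finset.single_le_sum (f := fun i => ∫ x in U, (weakDeriv U i u x - pderiv i φ x) ^ 2)
      (fun i _ => integral_nonneg fun x => sq_nonneg _) (Finset.mem_univ i)
  have h5 : 0 ≤ ∫ x in U, (u x - φ x) ^ 2 := integral_nonneg fun x => sq_nonneg _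
  have h6 : 0 ≤ ∫ x in U, pderiv i φ x ^ 2 := integral_nonneg fun x => sq_nonneg _
  linarith

end H10

/-! ## The global spaces and forms -/

namespace Mesh

variable {Ω : Set (E 3)} {M : Mesh Ω} {ρ : ℝ}

theorem ShapeRegular.exists_elt (hM : M.ShapeRegular ρ) (hρ : 0 < ρ) (K : Fin M.n) :
    Nonempty (StarDomain (d := 2) (M.elt K).faceted) :=
  (M.elt K).flatDomain.exists_starDomain hρ (hM.elt_star K)

theorem ShapeRegular.exists_face (hM : M.ShapeRegular ρ) (hρ : 0 < ρ) (K : Fin M.n)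
    (f : Fin (M.elt K).n) : Nonempty (StarDomain (d := 1) ((M.elt K).face f).faceted) :=
  ((M.elt K).face f).flatDomain.exists_starDomain hρ (hM.face_star K f)

/-- The closures of the elements cover `Ω` and their frontiers are null. -/
theorem ae_of_forall_elt (M : Mesh Ω) {p : E 3 → Prop}
    (h : ∀ K, ∀ᵐ x ∂volume.restrict (M.elt K).carrier, p x) : ∀ᵐ x ∂volume.restrict Ω, p x := by
  refine ae_restrict_of_ae_restrict_of_subset (t := ⋃ K, closure (M.elt K).carrier)
    (M.cover ▸ subset_closure) ?_
  rw [ae_restrict_iUnion_iff]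
  intro K
  have h0 : volume (frontier (M.elt K).carrier) = 0 := (M.elt K).flatDomain.volume_frontier
  rw [closure_eq_self_union_frontier, ae_restrict_union_iff, Measure.restrict_eq_zero.2 h0]
  exact ⟨h K, by simp⟩

theorem eq_zero_of_forall_elt (M : Mesh Ω) {v : L2 Ω}
    (h : ∀ K, v =ᵐ[volume.restrict (M.elt K).carrier] 0) : v = 0 :=
  Lp.ext (Filter.EventuallyEq.trans (M.ae_of_forall_elt h) (Lp.coeFn_zero _ _ _).symm)

theorem toL2_elt_lincomb (K : Fin M.n) (c : ℝ) (u v : L2 Ω) :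
    toL2 (M.elt K).carrier ⇑(c • u + v) =
      c • toL2 (M.elt K).carrier u + toL2 (M.elt K).carrier v :=
  toL2_restrict_lincomb (M.subset K) c u v

theorem toL2_elt_zero (K : Fin M.n) : toL2 (M.elt K).carrier ⇑(0 : L2 Ω) = 0 := by
  simpa using toL2_elt_lincomb K (-1) (0 : L2 Ω) 0

theorem coeFn_toL2_elt (K : Fin M.n) (v : L2 Ω) :
    toL2 (M.elt K).carrier v =ᵐ[volume.restrict (M.elt K).carrier] v :=
  coeFn_toL2_restrict (M.subset K) v

theorem coeFn_lincomb_elt (K : Fin M.n) (c : ℝ) (u v : L2 Ω) :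
    ⇑(c • u + v) =ᵐ[volume.restrict (M.elt K).carrier] c • ⇑u + ⇑v :=
  ae_mono (Measure.restrict_mono (M.subset K) le_rfl) (coeFn_lincomb c u v)

theorem eq_zero_of_weakDeriv (hΩb : Bornology.IsBounded Ω) {v : L2 Ω} (hv : MemH10 Ω v)
    (h : ∀ i, weakDeriv Ω i v =ᵐ[volume.restrict Ω] 0) : v = 0 :=
  Lp.ext ((ae_eq_zero_of_memH10 hΩb hv h).trans (Lp.coeFn_zero _ _ _).symm)

theorem isLinOn_aMass (M : Mesh Ω) (S : Submodule ℝ (L2 Ω)) (σ : L2 Ω) :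
    IsLinOn S (M.aMass σ) := fun c u _ v _ => by
  simp only [aMass, toL2_elt_lincomb, locMass_lincomb, Finset.sum_add_distrib, Finset.mul_sum]

theorem isLinOn_load (M : Mesh Ω) (S : Submodule ℝ (L2 Ω)) (f : L2 Ω) :
    IsLinOn S (M.load f) := fun c u _ v _ => by
  simp only [load, toL2_elt_lincomb, locLoad_lincomb, Finset.sum_add_distrib, Finset.mul_sum]

theorem isBilinOn_sum {S : Submodule ℝ (L2 Ω)} {T : ∀ K, Submodule ℝ (L2 (M.elt K).carrier)}
    (hST : ∀ v ∈ S, ∀ K, toL2 (M.elt K).carrier v ∈ T K)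
    {b : ∀ K, L2 (M.elt K).carrier → L2 (M.elt K).carrier → ℝ}
    (hb : ∀ K, IsBilinOn (T K : Set (L2 (M.elt K).carrier)) (b K)) :
    IsBilinOn (S : Set (L2 Ω)) fun u v => ∑ K, b K (toL2 _ u) (toL2 _ v) := by
  refine .of_lincomb (fun c u hu v hv w hw => ?_) (fun c u hu v hv w hw => ?_) <;>
  rw [Finset.mul_sum, ← Finset.sum_add_distrib] <;>
  refine Finset.sum_congr rfl fun K _ => ?_ <;>
  rw [toL2_elt_lincomb]
  · exact (hb K).lincomb_left c (hST u hu K) (hST v hv K) (hST w hw K)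
  · exact (hb K).lincomb_right c (hST u hu K) (hST v hv K) (hST w hw K)

section

variable (hΩo : IsOpen Ω) (hΩb : Bornology.IsBounded Ω)
  (X : ∀ K, StarDomain (d := 2) (M.elt K).faceted)
  (Y : ∀ K f, StarDomain (d := 1) ((M.elt K).face f).faceted)

/-! ### The `C⁰` space -/

/-- `V_h` as a subspace. -/
def VSub : Submodule ℝ (L2 Ω) :=
  submoduleOfLincomb M.V
    ⟨(memH10_zero hΩo hΩb).congr (Lp.coeFn_zero _ _ _).symm, fun K => by
      rw [toL2_elt_zero]
      exact Vloc_zero (X K) (Y K)⟩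
    fun c u v hu hv => ⟨(hu.1.lincomb hΩo c hv.1).congr (coeFn_lincomb c u v).symm, fun K => by
      rw [toL2_elt_lincomb]
      exact Vloc_lincomb (X K) (Y K) c (hu.2 K) (hv.2 K)⟩

theorem finite_VSub : Module.Finite ℝ (VSub hΩo hΩb X Y) := by
  refine finite_of_linear_relation _ (A := ∀ K, C0PolyData (M.elt K))
    (fun v D => ∀ K, C0PolyRel (M.elt K) v (D K)) (fun c u v D D' _ _ h h' K => ?_)
    (fun v hv => ?_) (fun v _ h => ?_)
  · exact ((h K).lincomb (X K) (Y K) c (h' K)).congr (coeFn_lincomb_elt K c u v).symm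
  · choose D hD using fun K => isC0Poly_iff.1 (hv.2 K)
    exact ⟨D, fun K => (hD K).congr (coeFn_toL2_elt K v)⟩
  · exact M.eq_zero_of_forall_elt fun K => (h K).eq_zero (X K) (Y K)

variable {sG : ∀ K, L2 (M.elt K).carrier → L2 (M.elt K).carrier → ℝ}

theorem isBilinOn_aGrad (hs : ∀ K, IsBilinOn (Vloc (M.elt K)) (sG K)) :
    IsBilinOn (VSub hΩo hΩb X Y : Set (L2 Ω)) (M.aGrad sG) :=
  isBilinOn_sum (S := VSub hΩo hΩb X Y) (T := fun K => VlocSub (X K) (Y K)) (fun _ hv K => hv.2 K)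
    fun K => isBilinOn_locGrad (X K) (Y K) (hs K)

include hΩb X Y in
-- All local terms are nonnegative, so each vanishes. The local weak gradients agree with the global
-- one, which is thus zero almost everywhere in `Ω`.
theorem eq_zero_of_aGrad {β₀ β₁ : ℝ} (hβ : 0 < β₀)
    (hs : ∀ K, IsGradStab (M.elt K) β₀ β₁ (sG K)) {v : L2 Ω} (hv : v ∈ M.V)
    (h : M.aGrad sG v v = 0) : v = 0 := by
  refine eq_zero_of_weakDeriv hΩb hv.1 fun i => M.ae_of_forall_elt fun K => ?_
  have hK := (Finset.sum_eq_zero_iff_of_nonneg fun K _ =>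
    locGrad_nonneg (X K) (Y K) hβ (hs K) (hv.2 K)).1 h K (Finset.mem_univ K)
  have h1 := weakDeriv_eq_zero_of_locGrad (X K) (Y K) hβ (hs K) (hv.2 K) hK i
  rw [weakDeriv_congr (coeFn_toL2_elt K v)] at h1
  exact (hv.1.1.weakDeriv_mono (M.elt K).isOpen (M.subset K) i).symm.trans h1

/-! ### The `C¹` space -/

/-- `Ψ_h` as a subspace. -/
def PsiSub : Submodule ℝ (L2 Ω) :=
  submoduleOfLincomb M.Psi
    ⟨(memH2_of_contDiff hΩo hΩb contDiff_const).congr (Lp.coeFn_zero _ _ _).symm,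
      (memH10_zero hΩo hΩb).congr (Lp.coeFn_zero _ _ _).symm, fun K => by
      rw [toL2_elt_zero]
      exact Psiloc_zero (X K) (Y K)⟩
    fun c u v hu hv => ⟨(hu.1.lincomb hΩo c hv.1).congr (coeFn_lincomb c u v).symm,
      (hu.2.1.lincomb hΩo c hv.2.1).congr (coeFn_lincomb c u v).symm, fun K => by
      rw [toL2_elt_lincomb]
      exact Psiloc_lincomb (X K) (Y K) c (hu.2.2 K) (hv.2.2 K)⟩

theorem finite_PsiSub : Module.Finite ℝ (PsiSub hΩo hΩb X Y) := by
  refine finite_of_linear_relation _ (A := ∀ K, C1PolyData (M.elt K))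
    (fun v D => ∀ K, C1PolyRel (M.elt K) v (D K)) (fun c u v D D' _ _ h h' K => ?_)
    (fun v hv => ?_) (fun v _ h => ?_)
  · exact ((h K).lincomb (X K) (Y K) c (h' K)).congr (coeFn_lincomb_elt K c u v).symm
  · choose D hD using fun K => isC1Poly_iff.1 (hv.2.2 K)
    exact ⟨D, fun K => (hD K).congr (coeFn_toL2_elt K v)⟩
  · exact M.eq_zero_of_forall_elt fun K => (h K).eq_zero (X K) (Y K)

variable {sΔ : ∀ K, L2 (M.elt K).carrier → L2 (M.elt K).carrier → ℝ}

theorem isBilinOn_aHess (hs : ∀ K, IsBilinOn (Psiloc (M.elt K)) (sΔ K)) :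
    IsBilinOn (PsiSub hΩo hΩb X Y : Set (L2 Ω)) (M.aHess sΔ) :=
  isBilinOn_sum (S := PsiSub hΩo hΩb X Y) (T := fun K => PsilocSub (X K) (Y K)) (fun _ hv K => hv.2.2 K)
    fun K => isBilinOn_locHess (X K) (Y K) (hs K)

include hΩb X Y in
-- As for the gradient form, with global `H²` regularity identifying local and global second
-- derivatives; only the pure ones `∂ᵢ∂ᵢ` are needed.
theorem eq_zero_of_aHess {α₀ α₁ : ℝ} (hα : 0 < α₀)
    (hs : ∀ K, IsHessStab (M.elt K) α₀ α₁ (sΔ K)) {v : L2 Ω} (hv : v ∈ M.Psi)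
    (h : M.aHess sΔ v v = 0) : v = 0 := by
  refine eq_zero_of_weakDeriv hΩb hv.2.1 fun i => weakDeriv_eq_zero_of_memH10 hv.1 hv.2.1 i
    (M.ae_of_forall_elt fun K => ?_)
  have hK := (Finset.sum_eq_zero_iff_of_nonneg fun K _ =>
    locHess_nonneg (X K) (Y K) hα (hs K) (hv.2.2 K)).1 h K (Finset.mem_univ K)
  have h1 := weakDeriv_eq_zero_of_locHess (X K) (Y K) hα (hs K) (hv.2.2 K) hK i i
  rw [weakDeriv_congr (coeFn_toL2_elt K v),
    weakDeriv_congr (hv.1.1.weakDeriv_mono (M.elt K).isOpen (M.subset K) i)] at h1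
  exact ((hv.1.2 i).weakDeriv_mono (M.elt K).isOpen (M.subset K) i).symm.trans h1

end

end Mesh

/-- A problem that is posed on a product and whose equation is the sum of two separate equations
decouples. -/
theorem decoupled_iff {H H' : Type*} [AddCommGroup H] [Module ℝ H] [AddCommGroup H'] [Module ℝ H']
    {S : Submodule ℝ H} {S' : Submodule ℝ H'} {a l : H → ℝ} {b m : H' → ℝ} (ha : IsLinOn S a)
    (hl : IsLinOn S l) (hb : IsLinOn S' b) (hm : IsLinOn S' m) :
    (∀ v ∈ S, ∀ ψ ∈ S', b ψ + a v + m ψ = l v) ↔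
      (∀ v ∈ S, a v = l v) ∧ (∀ ψ ∈ S', b ψ = - m ψ) := by
  refine ⟨fun h => ⟨fun v hv => ?_, fun ψ hψ => ?_⟩, fun h v hv ψ hψ => ?_⟩
  · simpa [hb.map_zero, hm.map_zero] using h v hv 0 S'.zero_mem
  · have := h 0 S.zero_mem ψ hψ
    rw [ha.map_zero, hl.map_zero] at this
    linarith
  · linarith [h.1 v hv, h.2 ψ hψ]

end VEM
end

/-! ### Assembly of the main theorem. -/

theorem mainTheorem6
    (Ω : Set (VEM.E 3)) (hΩo : IsOpen Ω) (hΩc : IsConnected Ω) (hΩb : Bornology.IsBounded Ω)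
    (M : VEM.Mesh Ω) (ρ : ℝ) (hρ : 0 < ρ) (hM : M.ShapeRegular ρ)
    (α₀ α₁ β₀ β₁ : ℝ) (hα₀ : 0 < α₀) (hα₁ : 0 < α₁) (hβ₀ : 0 < β₀) (hβ₁ : 0 < β₁)
    (sΔ sG : ∀ K, VEM.L2 (M.elt K).carrier → VEM.L2 (M.elt K).carrier → ℝ)
    (hsΔ : ∀ K, VEM.IsHessStab (M.elt K) α₀ α₁ (sΔ K))
    (hsG : ∀ K, VEM.IsGradStab (M.elt K) β₀ β₁ (sG K))
    (f : VEM.L2 Ω) :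
    -- the discrete formulation has exactly one solution in `V_h × Ψ_h`
    (∃! z : VEM.L2 Ω × VEM.L2 Ω, (z.1 ∈ M.V ∧ z.2 ∈ M.Psi) ∧
      ∀ v ∈ M.V, ∀ ψ ∈ M.Psi,
        M.aHess sΔ z.2 ψ + M.aGrad sG z.1 v + M.aMass z.1 ψ = M.load f v) ∧
    -- the formulation decouples into two problems
    (∀ σ ∈ M.V, ∀ u ∈ M.Psi,
      ((∀ v ∈ M.V, ∀ ψ ∈ M.Psi,
          M.aHess sΔ u ψ + M.aGrad sG σ v + M.aMass σ ψ = M.load f v) ↔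
        (∀ v ∈ M.V, M.aGrad sG σ v = M.load f v) ∧
        (∀ ψ ∈ M.Psi, M.aHess sΔ u ψ = - M.aMass σ ψ))) ∧
    -- each of which is uniquely solvable
    (∃! σ, σ ∈ M.V ∧ ∀ v ∈ M.V, M.aGrad sG σ v = M.load f v) ∧
    (∀ σ ∈ M.V, ∃! u, u ∈ M.Psi ∧ ∀ ψ ∈ M.Psi, M.aHess sΔ u ψ = - M.aMass σ ψ) := by
  have X := fun K => Classical.choice (hM.exists_elt hρ K)
  have Y := fun K f => Classical.choice (hM.exists_face hρ K f)
  let SV : Submodule ℝ (VEM.L2 Ω) := VEM.Mesh.VSub hΩo hΩb X Y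
  let SΨ : Submodule ℝ (VEM.L2 Ω) := VEM.Mesh.PsiSub hΩo hΩb X Y
  have : Module.Finite ℝ SV := VEM.Mesh.finite_VSub hΩo hΩb X Y
  have : Module.Finite ℝ SΨ := VEM.Mesh.finite_PsiSub hΩo hΩb X Y
  have hG := VEM.Mesh.isBilinOn_aGrad hΩo hΩb X Y fun K => (hsG K).bilin
  have hH := VEM.Mesh.isBilinOn_aHess hΩo hΩb X Y fun K => (hsΔ K).bilin
  have h1 : ∃! σ, σ ∈ M.V ∧ ∀ v ∈ M.V, M.aGrad sG σ v = M.load f v :=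
    VEM.existsUnique_of_definite SV hG
      (fun v hv => VEM.Mesh.eq_zero_of_aGrad hΩb X Y hβ₀ hsG hv) (M.isLinOn_load SV f)
  have h2 : ∀ σ ∈ M.V, ∃! u, u ∈ M.Psi ∧ ∀ ψ ∈ M.Psi, M.aHess sΔ u ψ = - M.aMass σ ψ :=
    fun σ _ => VEM.existsUnique_of_definite SΨ hH
      (fun v hv => VEM.Mesh.eq_zero_of_aHess hΩb X Y hα₀ hsΔ hv) (M.isLinOn_aMass SΨ σ).neg
  have h3 : ∀ σ ∈ M.V, ∀ u ∈ M.Psi,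
      ((∀ v ∈ M.V, ∀ ψ ∈ M.Psi,
          M.aHess sΔ u ψ + M.aGrad sG σ v + M.aMass σ ψ = M.load f v) ↔
        (∀ v ∈ M.V, M.aGrad sG σ v = M.load f v) ∧
        (∀ ψ ∈ M.Psi, M.aHess sΔ u ψ = - M.aMass σ ψ)) := fun σ hσ u hu =>
    VEM.decoupled_iff (S := SV) (S' := SΨ) (hG.isLinOn hσ) (M.isLinOn_load SV f)
      (hH.isLinOn hu) (M.isLinOn_aMass SΨ σ)
  refine ⟨?_, h3, h1, h2⟩
  -- The decoupled problems are solved successively. For uniqueness, any solution of the coupled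
  -- problem solves both, which fixes first `σ'` and then `u'`.
  obtain ⟨σ, ⟨hσ, hσ1⟩, hσ2⟩ := h1
  obtain ⟨u, ⟨hu, hu1⟩, hu2⟩ := h2 σ hσ
  refine ⟨(σ, u), ⟨⟨hσ, hu⟩, (h3 σ hσ u hu).2 ⟨hσ1, hu1⟩⟩, ?_⟩
  rintro ⟨σ', u'⟩ ⟨⟨hσ', hu'⟩, h⟩
  obtain ⟨e1, e2⟩ := (h3 σ' hσ' u' hu').1 h
  obtain rfl : σ' = σ := hσ2 σ' ⟨hσ', e1⟩
  obtain rfl : u' = u := hu2 u' ⟨hu', e2⟩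
  rfl
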